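/- Let $M$ be a closed (compact, without boundary) oriented smooth manifold of dimension $n\ge 2$, let $g$ be a smooth semi-Riemannian metric on $M$ (a smooth symmetric $2$-covariant tensor field that is non-degenerate at every point; the Riemannian case is included), and let $f$ be a smooth real-valued function on $M$. Let $$\mathrm{Ric}_f^1=\mathrm{Ric}+\mathrm{Hess} f-df\otimes df$$ be the $1$-Bakry–Émery Ricci tensor, where $\mathrm{Ric}$ is the Ricci tensor of $g$ and $\mathrm{Hess} f$ is the Hessian of $f$ with respect to the Levi-Civita connection of $g$, let $dV_g$ be the canonical volume form of $g$, and put $$\mathcal L(g,f)=\int_M \mathrm{tr}_g\big(\mathrm{Ric}_f^1\big)\,dV_g .$$ Call $(g,f)$ a critical point of $\mathcal L$ if for every smooth symmetric $2$-covariant tensor field $s$ on $M$ and every smooth function $h$ on $M$ the function $t\mapsto\mathcal L(g+ts,\,f+th)$, which is defined for all sufficiently small $|t|$, is differentiable at $t=0$ with derivative $0$. Then $(g,f)$ is a critical point of $\mathcal L$ if and only if $$\mathrm{Ric}-\tfrac12 R\,g = df\otimes df-\tfrac12|\nabla f|^2\,g \qquad\text{and}\qquad \Delta f=0$$ on $M$,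 where $R=\mathrm{tr}_g\mathrm{Ric}$ is the scalar curvature, $\nabla f$ is the gradient of $f$ with respect to $g$, $|\nabla f|^2=g(\nabla f,\nabla f)$, and $\Delta f=\mathrm{tr}_g(\mathrm{Hess} f)$. -/

import Mathlib

open scoped Manifold ContDiff

noncomputable section

namespace BakryEmery

/-! ### Local (coordinate) differential geometry on an open piece of `ℝⁿ` -/

/-- The model space `ℝⁿ`. -/
abbrev Model (n : ℕ) : Type := EuclideanSpace ℝ (Fin n)

/-- Bilinear forms on `ℝⁿ`. -/
abbrev ModelForm (n : ℕ) : Type := Model n →L[ℝ] Model n →L[ℝ] ℝ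

section Local

variable {n : ℕ}

/-- The Christoffel symbols of the first kind of a metric `G` given in coordinates:
`(u, v) ↦ (w ↦ ½ (∂_u G(v, w) + ∂_v G(u, w) - ∂_w G(u, v)))`. -/
def christoffelFirst (G : Model n → ModelForm n) (y : Model n) :
    Model n →L[ℝ] Model n →L[ℝ] Model n →L[ℝ] ℝ :=
  (LinearMap.mk₂ ℝ
    (fun u v => (1 / 2 : ℝ) •
      (fderiv ℝ G y u v + fderiv ℝ G y v u - ((fderiv ℝ G y).flip u).flip v))
    (by intros; ext; simp; ring) (by intros; ext; simp; ring)
    (by intros; ext; simp; ring) (by intros; ext; simp; ring)).toContinuousBilinearMap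

theorem christoffelFirst_apply (G : Model n → ModelForm n) (y u v w : Model n) :
    christoffelFirst G y u v w =
      1 / 2 * (fderiv ℝ G y u v w + fderiv ℝ G y v u w - fderiv ℝ G y w u v) := by
  simp [christoffelFirst]

/-- The Christoffel symbols `Γ(u, v) = u^i v^j Γ_{ij}^k ∂_k`, i.e. the vector which satisfies
`G(Γ(u, v), w) = ½ (∂_u G(v, w) + ∂_v G(u, w) - ∂_w G(u, v))` for all `w`. -/
def christoffel (G : Model n → ModelForm n) (y : Model n) :
    Model n →L[ℝ] Model n →L[ℝ] Model n :=
  (ContinuousLinearMap.compL ℝ (Model n) (Model n →L[ℝ] ℝ) (Model n) (G y).inverse) ∘L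
    christoffelFirst G y

/-- The endomorphism `u ↦ R(u, v) w`, where `R(u, v) w` is the curvature
`∂_u Γ(v, w) - ∂_v Γ(u, w) + Γ(u, Γ(v, w)) - Γ(v, Γ(u, w))`. -/
def curvatureEnd (G : Model n → ModelForm n) (y v w : Model n) : Model n →L[ℝ] Model n :=
  ((fderiv ℝ (christoffel G) y).flip v).flip w - (fderiv ℝ (christoffel G) y v).flip w
    + (christoffel G y).flip (christoffel G y v w)
    - christoffel G y v ∘L (christoffel G y).flip w

theorem curvatureEnd_apply (G : Model n → ModelForm n) (y u v w : Model n) :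
    curvatureEnd G y v w u =
      fderiv ℝ (christoffel G) y u v w - fderiv ℝ (christoffel G) y v u w
        + christoffel G y u (christoffel G y v w) - christoffel G y v (christoffel G y u w) := by
  simp [curvatureEnd]

/-- The Ricci tensor in coordinates, `Ric(v, w) = tr (u ↦ R(u, v) w)`. -/
def localRicci (G : Model n → ModelForm n) (y : Model n) : ModelForm n :=
  (LinearMap.mk₂ ℝ
    (fun v w => LinearMap.trace ℝ (Model n) (curvatureEnd G y v w).toLinearMap)
    (by
      intro v v' w
      rw [← map_add]; congr 1; ext1 u
      simp [curvatureEnd_apply]; abel)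
    (by
      intro c v w
      rw [← map_smul]; congr 1; ext1 u
      simp [curvatureEnd_apply, smul_sub, smul_add])
    (by
      intro v w w'
      rw [← map_add]; congr 1; ext1 u
      simp [curvatureEnd_apply]; abel)
    (by
      intro c v w
      rw [← map_smul]; congr 1; ext1 u
      simp [curvatureEnd_apply, smul_sub, smul_add])).toContinuousBilinearMap

theorem localRicci_apply (G : Model n → ModelForm n) (y v w : Model n) :
    localRicci G y v w = LinearMap.trace ℝ (Model n) (curvatureEnd G y v w).toLinearMap := by
  simp [localRicci]

/-- The Hessian in coordinates, `Hess F(u, v) = ∂_u ∂_v F - ∂_{Γ(u, v)} F`. -/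
def localHessian (G : Model n → ModelForm n) (F : Model n → ℝ) (y : Model n) : ModelForm n :=
  fderiv ℝ (fderiv ℝ F) y -
    (ContinuousLinearMap.compL ℝ (Model n) (Model n) ℝ (fderiv ℝ F y)) ∘L christoffel G y

end Local

/-! ### Tensors on a manifold -/

variable {n : ℕ} {M : Type*} [TopologicalSpace M] [ChartedSpace (Model n) M]

/-- The differential at `x` of the preferred chart at `p`: it sends a tangent vector to its vector
of components. -/
def chartDeriv (p x : M) : TangentSpace 𝓘(ℝ, Model n) x →L[ℝ] Model n :=
  mvfderiv 𝓘(ℝ, Model n) (chartAt (Model n) p) x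

/-- The differential at `y` of the inverse of the preferred chart at `p`: it sends the `i`-th
standard basis vector to the coordinate vector `∂_i`. -/
def chartSymmDeriv (p : M) (y : Model n) :
    Model n →L[ℝ] TangentSpace 𝓘(ℝ, Model n) ((chartAt (Model n) p).symm y) :=
  mfderiv 𝓘(ℝ, Model n) 𝓘(ℝ, Model n) (chartAt (Model n) p).symm y ∘L
    (NormedSpace.fromTangentSpace y).symm.toContinuousLinearMap

/-- The coordinate frame `∂_1, …, ∂_n` of the chart at `p`, at the point with coordinates `y`. -/
def coordFrame (p : M) (y : Model n) (i : Fin n) :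
    TangentSpace 𝓘(ℝ, Model n) ((chartAt (Model n) p).symm y) :=
  chartSymmDeriv p y (EuclideanSpace.single i 1)

/-- Bilinear forms on the tangent space at `x`. -/
abbrev TangentForm (n : ℕ) {M : Type*} [TopologicalSpace M] [ChartedSpace (Model n) M] (x : M) :
    Type :=
  TangentSpace 𝓘(ℝ, Model n) x →L[ℝ] TangentSpace 𝓘(ℝ, Model n) x →L[ℝ] ℝ

/-- The bilinear form at `x` whose components in the preferred chart at `x` are given by `B`. -/
def ofModelForm (x : M) (B : ModelForm n) : TangentForm n x :=
  (ContinuousLinearMap.precomp ℝ (chartDeriv x x)) ∘L B ∘L chartDeriv x x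

/-- The differential of a function, as a field of covectors. -/
abbrev differential (f : M → ℝ) (x : M) : TangentSpace 𝓘(ℝ, Model n) x →L[ℝ] ℝ :=
  mvfderiv 𝓘(ℝ, Model n) f x

/-- The tensor product `α ⊗ β` of two covectors. -/
def covectorTensor {x : M} (α β : TangentSpace 𝓘(ℝ, Model n) x →L[ℝ] ℝ) : TangentForm n x :=
  α.smulRight β

/-- Real valued smooth functions on `M`. -/
abbrev SmoothFun (n : ℕ) (M : Type*) [TopologicalSpace M] [ChartedSpace (Model n) M] : Type _ :=
  C^∞⟮𝓘(ℝ, Model n), M; ℝ⟯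

variable [IsManifold 𝓘(ℝ, Model n) ∞ M]

/-- Smooth 2-covariant tensor fields on `M`. -/
abbrev TwoTensor (n : ℕ) (M : Type*) [TopologicalSpace M] [ChartedSpace (Model n) M]
    [IsManifold 𝓘(ℝ, Model n) ∞ M] : Type _ :=
  Cₛ^∞⟮𝓘(ℝ, Model n); ModelForm n, fun x : M => TangentForm n x⟯

/-- A 2-covariant tensor field is symmetric. -/
def IsSymmTensor (s : TwoTensor n M) : Prop :=
  ∀ x v w, s x v w = s x w v

/-- A semi-Riemannian metric: a smooth symmetric 2-tensor field, non-degenerate at each point. -/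
structure IsSemiRiemannian (g : TwoTensor n M) : Prop where
  symm : IsSymmTensor g
  nondegenerate : ∀ x v, (∀ w, g x v w = 0) → v = 0

/-- The representation `g_{ij}` of `g` in the chart at `p`, as a function of the coordinates. -/
def localMetric (g : TwoTensor n M) (p : M) (y : Model n) : ModelForm n :=
  (ContinuousLinearMap.precomp ℝ (chartSymmDeriv p y)) ∘L
    g ((chartAt (Model n) p).symm y) ∘L chartSymmDeriv p y

/-- The Ricci tensor of `g`. -/
def ricci (g : TwoTensor n M) (x : M) : TangentForm n x :=
  ofModelForm x (localRicci (localMetric g x) (chartAt (Model n) x x))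

/-- The Hessian of `f`. -/
def hessian (g : TwoTensor n M) (f : SmoothFun n M) (x : M) : TangentForm n x :=
  ofModelForm x (localHessian (localMetric g x) (f ∘ (chartAt (Model n) x).symm)
    (chartAt (Model n) x x))

/-- The trace of a bilinear form with respect to `g`, i.e. `g^{ij} B_{ij}`. -/
def metricTrace (g : TwoTensor n M) (x : M) (B : TangentForm n x) : ℝ :=
  LinearMap.trace ℝ (TangentSpace 𝓘(ℝ, Model n) x) ((g x).inverse ∘L B).toLinearMap

/-- The scalar curvature. -/
def scalarCurvature (g : TwoTensor n M) (x : M) : ℝ :=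
  metricTrace g x (ricci g x)

/-- The Laplacian `tr_g (Hess f)`. -/
def laplacian (g : TwoTensor n M) (f : SmoothFun n M) (x : M) : ℝ :=
  metricTrace g x (hessian g f x)

/-- The gradient of `f`, i.e. the vector field which satisfies `g(∇f, ·) = df`. -/
def metricGradient (g : TwoTensor n M) (f : SmoothFun n M) (x : M) : TangentSpace 𝓘(ℝ, Model n) x :=
  (g x).inverse (differential f x)

/-- `|∇f|² = g(∇f, ∇f)`, which may be negative for an indefinite metric. -/
def gradientSq (g : TwoTensor n M) (f : SmoothFun n M) (x : M) : ℝ :=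
  g x (metricGradient g f x) (metricGradient g f x)

/-- The `m`-Bakry–Émery Ricci tensor `Ric + Hess f - (1/m) df ⊗ df`. -/
def bakryEmeryRicci (m : ℝ) (g : TwoTensor n M) (f : SmoothFun n M) (x : M) : TangentForm n x :=
  ricci g x + hessian g f x - (1 / m) • covectorTensor (differential f x) (differential f x)

/-! ### Orientations and integration of top degree forms -/

/-- The sign of the coordinate frame of the chart at `p`, at the point with coordinates `y`,
with respect to a pointwise orientation of the tangent spaces. -/
def frameSign (o : ∀ x : M, Orientation ℝ (TangentSpace 𝓘(ℝ, Model n) x) (Fin n))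
    (p : M) (y : Model n) : SignType :=
  SignType.sign ((o ((chartAt (Model n) p).symm y)).someVector (coordFrame p y))

variable (n M) in
/-- An orientation of `M`: an orientation of each tangent space, such that in each chart the sign
of the coordinate frame is locally constant. -/
structure ManifoldOrientation where
  orientation : ∀ x : M, Orientation ℝ (TangentSpace 𝓘(ℝ, Model n) x) (Fin n)
  locallyConstant : ∀ p : M, ∀ y ∈ (chartAt (Model n) p).target,
    ∀ᶠ z in nhds y, frameSign orientation p z = frameSign orientation p y

/-- The canonical volume form `dV_g` of `g` on an oriented manifold: the positive multiple `α` of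
the orientation such that `|α(∂_1, …, ∂_n)| = √|det g(∂_i, ∂_j)|`, where the right-hand side is
evaluated in the coordinate frame of the preferred chart at the point. -/
def volumeForm (o : ManifoldOrientation n M) (g : TwoTensor n M) (x : M) :
    TangentSpace 𝓘(ℝ, Model n) x [⋀^Fin n]→ₗ[ℝ] ℝ :=
  let e : Fin n → TangentSpace 𝓘(ℝ, Model n) x := fun i =>
    (chartDeriv x x).inverse (EuclideanSpace.single i 1)
  (√|Matrix.det (Matrix.of fun i j => g x (e i) (e j))| / |(o.orientation x).someVector e|) •
    (o.orientation x).someVector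

variable [CompactSpace M] [T2Space M]

variable (n M) in
/-- A smooth partition of unity subordinate to the domains of the preferred charts. -/
def chartPartition : SmoothPartitionOfUnity M 𝓘(ℝ, Model n) M Set.univ :=
  (SmoothPartitionOfUnity.exists_isSubordinate_chartAt_source 𝓘(ℝ, Model n) M).choose

/-- The integral of a form of top degree over a closed oriented manifold:
`∑_p ∫ ρ_p α(∂_1, …, ∂_n) dy¹ ⋯ dyⁿ`, where `ρ` is a partition of unity subordinate to charts, and
where the contribution of a chart is taken with the sign of its coordinate frame. -/
def integralForm (o : ManifoldOrientation n M)
    (α : ∀ x : M, TangentSpace 𝓘(ℝ, Model n) x [⋀^Fin n]→ₗ[ℝ] ℝ) : ℝ :=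
  ∑ᶠ p : M, ∫ y in (chartAt (Model n) p).target,
    chartPartition n M p ((chartAt (Model n) p).symm y) *
      ((frameSign o.orientation p y : ℝ) * α ((chartAt (Model n) p).symm y) (coordFrame p y))

/-- The functional `L(g, f) = ∫_M tr_g(Ric_f^1) dV_g`. -/
def hilbertAction (o : ManifoldOrientation n M) (g : TwoTensor n M) (f : SmoothFun n M) : ℝ :=
  integralForm o fun x => metricTrace g x (bakryEmeryRicci 1 g f x) • volumeForm o g x

/-- `(g, f)` is a critical point of the functional: for each symmetric 2-tensor field `s` and each
function `h`, the derivative of `t ↦ L(g + t s, f + t h)` at `t = 0` exists and vanishes. -/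
def IsCriticalPoint (o : ManifoldOrientation n M) (g : TwoTensor n M) (f : SmoothFun n M) : Prop :=
  ∀ s : TwoTensor n M, IsSymmTensor s → ∀ h : SmoothFun n M,
    HasDerivAt (fun t : ℝ => hilbertAction o (g + t • s) (f + t • h)) 0 0

end BakryEmery

end

/-!
The action is computed in charts. With a partition of unity `ρ_p`, the sign of each coordinate
frame cancels against the orientation (`integrand_eq_localDensity`), and
`L(g, f) = ∑_p ∫ ρ_p √|det G| tr_G (Ric + Hess F - dF ⊗ dF)`, where `G` and `F` are the components
of `g` and `f` in the chart at `p`. It remains to differentiate this in `t` for `(g + t s, f + t h)`.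

The pointwise variation is an identity between polynomials in the derivatives of the components.
It is proved in a commutative ring with commuting derivations `∂_k` and `δ = d/dt`, with the
components of the metric, of its inverse and the volume density as elements. The only facts used
are that the densitized inverse metric `√|det G| G^{vw}` is parallel for the Levi-Civita connection
and the Palatini identity (`IsParallelDensity.sum_mul_deriv_ricci`). The result
(`IsParallelDensity.deriv_lagrangian`) is that the variation is the sum of a tensorial part, linear
in the values of `s` and `h`, and a divergence. The ring is then taken to be that of the functions
of `(t, y)` which are smooth where `G + t S` is non-degenerate
(`IsVariation.evalAt_zero_timeDeriv_lagrangianElt`).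

The local tensors are natural under changes of coordinates (`IsLocalIsometry`), which makes the
integrand, its variation, the tensorial part and hence the divergence part densities on `M`. A
density supported in one chart may be integrated in that chart
(`IsDensity.integralDensity_eq_of_support`). The divergence part is linear in `(s, h)`; decomposing
`(s, h)` by the partition of unity and using the divergence theorem in each chart, its integral is
zero (`integralDensity_divergenceFamily`). So the first variation of the action is the integral of
the tensorial part (`hasDerivAt_hilbertAction`), which is `e dV_g` for the function
`e = 2 h Δf + ½ tr(s) tr(C) - ⟨s, C⟩`, where `C = Ric - df ⊗ df`.

If `Δf = 0` and `C = ½ tr(C) g`, which is the field equation since `tr(C) = R - |∇f|²`, then `e = 0`.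
Conversely, at a critical point the test variations which in a chart are `χ` times constant
components, for arbitrary bump functions `χ`, show that `e` vanishes pointwise for constant
components (`IsCriticalPoint.eulerDensity_eq_zero`). Taking `s = 0` gives `Δf = 0`, and taking
`h = 0` and `s = g(u, ·) ⊗ g(u, ·)` at a point gives `C(u, u) = ½ tr(C) g(u, u)` for each vector
`u`, hence `C = ½ tr(C) g`, as both sides are symmetric (`eq_smul_of_forall_trace_eq`).
-/

noncomputable section

-- The norm on the space of bilinear forms is found only at this depth.
set_option maxSynthPendingDepth 3

namespace BakryEmery

/-! ### Tensor calculus with indices in a differential ring -/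

section DifferentialRing

variable {A : Type*} [CommRing A] [Algebra ℝ A] {ι : Type*} [Fintype ι]

/-- The Christoffel symbols of the first kind of the matrix `g`, for derivations `D i` which play
the role of the partial derivatives. -/
def ringChristoffelFirst (D : ι → Derivation ℝ A A) (g : ι → ι → A) (i j k : ι) : A :=
  (1 / 2 : ℝ) • (D i (g j k) + D j (g i k) - D k (g i j))

/-- The Christoffel symbols `Γ^k_{ij}`, written `Γ k i j`, where `h` is the inverse of `g`. -/
def ringChristoffel (D : ι → Derivation ℝ A A) (g h : ι → ι → A) (k i j : ι) : A :=
  ∑ l, h k l * ringChristoffelFirst D g i j l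

/-- The Ricci tensor of a connection with Christoffel symbols `Γ`. -/
def ringRicci (D : ι → Derivation ℝ A A) (Γ : ι → ι → ι → A) (v w : ι) : A :=
  ∑ k, D k (Γ k v w) - ∑ k, D v (Γ k k w) + ∑ k, ∑ l, Γ k k l * Γ l v w
    - ∑ k, ∑ l, Γ k v l * Γ l k w

/-- The Hessian of `F` for a connection with Christoffel symbols `Γ`. -/
def ringHessian (D : ι → Derivation ℝ A A) (Γ : ι → ι → ι → A) (F : A) (v w : ι) : A :=
  D v (D w F) - ∑ k, D k F * Γ k v w

/-- `H` is covariantly constant as a symmetric bivector density of weight one for the connection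
with Christoffel symbols `Γ`. -/
def IsParallelDensity (D : ι → Derivation ℝ A A) (Γ : ι → ι → ι → A) (H : ι → ι → A) : Prop :=
  ∀ k v w, D k (H v w) =
    H v w * ∑ j, Γ j j k - ∑ j, Γ v k j * H j w - ∑ j, Γ w k j * H j v

variable {D : ι → Derivation ℝ A A} {Γ : ι → ι → ι → A} {H g h : ι → ι → A}

omit [Algebra ℝ A] in
theorem sum₃_rotate (f : ι → ι → ι → A) :
    ∑ a, ∑ b, ∑ c, f a b c = ∑ c, ∑ a, ∑ b, f a b c := by
  calc _ = ∑ a, ∑ c, ∑ b, f a b c := Finset.sum_congr rfl fun _ _ => Finset.sum_comm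
    _ = _ := Finset.sum_comm

/-- The divergence of a parallel density: the terms with `Γ^j_{jk}` cancel. -/
theorem IsParallelDensity.sum_deriv (hH : IsParallelDensity D Γ H) (w : ι) :
    ∑ k, D k (H k w) = -∑ k, ∑ j, Γ w k j * H j k := by
  have e : ∑ k, H k w * ∑ j, Γ j j k = ∑ k, ∑ j, Γ k k j * H j w := by
    simp only [Finset.mul_sum]
    rw [Finset.sum_comm]
    exact Finset.sum_congr rfl fun _ _ => Finset.sum_congr rfl fun _ _ => mul_comm _ _
  simp only [hH _ _ _, Finset.sum_sub_distrib, e]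
  ring

/-- The Laplacian in divergence form. -/
theorem IsParallelDensity.sum_mul_hessian (hH : IsParallelDensity D Γ H)
    (hs : ∀ v w, H v w = H w v) (F : A) :
    ∑ v, ∑ w, H v w * ringHessian D Γ F v w = ∑ k, D k (∑ w, H k w * D w F) := by
  simp only [map_sum, Derivation.leibniz, smul_eq_mul, ringHessian, mul_sub,
    Finset.sum_sub_distrib, Finset.sum_add_distrib, Finset.mul_sum]
  have e : ∑ k, ∑ w, D w F * D k (H k w) = -∑ v, ∑ w, ∑ k, H v w * (D k F * Γ k v w) := by
    rw [Finset.sum_comm, sum₃_rotate, ← Finset.sum_neg_distrib]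
    refine Finset.sum_congr rfl fun w _ => ?_
    rw [← Finset.mul_sum, hH.sum_deriv]
    rw [mul_neg, Finset.mul_sum]
    congr 1
    refine Finset.sum_congr rfl fun a _ => ?_
    rw [Finset.mul_sum]
    refine Finset.sum_congr rfl fun b _ => ?_
    rw [hs a b]; ring
  rw [e]; ring

/-- The Palatini identity: the variation of the Ricci tensor, contracted with a parallel density,
is a divergence. -/
theorem IsParallelDensity.sum_mul_deriv_ricci (hH : IsParallelDensity D Γ H)
    (hs : ∀ v w, H v w = H w v) (hΓ : ∀ k i j, Γ k i j = Γ k j i)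
    {δ : Derivation ℝ A A} (hδ : ∀ k a, δ (D k a) = D k (δ a)) :
    ∑ v, ∑ w, H v w * δ (ringRicci D Γ v w) =
      ∑ k, D k (∑ v, ∑ w, H v w * δ (Γ k v w) - ∑ w, H k w * ∑ j, δ (Γ j j w)) := by
  have e3 : ∑ w, (∑ j, δ (Γ j j w)) * ∑ k, D k (H k w) =
      -∑ v, ∑ w, H v w * ∑ k, ∑ l, δ (Γ k k l) * Γ l v w := by
    simp only [hH.sum_deriv, mul_neg, Finset.sum_neg_distrib]
    congr 1
    simp only [Finset.mul_sum, Finset.sum_mul]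
    calc _ = ∑ l, ∑ v, ∑ w, ∑ k, H v w * (δ (Γ k k l) * Γ l v w) := by
          refine Finset.sum_congr rfl fun l _ => Finset.sum_congr rfl fun v _ =>
            Finset.sum_congr rfl fun w _ => Finset.sum_congr rfl fun k _ => ?_
          rw [hs v w]; ring
      _ = ∑ v, ∑ w, ∑ l, ∑ k, H v w * (δ (Γ k k l) * Γ l v w) :=
          (sum₃_rotate fun v w l => ∑ k, H v w * (δ (Γ k k l) * Γ l v w)).symm
      _ = _ := Finset.sum_congr rfl fun v _ => Finset.sum_congr rfl fun w _ => Finset.sum_comm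
  have e4 : ∑ k, ∑ v, ∑ w, δ (Γ k v w) * (H v w * ∑ j, Γ j j k) =
      ∑ v, ∑ w, H v w * ∑ k, ∑ l, Γ k k l * δ (Γ l v w) := by
    rw [← sum₃_rotate]
    refine Finset.sum_congr rfl fun v _ => Finset.sum_congr rfl fun w _ => ?_
    simp only [Finset.mul_sum]
    rw [Finset.sum_comm]
    refine Finset.sum_congr rfl fun k _ => Finset.sum_congr rfl fun l _ => ?_
    ring
  have e5 : ∑ k, ∑ v, ∑ w, δ (Γ k v w) * ∑ j, Γ w k j * H j v =
      ∑ v, ∑ w, H v w * ∑ k, ∑ l, δ (Γ k v l) * Γ l k w := by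
    simp only [Finset.mul_sum]
    calc _ = ∑ v, ∑ k, ∑ l, ∑ w, H v w * (δ (Γ k v l) * Γ l k w) := by
          rw [Finset.sum_comm]
          refine Finset.sum_congr rfl fun v _ => Finset.sum_congr rfl fun k _ =>
            Finset.sum_congr rfl fun w _ => Finset.sum_congr rfl fun j _ => ?_
          rw [hs v j]; ring
      _ = _ := Finset.sum_congr rfl fun v _ => sum₃_rotate _
  have e6 : ∑ k, ∑ v, ∑ w, δ (Γ k v w) * ∑ j, Γ v k j * H j w =
      ∑ v, ∑ w, H v w * ∑ k, ∑ l, Γ k v l * δ (Γ l k w) := by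
    simp only [Finset.mul_sum]
    calc _ = ∑ l, ∑ k, ∑ v, ∑ w, H v w * (Γ k v l * δ (Γ l k w)) := by
          refine Finset.sum_congr rfl fun v _ => Finset.sum_congr rfl fun k _ => ?_
          rw [Finset.sum_comm]
          refine Finset.sum_congr rfl fun w _ => Finset.sum_congr rfl fun j _ => ?_
          rw [hΓ k w v]; ring
      _ = ∑ k, ∑ v, ∑ w, ∑ l, H v w * (Γ k v l * δ (Γ l k w)) := by
          rw [Finset.sum_comm]
          refine Finset.sum_congr rfl fun k _ => ?_
          exact (sum₃_rotate fun v w l => H v w * (Γ k v l * δ (Γ l k w))).symm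
      _ = _ := (sum₃_rotate fun v w k => ∑ l, H v w * (Γ k v l * δ (Γ l k w))).symm
  have e1 : ∑ v, ∑ w, H v w * ∑ k, D k (δ (Γ k v w)) =
      ∑ k, ∑ v, ∑ w, H v w * D k (δ (Γ k v w)) := by
    rw [← sum₃_rotate]; simp only [Finset.mul_sum]
  have e3' : ∑ k, ∑ w, (∑ j, δ (Γ j j w)) * D k (H k w) =
      ∑ w, (∑ j, δ (Γ j j w)) * ∑ k, D k (H k w) := by
    rw [Finset.sum_comm]; simp only [Finset.mul_sum]
  have lhs : ∑ v, ∑ w, H v w * δ (ringRicci D Γ v w) =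
      ∑ v, ∑ w, H v w * ∑ k, D k (δ (Γ k v w)) - ∑ v, ∑ w, H v w * ∑ k, D v (δ (Γ k k w))
      + (∑ v, ∑ w, H v w * ∑ k, ∑ l, δ (Γ k k l) * Γ l v w
        + ∑ v, ∑ w, H v w * ∑ k, ∑ l, Γ k k l * δ (Γ l v w))
      - (∑ v, ∑ w, H v w * ∑ k, ∑ l, δ (Γ k v l) * Γ l k w
        + ∑ v, ∑ w, H v w * ∑ k, ∑ l, Γ k v l * δ (Γ l k w)) := by
    simp only [← Finset.sum_add_distrib, ← Finset.sum_sub_distrib, ← mul_add, ← mul_sub]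
    refine Finset.sum_congr rfl fun v _ => Finset.sum_congr rfl fun w _ => ?_
    congr 1
    simp only [ringRicci, map_sub, map_add, map_sum, Derivation.leibniz, smul_eq_mul, hδ,
      Finset.sum_add_distrib, Finset.sum_sub_distrib, mul_comm (δ _)]
    ring
  have rhs : ∑ k, D k (∑ v, ∑ w, H v w * δ (Γ k v w) - ∑ w, H k w * ∑ j, δ (Γ j j w)) =
      ∑ k, ∑ v, ∑ w, H v w * D k (δ (Γ k v w))
      + (∑ k, ∑ v, ∑ w, δ (Γ k v w) * (H v w * ∑ j, Γ j j k)
        - ∑ k, ∑ v, ∑ w, δ (Γ k v w) * (∑ j, Γ v k j * H j w)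
        - ∑ k, ∑ v, ∑ w, δ (Γ k v w) * (∑ j, Γ w k j * H j v))
      - (∑ k, ∑ w, H k w * ∑ j, D k (δ (Γ j j w))
        + ∑ k, ∑ w, (∑ j, δ (Γ j j w)) * D k (H k w)) := by
    simp only [← Finset.sum_add_distrib, ← Finset.sum_sub_distrib, ← mul_sub, ← hH _ _ _]
    refine Finset.sum_congr rfl fun k _ => ?_
    simp only [map_sub, map_sum, Derivation.leibniz, smul_eq_mul]
  -- `rhs` is expanded by the Leibniz rule; the derivatives of `H` produce the terms with `Γ`.
  rw [lhs, rhs, e1, e4, e5, e6, e3', e3]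
  ring

/-- The first variation of the density `H^{vw} (Ric + Hess F - dF ⊗ dF)_{vw}`, up to a
divergence. -/
theorem IsParallelDensity.deriv_lagrangian (hH : IsParallelDensity D Γ H)
    (hs : ∀ v w, H v w = H w v) (hΓ : ∀ k i j, Γ k i j = Γ k j i)
    {δ : Derivation ℝ A A} (hδ : ∀ k a, δ (D k a) = D k (δ a)) (F : A) :
    δ (∑ v, ∑ w, H v w * (ringRicci D Γ v w + ringHessian D Γ F v w - D v F * D w F)) =
      ∑ v, ∑ w, δ (H v w) * (ringRicci D Γ v w - D v F * D w F)
      + 2 * δ F * ∑ v, ∑ w, H v w * ringHessian D Γ F v w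
      + ∑ k, D k (∑ v, ∑ w, H v w * δ (Γ k v w) - ∑ w, H k w * ∑ j, δ (Γ j j w)
          + ∑ w, δ (H k w) * D w F + ∑ w, H k w * D w (δ F)
          - 2 * δ F * ∑ w, H k w * D w F) := by
  have hess : δ (∑ v, ∑ w, H v w * ringHessian D Γ F v w) =
      ∑ k, D k (∑ w, δ (H k w) * D w F + ∑ w, H k w * D w (δ F)) := by
    rw [hH.sum_mul_hessian hs, map_sum]
    refine Finset.sum_congr rfl fun k _ => ?_
    rw [hδ]; congr 1
    rw [map_sum, ← Finset.sum_add_distrib]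
    refine Finset.sum_congr rfl fun w _ => ?_
    rw [Derivation.leibniz, hδ, smul_eq_mul, smul_eq_mul]; ring
  have kin : δ (∑ v, ∑ w, H v w * (D v F * D w F)) =
      ∑ v, ∑ w, δ (H v w) * (D v F * D w F) + 2 * ∑ v, D v (δ F) * ∑ w, H v w * D w F := by
    have sw : ∑ v, ∑ w, H v w * (D v F * D w (δ F)) = ∑ v, ∑ w, H v w * (D w F * D v (δ F)) := by
      rw [Finset.sum_comm]
      refine Finset.sum_congr rfl fun v _ => Finset.sum_congr rfl fun w _ => ?_
      rw [hs w v]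
    have : 2 * ∑ v, D v (δ F) * ∑ w, H v w * D w F =
        ∑ v, ∑ w, H v w * (D v F * D w (δ F)) + ∑ v, ∑ w, H v w * (D w F * D v (δ F)) := by
      rw [sw, ← two_mul]; congr 1
      refine Finset.sum_congr rfl fun v _ => ?_
      rw [Finset.mul_sum]
      refine Finset.sum_congr rfl fun w _ => ?_
      ring
    rw [this]
    simp only [map_sum, ← Finset.sum_add_distrib]
    refine Finset.sum_congr rfl fun v _ => Finset.sum_congr rfl fun w _ => ?_
    simp only [Derivation.leibniz, hδ, smul_eq_mul]; ring
  have div : ∑ k, D k (2 * δ F * ∑ w, H k w * D w F) =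
      2 * ∑ v, D v (δ F) * ∑ w, H v w * D w F
        + 2 * δ F * ∑ v, ∑ w, H v w * ringHessian D Γ F v w := by
    rw [hH.sum_mul_hessian hs, Finset.mul_sum, Finset.mul_sum, ← Finset.sum_add_distrib]
    refine Finset.sum_congr rfl fun k _ => ?_
    have h2 : D k (2 : A) = 0 := by exact_mod_cast (D k).map_natCast 2
    simp only [Derivation.leibniz, smul_eq_mul, h2]; ring
  have ric : δ (∑ v, ∑ w, H v w * ringRicci D Γ v w) =
      ∑ v, ∑ w, δ (H v w) * ringRicci D Γ v w + ∑ v, ∑ w, H v w * δ (ringRicci D Γ v w) := by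
    simp only [map_sum, ← Finset.sum_add_distrib]
    refine Finset.sum_congr rfl fun v _ => Finset.sum_congr rfl fun w _ => ?_
    simp only [Derivation.leibniz, smul_eq_mul]; ring
  have split : ∀ k, D k (∑ v, ∑ w, H v w * δ (Γ k v w) - ∑ w, H k w * ∑ j, δ (Γ j j w)
          + ∑ w, δ (H k w) * D w F + ∑ w, H k w * D w (δ F)
          - 2 * δ F * ∑ w, H k w * D w F) =
      D k (∑ v, ∑ w, H v w * δ (Γ k v w) - ∑ w, H k w * ∑ j, δ (Γ j j w))
      + D k (∑ w, δ (H k w) * D w F + ∑ w, H k w * D w (δ F))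
      - D k (2 * δ F * ∑ w, H k w * D w F) := by
    intro k; rw [← map_add, ← map_sub, add_assoc _ (∑ w, δ (H k w) * D w F)]
  have lhs : δ (∑ v, ∑ w, H v w * (ringRicci D Γ v w + ringHessian D Γ F v w - D v F * D w F)) =
      δ (∑ v, ∑ w, H v w * ringRicci D Γ v w) + δ (∑ v, ∑ w, H v w * ringHessian D Γ F v w)
        - δ (∑ v, ∑ w, H v w * (D v F * D w F)) := by
    rw [← map_add, ← map_sub]
    simp only [mul_sub, mul_add, Finset.sum_add_distrib, Finset.sum_sub_distrib]
  have main : ∑ v, ∑ w, δ (H v w) * (ringRicci D Γ v w - D v F * D w F) =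
      ∑ v, ∑ w, δ (H v w) * ringRicci D Γ v w - ∑ v, ∑ w, δ (H v w) * (D v F * D w F) := by
    simp only [mul_sub, Finset.sum_sub_distrib]
  rw [lhs, main, ric, kin, hess, hH.sum_mul_deriv_ricci hs hΓ hδ,
    Finset.sum_congr rfl fun k _ => split k, Finset.sum_sub_distrib, Finset.sum_add_distrib, div]
  ring

section Metric

omit [Fintype ι] in
theorem ringChristoffelFirst_symm (hg : ∀ i j, g i j = g j i) (i j k : ι) :
    ringChristoffelFirst D g i j k = ringChristoffelFirst D g j i k := by
  rw [ringChristoffelFirst, ringChristoffelFirst, hg i j, add_comm (D i _)]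

theorem ringChristoffel_symm (hg : ∀ i j, g i j = g j i) (k i j : ι) :
    ringChristoffel D g h k i j = ringChristoffel D g h k j i := by
  simp only [ringChristoffel, ringChristoffelFirst_symm hg i j]

omit [Fintype ι] in
/-- The Levi-Civita connection is metric. -/
theorem deriv_eq_ringChristoffelFirst (hg : ∀ i j, g i j = g j i) (k a b : ι) :
    D k (g a b) = ringChristoffelFirst D g k a b + ringChristoffelFirst D g k b a := by
  rw [ringChristoffelFirst, ringChristoffelFirst, ← smul_add, hg b a]
  have : D k (g a b) + D a (g k b) - D b (g k a) + (D k (g a b) + D b (g k a) - D a (g k b)) =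
      (2 : ℝ) • D k (g a b) := by rw [two_smul]; ring
  rw [this, smul_smul]; norm_num

/-- The trace `Γ^j_{jk}` is half of the logarithmic derivative of the determinant. -/
theorem sum_ringChristoffel (hg : ∀ i j, g i j = g j i) (hh : ∀ i j, h i j = h j i) (k : ι) :
    ∑ j, ringChristoffel D g h j j k = (1 / 2 : ℝ) • ∑ a, ∑ b, h a b * D k (g a b) := by
  have e : ∑ j, ∑ l, h j l * D j (g k l) = ∑ j, ∑ l, h j l * D l (g j k) := by
    rw [Finset.sum_comm]
    refine Finset.sum_congr rfl fun a _ => Finset.sum_congr rfl fun b _ => ?_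
    rw [hh b a, hg k a]
  simp only [ringChristoffel, ringChristoffelFirst, mul_smul_comm, ← Finset.smul_sum, mul_add,
    mul_sub, Finset.sum_add_distrib, Finset.sum_sub_distrib, e]
  congr 1
  ring

variable [DecidableEq ι]

/-- The derivative of the inverse of a matrix. -/
theorem deriv_inverse (δ : Derivation ℝ A A)
    (hgh : ∀ i j, ∑ k, g i k * h k j = if i = j then 1 else 0)
    (hhg : ∀ i j, ∑ k, h i k * g k j = if i = j then 1 else 0) (v w : ι) :
    δ (h v w) = -∑ a, ∑ b, h v a * δ (g a b) * h b w := by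
  have e : ∀ a, ∑ b, δ (g a b) * h b w = -∑ b, g a b * δ (h b w) := by
    intro a
    have := congrArg δ (hgh a w)
    rw [map_sum] at this
    simp only [Derivation.leibniz, smul_eq_mul, Finset.sum_add_distrib] at this
    have z : δ (if a = w then (1 : A) else 0) = 0 := by split_ifs <;> simp
    rw [z] at this
    rw [eq_neg_iff_add_eq_zero, ← this, add_comm]
    congr 1
    exact Finset.sum_congr rfl fun _ _ => mul_comm _ _
  have e2 : ∑ a, ∑ b, h v a * δ (g a b) * h b w = -∑ b, (∑ a, h v a * g a b) * δ (h b w) := by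
    simp only [mul_assoc, ← Finset.mul_sum, e, mul_neg, Finset.sum_neg_distrib, Finset.sum_mul]
    congr 1
    rw [Finset.sum_comm]
    simp only [Finset.mul_sum]
  rw [e2]
  simp [hhg]

/-- The densitized inverse metric `s g^{vw}`, where `s` is a solution of the equation for the
volume density, is parallel for the Levi-Civita connection. -/
theorem isParallelDensity_of_metric (hg : ∀ i j, g i j = g j i) (hh : ∀ i j, h i j = h j i)
    (hgh : ∀ i j, ∑ k, g i k * h k j = if i = j then 1 else 0)
    (hhg : ∀ i j, ∑ k, h i k * g k j = if i = j then 1 else 0) {s : A}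
    (hs : ∀ k, D k s = (1 / 2 : ℝ) • (s * ∑ a, ∑ b, h a b * D k (g a b))) :
    IsParallelDensity D (ringChristoffel D g h) (fun v w => s * h v w) := by
  intro k v w
  have tr := sum_ringChristoffel (D := D) hg hh k
  have e1 : ∑ a, ∑ b, h v a * ringChristoffelFirst D g k a b * h b w =
      ∑ j, ringChristoffel D g h w k j * h j v := by
    simp only [ringChristoffel, Finset.sum_mul]
    refine Finset.sum_congr rfl fun a _ => Finset.sum_congr rfl fun b _ => ?_
    rw [hh v a, hh b w]; ring
  have e2 : ∑ a, ∑ b, h v a * ringChristoffelFirst D g k b a * h b w =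
      ∑ j, ringChristoffel D g h v k j * h j w := by
    rw [Finset.sum_comm]
    simp only [ringChristoffel, Finset.sum_mul]
  have e3 := deriv_inverse (D k) hgh hhg v w
  simp only [deriv_eq_ringChristoffelFirst hg k, mul_add, add_mul, Finset.sum_add_distrib] at e3
  rw [e1, e2] at e3
  simp only [Derivation.leibniz, smul_eq_mul, hs, e3, tr]
  have p : ∀ u u', ∑ j, ringChristoffel D g h u k j * (s * h j u') =
      s * ∑ j, ringChristoffel D g h u k j * h j u' := by
    intro u u'
    rw [Finset.mul_sum]
    exact Finset.sum_congr rfl fun _ _ => by ring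
  simp only [p, mul_smul_comm]
  rw [show s * h v w * ∑ a, ∑ b, h a b * D k (g a b)
    = h v w * (s * ∑ a, ∑ b, h a b * D k (g a b)) by ring]
  ring

omit [DecidableEq ι] in
/-- The Ricci tensor of a metric is symmetric, since `Γ^j_{jk}` is a logarithmic derivative. -/
theorem ringRicci_symm (hg : ∀ i j, g i j = g j i) (hh : ∀ i j, h i j = h j i)
    (hD : ∀ i j a, D i (D j a) = D j (D i a)) {s s' : A} (hss : s' * s = 1)
    (hs : ∀ k, D k s = (1 / 2 : ℝ) • (s * ∑ a, ∑ b, h a b * D k (g a b))) (v w : ι) :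
    ringRicci D (ringChristoffel D g h) v w = ringRicci D (ringChristoffel D g h) w v := by
  have hΓ : ∀ k i j, ringChristoffel D g h k i j = ringChristoffel D g h k j i :=
    ringChristoffel_symm hg
  have e : ∀ k, ∑ j, ringChristoffel D g h j j k = s' * D k s := by
    intro k
    rw [hs k, sum_ringChristoffel hg hh, mul_smul_comm, ← mul_assoc, hss, one_mul]
  have e1 : ∑ k, D v (ringChristoffel D g h k k w) = ∑ k, D w (ringChristoffel D g h k k v) := by
    rw [← map_sum, ← map_sum, e, e]
    have ds : ∀ k, D k s' = - (s' * s' * D k s) := by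
      intro k
      have := congrArg (D k) hss
      rw [Derivation.leibniz, Derivation.map_one_eq_zero, smul_eq_mul, smul_eq_mul] at this
      calc D k s' = s' * s * D k s' := by rw [hss, one_mul]
        _ = s' * (s' * D k s + s * D k s') - s' * s' * D k s := by ring
        _ = _ := by rw [this]; ring
    simp only [Derivation.leibniz, smul_eq_mul, ds, hD v w]; ring
  have e2 : ∑ k, ∑ l, ringChristoffel D g h k v l * ringChristoffel D g h l k w =
      ∑ k, ∑ l, ringChristoffel D g h k w l * ringChristoffel D g h l k v := by
    rw [Finset.sum_comm]
    refine Finset.sum_congr rfl fun a _ => Finset.sum_congr rfl fun b _ => ?_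
    rw [hΓ b v a, hΓ a b w]; ring
  simp only [ringRicci]
  rw [e1, e2]
  simp only [hΓ _ v w]

end Metric

end DifferentialRing

/-! ### Components of bilinear forms and of local tensors -/

section Components

variable {n : ℕ}

/-- The `i`-th standard basis vector of `ℝⁿ`. -/
abbrev stdVec (i : Fin n) : Model n := EuclideanSpace.single i 1

/-- The components of the inverse of a bilinear form. -/
def invEntry (B : ModelForm n) (k l : Fin n) : ℝ := B.inverse (EuclideanSpace.proj l) k

/-- The volume density `√|det B(e_i, e_j)|` of a bilinear form. -/
def volDensity (B : ModelForm n) : ℝ :=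
  √|Matrix.det (Matrix.of fun i j => B (stdVec i) (stdVec j))|

theorem covector_eq_sum (α : Model n →L[ℝ] ℝ) :
    α = ∑ l, α (stdVec l) • (EuclideanSpace.proj l : Model n →L[ℝ] ℝ) := by
  ext v
  conv_lhs => rw [← (EuclideanSpace.basisFun (Fin n) ℝ).sum_repr v]
  simp [mul_comm]

theorem vector_eq_sum (v : Model n) : v = ∑ k, v k • stdVec k := by
  conv_lhs => rw [← (EuclideanSpace.basisFun (Fin n) ℝ).sum_repr v]
  simp

theorem stdVec_apply (i j : Fin n) : stdVec i j = if i = j then (1 : ℝ) else 0 := by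
  simp [stdVec, PiLp.single_apply, eq_comm]

theorem inverse_apply_eq_sum (B : ModelForm n) (α : Model n →L[ℝ] ℝ) (k : Fin n) :
    B.inverse α k = ∑ l, invEntry B k l * α (stdVec l) := by
  conv_lhs => rw [covector_eq_sum α]
  simp [invEntry, mul_comm]

theorem trace_eq_sum_apply (T : Model n →ₗ[ℝ] Model n) :
    LinearMap.trace ℝ (Model n) T = ∑ k, T (stdVec k) k := by
  rw [LinearMap.trace_eq_matrix_trace ℝ (EuclideanSpace.basisFun (Fin n) ℝ).toBasis]
  simp [Matrix.trace, LinearMap.toMatrix_apply]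

theorem trace_inverse_comp (B C : ModelForm n) :
    LinearMap.trace ℝ (Model n) (B.inverse ∘L C).toLinearMap =
      ∑ v, ∑ w, invEntry B v w * C (stdVec v) (stdVec w) := by
  rw [trace_eq_sum_apply]
  exact Finset.sum_congr rfl fun v _ => inverse_apply_eq_sum B _ v

variable {B : ModelForm n}

theorem sum_invEntry_mul (hB : B.IsInvertible) (hs : ∀ v w, B v w = B w v) (i j : Fin n) :
    ∑ k, invEntry B i k * B (stdVec k) (stdVec j) = if i = j then 1 else 0 := by
  have := inverse_apply_eq_sum B (B (stdVec j)) i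
  rw [hB.inverse_apply_self, stdVec_apply] at this
  simp only [hs _ (stdVec j), ← this, eq_comm]

theorem sum_mul_invEntry (hB : B.IsInvertible) (hs : ∀ v w, B v w = B w v) (i j : Fin n) :
    ∑ k, B (stdVec i) (stdVec k) * invEntry B k j = if i = j then 1 else 0 := by
  have h : Matrix.of (invEntry B) * Matrix.of (fun i j => B (stdVec i) (stdVec j)) = 1 := by
    ext a b
    simp [Matrix.mul_apply, Matrix.one_apply, sum_invEntry_mul hB hs]
  have h2 := mul_eq_one_comm.1 h
  simpa [Matrix.mul_apply, Matrix.one_apply] using congrFun (congrFun h2 i) j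

theorem invEntry_symm (hB : B.IsInvertible) (hs : ∀ v w, B v w = B w v) (i j : Fin n) :
    invEntry B i j = invEntry B j i := by
  have h : Matrix.of (invEntry B) * Matrix.of (fun i j => B (stdVec i) (stdVec j)) = 1 := by
    ext a b
    simp [Matrix.mul_apply, Matrix.one_apply, sum_invEntry_mul hB hs]
  have e : (Matrix.of (fun i j => B (stdVec i) (stdVec j)) : Matrix (Fin n) (Fin n) ℝ).transpose =
      Matrix.of (fun i j => B (stdVec i) (stdVec j)) := by
    ext a b; simp [hs (stdVec a)]
  have h2 := congrArg Matrix.transpose (mul_eq_one_comm.1 h)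
  rw [Matrix.transpose_mul, e, Matrix.transpose_one] at h2
  have := left_inv_eq_right_inv h2 (mul_eq_one_comm.1 h)
  simpa using congrFun (congrFun this j) i

theorem det_ne_zero_of_isInvertible (hB : B.IsInvertible) (hs : ∀ v w, B v w = B w v) :
    Matrix.det (Matrix.of fun i j => B (stdVec i) (stdVec j)) ≠ 0 := by
  have h : Matrix.of (invEntry B) * Matrix.of (fun i j => B (stdVec i) (stdVec j)) = 1 := by
    ext a b
    simp [Matrix.mul_apply, Matrix.one_apply, sum_invEntry_mul hB hs]
  intro h0
  have := congrArg Matrix.det h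
  simp [Matrix.det_mul, h0] at this

theorem volDensity_pos (hB : B.IsInvertible) (hs : ∀ v w, B v w = B w v) : 0 < volDensity B :=
  Real.sqrt_pos.2 (abs_pos.2 (det_ne_zero_of_isInvertible hB hs))

end Components

/-! ### Smoothness of the local tensors -/

section Smoothness

variable {n : ℕ} {Z : Type*} [NormedAddCommGroup Z] [NormedSpace ℝ Z]

theorem contDiffAt_clm_apply_of_finiteDimensional {X V : Type*} [NormedAddCommGroup X]
    [NormedSpace ℝ X] [FiniteDimensional ℝ X] [NormedAddCommGroup V] [NormedSpace ℝ V]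
    {f : Z → X →L[ℝ] V} {z : Z} (hf : ∀ x, ContDiffAt ℝ ∞ (fun z => f z x) z) :
    ContDiffAt ℝ ∞ f z := by
  let e₁ := ContinuousLinearEquiv.ofFinrankEq
    (Module.finrank_fin_fun (R := ℝ) (n := Module.finrank ℝ X)).symm
  let e₂ := (e₁.arrowCongr (1 : V ≃L[ℝ] V)).trans
    (ContinuousLinearEquiv.piRing (Fin (Module.finrank ℝ X)))
  rw [← Function.id_comp f, ← e₂.symm_comp_self]
  exact e₂.symm.contDiff.contDiffAt.comp z (contDiffAt_pi.mpr fun i => hf _)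

theorem contDiffAt_fderiv {V : Type*} [NormedAddCommGroup V] [NormedSpace ℝ V] {f : Z → V} {z : Z}
    (hf : ContDiffAt ℝ ∞ f z) : ContDiffAt ℝ ∞ (fderiv ℝ f) z :=
  hf.fderiv_right (m := ∞) (by simp)

theorem contDiffAt_inverse {V W : Type*} [NormedAddCommGroup V] [NormedSpace ℝ V] [CompleteSpace V]
    [NormedAddCommGroup W] [NormedSpace ℝ W] {f : Z → V →L[ℝ] W} {z : Z}
    (hf : ContDiffAt ℝ ∞ f z) (hi : (f z).IsInvertible) :
    ContDiffAt ℝ ∞ (fun z => (f z).inverse) z :=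
  hi.contDiffAt_map_inverse.comp z hf

variable {G : Model n → ModelForm n} {y : Model n}

theorem contDiffAt_christoffelFirst (hG : ContDiffAt ℝ ∞ G y) :
    ContDiffAt ℝ ∞ (christoffelFirst G) y := by
  refine contDiffAt_clm_apply_of_finiteDimensional fun u =>
    contDiffAt_clm_apply_of_finiteDimensional fun v =>
      contDiffAt_clm_apply_of_finiteDimensional fun w => ?_
  simp only [christoffelFirst_apply]
  have := contDiffAt_fderiv hG
  fun_prop

theorem christoffel_apply (G : Model n → ModelForm n) (y u v : Model n) :
    christoffel G y u v = (G y).inverse (christoffelFirst G y u v) := rfl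

theorem contDiffAt_christoffel (hG : ContDiffAt ℝ ∞ G y) (hi : (G y).IsInvertible) :
    ContDiffAt ℝ ∞ (christoffel G) y := by
  refine contDiffAt_clm_apply_of_finiteDimensional fun u =>
    contDiffAt_clm_apply_of_finiteDimensional fun v => ?_
  simp only [christoffel_apply]
  exact (contDiffAt_inverse hG hi).clm_apply
    (((contDiffAt_christoffelFirst hG).clm_apply contDiffAt_const).clm_apply contDiffAt_const)

theorem christoffel_eq_sum (G : Model n → ModelForm n) (y u v : Model n) (k : Fin n) :
    christoffel G y u v k = ∑ l, invEntry (G y) k l * christoffelFirst G y u v (stdVec l) :=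
  inverse_apply_eq_sum _ _ _

theorem fderiv_christoffel_apply (hG : ContDiffAt ℝ ∞ G y) (hi : (G y).IsInvertible)
    (u v w : Model n) (k : Fin n) :
    fderiv ℝ (christoffel G) y u v w k = fderiv ℝ (fun y' => christoffel G y' v w k) y u := by
  have h := ((contDiffAt_christoffel hG hi).differentiableAt (by simp)).hasFDerivAt
  have h2 := ((h.clm_apply (hasFDerivAt_const v y)).clm_apply (hasFDerivAt_const w y))
  have h3 := ((EuclideanSpace.proj k : Model n →L[ℝ] ℝ).hasFDerivAt).comp y h2
  have h4 := h3.fderiv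
  simp only [Function.comp_def, EuclideanSpace.coe_proj] at h4
  rw [h4]
  simp

theorem localRicci_eq_sum (hG : ContDiffAt ℝ ∞ G y) (hi : (G y).IsInvertible) (v w : Model n) :
    localRicci G y v w =
      ∑ k, fderiv ℝ (fun y' => christoffel G y' v w k) y (stdVec k)
      - ∑ k, fderiv ℝ (fun y' => christoffel G y' (stdVec k) w k) y v
      + ∑ k, ∑ l, christoffel G y (stdVec k) (stdVec l) k * christoffel G y v w l
      - ∑ k, ∑ l, christoffel G y v (stdVec l) k * christoffel G y (stdVec k) w l := by
  rw [localRicci_apply, trace_eq_sum_apply]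
  simp only [ContinuousLinearMap.coe_coe, curvatureEnd_apply, PiLp.sub_apply, PiLp.add_apply,
    Finset.sum_sub_distrib, Finset.sum_add_distrib, fderiv_christoffel_apply hG hi]
  have e : ∀ u u' : Model n, ∀ k, christoffel G y u u' k =
      ∑ l, christoffel G y u (stdVec l) k * u' l := by
    intro u u' k
    conv_lhs => rw [vector_eq_sum u']
    simp [mul_comm]
  simp only [e (stdVec _) (christoffel G y v w), e v (christoffel G y (stdVec _) w)]

theorem localHessian_eq_sum {F : Model n → ℝ} (hF : ContDiffAt ℝ ∞ F y) (v w : Model n) :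
    localHessian G F y v w =
      fderiv ℝ (fun y' => fderiv ℝ F y' w) y v
        - ∑ k, fderiv ℝ F y (stdVec k) * christoffel G y v w k := by
  have h := ((contDiffAt_fderiv hF).differentiableAt (by simp)).hasFDerivAt
  have h2 := (h.clm_apply (hasFDerivAt_const w y)).fderiv
  rw [h2]
  simp only [localHessian, sub_apply, ContinuousLinearMap.comp_apply,
    ContinuousLinearMap.compL_apply]
  congr 1
  · simp
  · conv_lhs => rw [vector_eq_sum (christoffel G y v w)]
    simp [mul_comm]

end Smoothness

/-! ### The differential ring of functions which are smooth on an open set -/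

section SmoothRing

variable {Z : Type*} [NormedAddCommGroup Z] [NormedSpace ℝ Z]

/-- The functions on `Z` which are smooth on `Ω`, with arbitrary values outside `Ω`. -/
def smoothRing (Ω : Set Z) : Subalgebra ℝ (Z → ℝ) where
  carrier := {f | ContDiffOn ℝ ∞ f Ω}
  mul_mem' hf hg := ContDiffOn.mul hf hg
  add_mem' hf hg := ContDiffOn.add hf hg
  algebraMap_mem' _ := contDiffOn_const

variable {Ω : Set Z}

/-- Evaluation at a point. -/
def evalAt (z : Z) : smoothRing Ω →ₐ[ℝ] ℝ :=
  (Pi.evalAlgHom ℝ (fun _ : Z => ℝ) z).comp (smoothRing Ω).val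

theorem smoothRing_ext {a b : smoothRing Ω} (h : ∀ z, evalAt z a = evalAt z b) : a = b :=
  Subtype.ext (funext h)

theorem contDiffAt_coe (hΩ : IsOpen Ω) (a : smoothRing Ω) {z : Z} (hz : z ∈ Ω) :
    ContDiffAt ℝ ∞ (a : Z → ℝ) z :=
  a.2.contDiffAt (hΩ.mem_nhds hz)

open Classical in
/-- The partial derivative in the direction `u`, set to zero outside `Ω` so that the Leibniz rule
holds everywhere. -/
def partialDeriv (hΩ : IsOpen Ω) (u : Z) : Derivation ℝ (smoothRing Ω) (smoothRing Ω) :=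
  Derivation.mk'
    { toFun := fun a => ⟨fun z => if z ∈ Ω then fderiv ℝ (a : Z → ℝ) z u else 0, by
        have h : ContDiffOn ℝ ∞ (fun z => fderiv ℝ (a : Z → ℝ) z u) Ω :=
          (a.2.fderiv_of_isOpen hΩ (m := ∞) (by simp)).clm_apply contDiffOn_const
        exact h.congr fun z hz => if_pos hz⟩
      map_add' := fun a b => by
        refine Subtype.ext (funext fun z => ?_)
        by_cases hz : z ∈ Ω
        · have ha := (contDiffAt_coe hΩ a hz).differentiableAt (by simp)
          have hb := (contDiffAt_coe hΩ b hz).differentiableAt (by simp)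
          simp [hz, fderiv_add ha hb]
        · simp [hz]
      map_smul' := fun c a => by
        refine Subtype.ext (funext fun z => ?_)
        by_cases hz : z ∈ Ω
        · have ha := (contDiffAt_coe hΩ a hz).differentiableAt (by simp)
          simp [hz, fderiv_const_smul ha c]
        · simp [hz] }
    (fun a b => by
        refine Subtype.ext (funext fun z => ?_)
        by_cases hz : z ∈ Ω
        · have ha := (contDiffAt_coe hΩ a hz).differentiableAt (by simp)
          have hb := (contDiffAt_coe hΩ b hz).differentiableAt (by simp)
          simp [hz, fderiv_mul ha hb]
        · simp [hz])

theorem evalAt_partialDeriv (hΩ : IsOpen Ω) (u : Z) (a : smoothRing Ω) {z : Z} (hz : z ∈ Ω) :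
    evalAt z (partialDeriv hΩ u a) = fderiv ℝ (fun z => evalAt z a) z u :=
  if_pos hz

/-- Partial derivatives commute. -/
theorem partialDeriv_comm (hΩ : IsOpen Ω) (u v : Z) (a : smoothRing Ω) :
    partialDeriv hΩ u (partialDeriv hΩ v a) = partialDeriv hΩ v (partialDeriv hΩ u a) := by
  refine smoothRing_ext fun z => ?_
  by_cases hz : z ∈ Ω
  · have e : ∀ u v, evalAt z (partialDeriv hΩ u (partialDeriv hΩ v a)) =
        fderiv ℝ (fderiv ℝ (a : Z → ℝ)) z u v := by
      intro u v
      rw [evalAt_partialDeriv hΩ u _ hz]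
      have : (fun z => evalAt z (partialDeriv hΩ v a)) =ᶠ[nhds z]
          fun z => fderiv ℝ (a : Z → ℝ) z v := by
        filter_upwards [hΩ.mem_nhds hz] with z' hz'
        exact evalAt_partialDeriv hΩ v a hz'
      rw [this.fderiv_eq]
      have h := ((contDiffAt_fderiv (contDiffAt_coe hΩ a hz)).differentiableAt (by simp)).hasFDerivAt
      rw [(h.clm_apply (hasFDerivAt_const v z)).fderiv]
      simp
    rw [e, e]
    exact ((contDiffAt_coe hΩ a hz).isSymmSndFDerivAt (by
      rw [minSmoothness_of_isRCLikeNormedField]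
      exact WithTop.coe_le_coe.2 (le_top : (2 : ℕ∞) ≤ ⊤))).eq u v
  · exact (if_neg hz).trans (if_neg hz).symm

end SmoothRing

/-- Jacobi's formula in a differential ring. -/
theorem deriv_det {A : Type*} [CommRing A] [Algebra ℝ A] {ι : Type*} [Fintype ι] [DecidableEq ι]
    (δ : Derivation ℝ A A) (g : Matrix ι ι A) :
    δ g.det = ∑ a, ∑ b, g.adjugate a b * δ (g b a) := by
  have prod : ∀ (s : Finset ι) (f : ι → A),
      δ (∏ i ∈ s, f i) = ∑ i ∈ s, (∏ j ∈ s.erase i, f j) * δ (f i) := by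
    intro s f
    induction s using Finset.induction_on with
    | empty => simp
    | insert a s ha ih =>
      rw [Finset.prod_insert ha, Derivation.leibniz, ih, Finset.sum_insert ha,
        Finset.erase_insert ha, add_comm]
      simp only [smul_eq_mul, Finset.mul_sum]
      congr 1
      refine Finset.sum_congr rfl fun i hi => ?_
      have hia : a ≠ i := fun h => ha (h ▸ hi)
      rw [Finset.erase_insert_of_ne hia, Finset.prod_insert (by simp [ha]), mul_assoc]
  have col : ∀ a, ∑ b, g.adjugate a b * δ (g b a) = (g.updateCol a fun b => δ (g b a)).det := by
    intro a
    rw [← Matrix.cramer_apply, Matrix.cramer_eq_adjugate_mulVec]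
    rfl
  simp only [col]
  simp only [Matrix.det_apply, map_sum]
  rw [Finset.sum_comm]
  refine Finset.sum_congr rfl fun σ _ => ?_
  rw [← Finset.smul_sum]
  have : δ (Equiv.Perm.sign σ • ∏ i, g (σ i) i) = Equiv.Perm.sign σ • δ (∏ i, g (σ i) i) := by
    rcases Int.units_eq_one_or (Equiv.Perm.sign σ) with h | h <;> simp [h]
  rw [this, prod]
  congr 1
  refine Finset.sum_congr rfl fun i _ => ?_
  rw [← Finset.mul_prod_erase Finset.univ _ (Finset.mem_univ i), mul_comm]
  congr 1
  · simp
  · refine Finset.prod_congr rfl fun j hj => ?_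
    rw [Matrix.updateCol_ne (Finset.ne_of_mem_erase hj)]

/-! ### The first variation in coordinates -/

section Variation

variable {n : ℕ} {U : Set (Model n)} {G S : Model n → ModelForm n} {F H : Model n → ℝ}

/-- The density `√|det G| tr_G (Ric + Hess F - dF ⊗ dF)` in coordinates. -/
def localDensity (G : Model n → ModelForm n) (F : Model n → ℝ) (y : Model n) : ℝ :=
  volDensity (G y) * LinearMap.trace ℝ (Model n)
    ((G y).inverse ∘L (localRicci G y + localHessian G F y -
      (fderiv ℝ F y).smulRight (fderiv ℝ F y))).toLinearMap

/-- The data of a smooth variation `(G + t S, F + t H)` on an open set `U`. -/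
structure IsVariation (U : Set (Model n)) (G S : Model n → ModelForm n) (F H : Model n → ℝ) :
    Prop where
  isOpen : IsOpen U
  metric_smooth : ContDiffOn ℝ ∞ G U
  tensor_smooth : ContDiffOn ℝ ∞ S U
  potential_smooth : ContDiffOn ℝ ∞ F U
  function_smooth : ContDiffOn ℝ ∞ H U
  metric_symm : ∀ y ∈ U, ∀ v w, G y v w = G y w v
  tensor_symm : ∀ y ∈ U, ∀ v w, S y v w = S y w v

/-- The pairs `(t, y)` such that `G + t S` is non-degenerate at `y`. -/
def regularSet (U : Set (Model n)) (G S : Model n → ModelForm n) : Set (ℝ × Model n) :=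
  {z | z.2 ∈ U ∧ (G z.2 + z.1 • S z.2).IsInvertible}

theorem isOpen_setOf_isInvertible : IsOpen {B : ModelForm n | B.IsInvertible} :=
  ContinuousLinearEquiv.isOpen

namespace IsVariation

variable (hV : IsVariation U G S F H)
include hV

theorem contDiffOn_family :
    ContDiffOn ℝ ∞ (fun z : ℝ × Model n => G z.2 + z.1 • S z.2) (Prod.snd ⁻¹' U) :=
  (hV.metric_smooth.comp contDiffOn_snd (Set.Subset.refl _)).add
    (contDiffOn_fst.smul (hV.tensor_smooth.comp contDiffOn_snd (Set.Subset.refl _)))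

theorem isOpen_regularSet : IsOpen (regularSet U G S) :=
  hV.contDiffOn_family.continuousOn.isOpen_inter_preimage (hV.isOpen.preimage continuous_snd)
    isOpen_setOf_isInvertible

theorem family_symm {z : ℝ × Model n} (hz : z ∈ regularSet U G S) (v w : Model n) :
    (G z.2 + z.1 • S z.2) v w = (G z.2 + z.1 • S z.2) w v := by
  simp [hV.metric_symm z.2 hz.1 v w, hV.tensor_symm z.2 hz.1 v w]

theorem contDiffAt_family {z : ℝ × Model n} (hz : z ∈ regularSet U G S) :
    ContDiffAt ℝ ∞ (fun z : ℝ × Model n => G z.2 + z.1 • S z.2) z :=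
  hV.contDiffOn_family.contDiffAt ((hV.isOpen.preimage continuous_snd).mem_nhds hz.1)

theorem contDiffAt_slice {z : ℝ × Model n} (hz : z ∈ regularSet U G S) :
    ContDiffAt ℝ ∞ (fun y => G y + z.1 • S y) z.2 :=
  (hV.metric_smooth.contDiffAt (hV.isOpen.mem_nhds hz.1)).add
    (contDiffAt_const (c := z.1) |>.fun_smul
      (hV.tensor_smooth.contDiffAt (hV.isOpen.mem_nhds hz.1)))

theorem contDiffAt_slice_function {z : ℝ × Model n} (hz : z ∈ regularSet U G S) :
    ContDiffAt ℝ ∞ (fun y => F y + z.1 * H y) z.2 :=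
  (hV.potential_smooth.contDiffAt (hV.isOpen.mem_nhds hz.1)).add
    (contDiffAt_const.mul (hV.function_smooth.contDiffAt (hV.isOpen.mem_nhds hz.1)))

open Classical in
/-- The components of the metric `G + t S` as elements of the ring of smooth functions; they are
set to be those of the identity outside the regular set. -/
def metricElt (i j : Fin n) : smoothRing (regularSet U G S) :=
  ⟨fun z => if z ∈ regularSet U G S then (G z.2 + z.1 • S z.2) (stdVec i) (stdVec j)
      else if i = j then 1 else 0, by
    have : ContDiffOn ℝ ∞ (fun z : ℝ × Model n => (G z.2 + z.1 • S z.2) (stdVec i) (stdVec j))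
        (regularSet U G S) := fun z hz =>
      (((hV.contDiffAt_family hz).clm_apply contDiffAt_const).clm_apply
        contDiffAt_const).contDiffWithinAt
    exact this.congr fun z hz => if_pos hz⟩

open Classical in
/-- The components of the inverse of the metric `G + t S`. -/
def inverseElt (i j : Fin n) : smoothRing (regularSet U G S) :=
  ⟨fun z => if z ∈ regularSet U G S then invEntry (G z.2 + z.1 • S z.2) i j
      else if i = j then 1 else 0, by
    have : ContDiffOn ℝ ∞ (fun z : ℝ × Model n => invEntry (G z.2 + z.1 • S z.2) i j)
        (regularSet U G S) := fun z hz =>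
      ((EuclideanSpace.proj i : Model n →L[ℝ] ℝ).contDiff.contDiffAt.comp z
        ((contDiffAt_inverse (hV.contDiffAt_family hz) hz.2).clm_apply
          contDiffAt_const)).contDiffWithinAt
    exact this.congr fun z hz => if_pos hz⟩

open Classical in
/-- The volume density of the metric `G + t S`. -/
def volElt : smoothRing (regularSet U G S) :=
  ⟨fun z => if z ∈ regularSet U G S then volDensity (G z.2 + z.1 • S z.2) else 1, by
    have : ContDiffOn ℝ ∞ (fun z : ℝ × Model n => volDensity (G z.2 + z.1 • S z.2))
        (regularSet U G S) := fun z hz => by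
      have hd : ContDiffAt ℝ ∞ (fun z : ℝ × Model n => Matrix.det (Matrix.of fun i j =>
          (G z.2 + z.1 • S z.2) (stdVec i) (stdVec j))) z := by
        simp only [Matrix.det_apply', Matrix.of_apply]
        refine ContDiffAt.sum fun σ _ => contDiffAt_const.mul (contDiffAt_prod fun i _ => ?_)
        exact ((hV.contDiffAt_family hz).clm_apply contDiffAt_const).clm_apply contDiffAt_const
      have h0 := det_ne_zero_of_isInvertible hz.2 (hV.family_symm hz)
      exact (ContDiffAt.sqrt (f := fun z : ℝ × Model n => |Matrix.det (Matrix.of fun i j =>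
        (G z.2 + z.1 • S z.2) (stdVec i) (stdVec j))|)
        ((contDiffAt_abs h0).comp z hd) (abs_ne_zero.2 h0)).contDiffWithinAt
    exact this.congr fun z hz => if_pos hz⟩

/-- The function `F + t H`. -/
def potentialElt : smoothRing (regularSet U G S) :=
  ⟨fun z => F z.2 + z.1 * H z.2, fun z hz => by
    have h1 := hV.potential_smooth.contDiffAt (hV.isOpen.mem_nhds hz.1)
    have h2 := hV.function_smooth.contDiffAt (hV.isOpen.mem_nhds hz.1)
    exact ((h1.comp z contDiffAt_snd).add
      (contDiffAt_fst.mul (h2.comp z contDiffAt_snd))).contDiffWithinAt⟩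

/-- The derivative in the direction of the `k`-th coordinate. -/
def spaceDeriv (k : Fin n) :
    Derivation ℝ (smoothRing (regularSet U G S)) (smoothRing (regularSet U G S)) :=
  partialDeriv hV.isOpen_regularSet (0, stdVec k)

/-- The derivative with respect to the parameter `t`. -/
def timeDeriv :
    Derivation ℝ (smoothRing (regularSet U G S)) (smoothRing (regularSet U G S)) :=
  partialDeriv hV.isOpen_regularSet (1, 0)

theorem evalAt_metricElt {z : ℝ × Model n} (hz : z ∈ regularSet U G S) (i j : Fin n) :
    evalAt z (hV.metricElt i j) = (G z.2 + z.1 • S z.2) (stdVec i) (stdVec j) := if_pos hz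

theorem evalAt_metricElt_of_notMem {z : ℝ × Model n} (hz : z ∉ regularSet U G S) (i j : Fin n) :
    evalAt z (hV.metricElt i j) = if i = j then 1 else 0 := if_neg hz

theorem evalAt_inverseElt {z : ℝ × Model n} (hz : z ∈ regularSet U G S) (i j : Fin n) :
    evalAt z (hV.inverseElt i j) = invEntry (G z.2 + z.1 • S z.2) i j := if_pos hz

theorem evalAt_inverseElt_of_notMem {z : ℝ × Model n} (hz : z ∉ regularSet U G S) (i j : Fin n) :
    evalAt z (hV.inverseElt i j) = if i = j then 1 else 0 := if_neg hz

theorem evalAt_volElt {z : ℝ × Model n} (hz : z ∈ regularSet U G S) :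
    evalAt z hV.volElt = volDensity (G z.2 + z.1 • S z.2) := if_pos hz

theorem evalAt_volElt_of_notMem {z : ℝ × Model n} (hz : z ∉ regularSet U G S) :
    evalAt z hV.volElt = 1 := if_neg hz

theorem metricElt_symm (i j : Fin n) : hV.metricElt i j = hV.metricElt j i := by
  refine smoothRing_ext fun z => ?_
  by_cases hz : z ∈ regularSet U G S
  · rw [hV.evalAt_metricElt hz, hV.evalAt_metricElt hz, hV.family_symm hz]
  · simp only [hV.evalAt_metricElt_of_notMem hz, eq_comm]

theorem inverseElt_symm (i j : Fin n) : hV.inverseElt i j = hV.inverseElt j i := by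
  refine smoothRing_ext fun z => ?_
  by_cases hz : z ∈ regularSet U G S
  · rw [hV.evalAt_inverseElt hz, hV.evalAt_inverseElt hz,
      invEntry_symm hz.2 (hV.family_symm hz) i j]
  · simp only [hV.evalAt_inverseElt_of_notMem hz, eq_comm]

theorem sum_metricElt_mul (i j : Fin n) :
    ∑ k, hV.metricElt i k * hV.inverseElt k j = if i = j then 1 else 0 := by
  refine smoothRing_ext fun z => ?_
  have e : evalAt z (if i = j then (1 : smoothRing (regularSet U G S)) else 0) =
      if i = j then (1 : ℝ) else 0 := by split_ifs <;> simp
  rw [e, map_sum]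
  by_cases hz : z ∈ regularSet U G S
  · rw [← sum_mul_invEntry hz.2 (hV.family_symm hz) i j]
    simp only [map_mul, hV.evalAt_metricElt hz, hV.evalAt_inverseElt hz]
  · simp [hV.evalAt_metricElt_of_notMem hz, hV.evalAt_inverseElt_of_notMem hz]

theorem sum_inverseElt_mul (i j : Fin n) :
    ∑ k, hV.inverseElt i k * hV.metricElt k j = if i = j then 1 else 0 := by
  refine Eq.trans (Finset.sum_congr rfl fun k _ => ?_) ((hV.sum_metricElt_mul j i).trans ?_)
  · rw [hV.inverseElt_symm i k, hV.metricElt_symm k j, mul_comm]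
  · simp [eq_comm]

/-- The logarithmic derivative of the volume density, from Jacobi's formula and `s⁴ = det²`. -/
theorem deriv_volElt (δ : Derivation ℝ (smoothRing (regularSet U G S))
      (smoothRing (regularSet U G S))) :
    δ hV.volElt = (1 / 2 : ℝ) •
      (hV.volElt * ∑ a, ∑ b, hV.inverseElt a b * δ (hV.metricElt a b)) := by
  set g : Matrix (Fin n) (Fin n) (smoothRing (regularSet U G S)) := Matrix.of hV.metricElt
  set h : Matrix (Fin n) (Fin n) (smoothRing (regularSet U G S)) := Matrix.of hV.inverseElt
  have hgh : g * h = 1 := by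
    ext1 i j
    rw [Matrix.mul_apply, Matrix.one_apply]
    exact hV.sum_metricElt_mul i j
  have hdet : g.det * h.det = 1 := by rw [← Matrix.det_mul, hgh, Matrix.det_one]
  have hadj : h.det • g.adjugate = h := by
    have : g.adjugate * (g * h) = g.det • h := by
      rw [← Matrix.mul_assoc, Matrix.adjugate_mul, Matrix.smul_mul, Matrix.one_mul]
    rw [hgh, Matrix.mul_one] at this
    rw [this, smul_smul, mul_comm, hdet, one_smul]
  have h4 : hV.volElt ^ 4 = g.det ^ 2 := by
    refine smoothRing_ext fun z => ?_
    have e : evalAt z g.det = Matrix.det (Matrix.of fun i j => evalAt z (hV.metricElt i j)) := by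
      rw [AlgHom.map_det]; rfl
    rw [map_pow, map_pow, e]
    by_cases hz : z ∈ regularSet U G S
    · simp only [hV.evalAt_volElt hz, hV.evalAt_metricElt hz, volDensity]
      rw [show ∀ x : ℝ, x ^ 4 = (x ^ 2) ^ 2 from fun x => by ring,
        Real.sq_sqrt (abs_nonneg _), sq_abs]
    · simp only [hV.evalAt_volElt_of_notMem hz, hV.evalAt_metricElt_of_notMem hz]
      have : (Matrix.of fun i j : Fin n => if i = j then (1 : ℝ) else 0) = 1 := by
        ext i j; simp [Matrix.one_apply]
      rw [this]; simp
  have hd := congrArg δ h4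
  rw [Derivation.leibniz_pow, Derivation.leibniz_pow] at hd
  simp only [smul_eq_mul, nsmul_eq_mul, Nat.cast_ofNat, pow_one,
    show 4 - 1 = 3 from rfl, show 2 - 1 = 1 from rfl] at hd
  have jac : ∑ a, ∑ b, hV.inverseElt a b * δ (hV.metricElt a b) = h.det * δ g.det := by
    rw [deriv_det, Finset.mul_sum]
    refine Finset.sum_congr rfl fun a _ => ?_
    rw [Finset.mul_sum]
    refine Finset.sum_congr rfl fun b _ => ?_
    rw [← mul_assoc, show h.det * g.adjugate a b = (h.det • g.adjugate) a b from rfl, hadj]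
    change _ = hV.inverseElt a b * δ (hV.metricElt b a)
    rw [hV.metricElt_symm b a]
  rw [jac]
  have key : (4 : smoothRing (regularSet U G S)) * δ hV.volElt =
      2 * (hV.volElt * (h.det * δ g.det)) := by
    have e1 : (4 : smoothRing (regularSet U G S)) * δ hV.volElt * (g.det ^ 2) =
        2 * (hV.volElt * (g.det * δ g.det)) := by
      rw [← h4]; linear_combination hV.volElt * hd
    have e2 : g.det ^ 2 * h.det ^ 2 = 1 := by rw [← mul_pow, hdet, one_pow]
    linear_combination h.det ^ 2 * e1 - 4 * δ hV.volElt * e2 +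
      2 * (hV.volElt * (h.det * δ g.det)) * hdet
  have h4' : (4 : smoothRing (regularSet U G S)) * δ hV.volElt = (4 : ℝ) • δ hV.volElt := by
    rw [Algebra.smul_def, map_ofNat]
  have h2' : (2 : smoothRing (regularSet U G S)) * (hV.volElt * (h.det * δ g.det)) =
      (2 : ℝ) • (hV.volElt * (h.det * δ g.det)) := by
    rw [Algebra.smul_def, map_ofNat]
  rw [h4', h2'] at key
  have := congrArg (fun x => (1 / 4 : ℝ) • x) key
  simp only [smul_smul] at this
  norm_num at this
  rw [this]

/-- The densitized inverse metric is parallel for the Levi-Civita connection. -/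
theorem isParallelDensity : IsParallelDensity hV.spaceDeriv
    (ringChristoffel hV.spaceDeriv hV.metricElt hV.inverseElt)
    (fun v w => hV.volElt * hV.inverseElt v w) :=
  isParallelDensity_of_metric hV.metricElt_symm hV.inverseElt_symm hV.sum_metricElt_mul
    hV.sum_inverseElt_mul fun k => hV.deriv_volElt (hV.spaceDeriv k)

end IsVariation

end Variation

section VariationFormula

variable {n : ℕ} {U : Set (Model n)} {G S : Model n → ModelForm n} {F H : Model n → ℝ}

/-- The variation of the inverse metric. -/
def inverseVar (G S : Model n → ModelForm n) (y : Model n) (k l : Fin n) : ℝ :=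
  -∑ a, ∑ b, invEntry (G y) k a * S y (stdVec a) (stdVec b) * invEntry (G y) b l

/-- The variation of the densitized inverse metric `√|det G| G^{kl}`. -/
def densityVar (G S : Model n → ModelForm n) (y : Model n) (k l : Fin n) : ℝ :=
  1 / 2 * (volDensity (G y) * ∑ a, ∑ b, invEntry (G y) a b * S y (stdVec a) (stdVec b)) *
    invEntry (G y) k l + volDensity (G y) * inverseVar G S y k l

/-- The variation of the Christoffel symbols. -/
def christoffelVar (G S : Model n → ModelForm n) (y : Model n) (k v w : Fin n) : ℝ :=
  ∑ l, (inverseVar G S y k l * christoffelFirst G y (stdVec v) (stdVec w) (stdVec l) +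
    invEntry (G y) k l * christoffelFirst S y (stdVec v) (stdVec w) (stdVec l))

/-- The vector density whose divergence is the non-tensorial part of the first variation. -/
def boundaryField (G : Model n → ModelForm n) (F : Model n → ℝ) (S : Model n → ModelForm n)
    (H : Model n → ℝ) (k : Fin n) (y : Model n) : ℝ :=
  ∑ v, ∑ w, volDensity (G y) * invEntry (G y) v w * christoffelVar G S y k v w
    - ∑ w, volDensity (G y) * invEntry (G y) k w * ∑ j, christoffelVar G S y j j w
    + ∑ w, densityVar G S y k w * fderiv ℝ F y (stdVec w)
    + ∑ w, volDensity (G y) * invEntry (G y) k w * fderiv ℝ H y (stdVec w)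
    - 2 * H y * ∑ w, volDensity (G y) * invEntry (G y) k w * fderiv ℝ F y (stdVec w)

/-- The tensorial part of the first variation, as a density. -/
def eulerDensity (G : Model n → ModelForm n) (F : Model n → ℝ) (S : Model n → ModelForm n)
    (H : Model n → ℝ) (y : Model n) : ℝ :=
  ∑ v, ∑ w, densityVar G S y v w * (localRicci G y (stdVec v) (stdVec w) -
      fderiv ℝ F y (stdVec v) * fderiv ℝ F y (stdVec w))
    + 2 * H y * ∑ v, ∑ w, volDensity (G y) * invEntry (G y) v w *
        localHessian G F y (stdVec v) (stdVec w)

theorem localDensity_eq_sum (G : Model n → ModelForm n) (F : Model n → ℝ) (y : Model n) :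
    localDensity G F y = ∑ v, ∑ w, volDensity (G y) * invEntry (G y) v w *
      (localRicci G y (stdVec v) (stdVec w) + localHessian G F y (stdVec v) (stdVec w) -
        fderiv ℝ F y (stdVec v) * fderiv ℝ F y (stdVec w)) := by
  rw [localDensity, trace_inverse_comp]
  simp only [Finset.mul_sum, mul_assoc]
  simp

namespace IsVariation

variable (hV : IsVariation U G S F H)
include hV

theorem eventually_slice {z : ℝ × Model n} (hz : z ∈ regularSet U G S) :
    ∀ᶠ y in nhds z.2, (z.1, y) ∈ regularSet U G S :=
  (Continuous.prodMk_right z.1).continuousAt.eventually (hV.isOpen_regularSet.mem_nhds hz)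

theorem evalAt_spaceDeriv {z : ℝ × Model n} (hz : z ∈ regularSet U G S)
    (a : smoothRing (regularSet U G S)) (k : Fin n) :
    evalAt z (hV.spaceDeriv k a) = fderiv ℝ (fun y => evalAt (z.1, y) a) z.2 (stdVec k) := by
  rw [spaceDeriv, evalAt_partialDeriv _ _ _ hz]
  have h := ((contDiffAt_coe hV.isOpen_regularSet a hz).differentiableAt (by simp)).hasFDerivAt
  have h2 := (HasFDerivAt.comp z.2 (f := fun y => (z.1, y)) h (hasFDerivAt_prodMk_right z.1 z.2))
  have e := h2.fderiv
  rw [show (fun y => evalAt (z.1, y) a) = (a : ℝ × Model n → ℝ) ∘ fun y => (z.1, y) from rfl, e]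
  rfl

/-- If `a` agrees near `y` with the function `φ` on the slice through `z`, its spatial derivatives
are those of `φ`. -/
theorem evalAt_spaceDeriv_of_eq {z : ℝ × Model n} (hz : z ∈ regularSet U G S)
    {a : smoothRing (regularSet U G S)} {φ : Model n → ℝ}
    (h : ∀ y, (z.1, y) ∈ regularSet U G S → evalAt (z.1, y) a = φ y) (k : Fin n) :
    evalAt z (hV.spaceDeriv k a) = fderiv ℝ φ z.2 (stdVec k) := by
  rw [hV.evalAt_spaceDeriv hz]
  have : (fun y => evalAt (z.1, y) a) =ᶠ[nhds z.2] φ := by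
    filter_upwards [hV.eventually_slice hz] with y hy using h y hy
  rw [this.fderiv_eq]

theorem hasDerivAt_evalAt {z : ℝ × Model n} (hz : z ∈ regularSet U G S)
    (a : smoothRing (regularSet U G S)) :
    HasDerivAt (fun t => evalAt (t, z.2) a) (evalAt z (hV.timeDeriv a)) z.1 := by
  rw [timeDeriv, evalAt_partialDeriv _ _ _ hz]
  have h := ((contDiffAt_coe hV.isOpen_regularSet a hz).differentiableAt (by simp)).hasFDerivAt
  exact HasFDerivAt.comp_hasDerivAt z.1 (f := fun t => (t, z.2)) h
    ((hasDerivAt_id z.1).prodMk (hasDerivAt_const z.1 z.2))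

theorem eventually_time {z : ℝ × Model n} (hz : z ∈ regularSet U G S) :
    ∀ᶠ t in nhds z.1, (t, z.2) ∈ regularSet U G S :=
  (Continuous.prodMk_left z.2).continuousAt.eventually (hV.isOpen_regularSet.mem_nhds hz)

theorem evalAt_timeDeriv_of_eq {z : ℝ × Model n} (hz : z ∈ regularSet U G S)
    {a : smoothRing (regularSet U G S)} {φ : ℝ → ℝ} {φ' : ℝ}
    (h : ∀ t, (t, z.2) ∈ regularSet U G S → evalAt (t, z.2) a = φ t) (hφ : HasDerivAt φ φ' z.1) :
    evalAt z (hV.timeDeriv a) = φ' := by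
  refine (hV.hasDerivAt_evalAt hz a).unique (hφ.congr_of_eventuallyEq ?_)
  filter_upwards [hV.eventually_time hz] with t ht using h t ht

theorem time_space_comm (k : Fin n) (a : smoothRing (regularSet U G S)) :
    hV.timeDeriv (hV.spaceDeriv k a) = hV.spaceDeriv k (hV.timeDeriv a) :=
  partialDeriv_comm _ _ _ _

theorem space_comm (i j : Fin n) (a : smoothRing (regularSet U G S)) :
    hV.spaceDeriv i (hV.spaceDeriv j a) = hV.spaceDeriv j (hV.spaceDeriv i a) :=
  partialDeriv_comm _ _ _ _

theorem evalAt_ringChristoffelFirst {z : ℝ × Model n} (hz : z ∈ regularSet U G S)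
    {a : Fin n → Fin n → smoothRing (regularSet U G S)} {T : Model n → ModelForm n}
    (hT : DifferentiableAt ℝ T z.2)
    (h : ∀ y, (z.1, y) ∈ regularSet U G S →
      ∀ i j, evalAt (z.1, y) (a i j) = T y (stdVec i) (stdVec j)) (i j k : Fin n) :
    evalAt z (ringChristoffelFirst hV.spaceDeriv a i j k) =
      christoffelFirst T z.2 (stdVec i) (stdVec j) (stdVec k) := by
  have e : ∀ p q r, evalAt z (hV.spaceDeriv p (a q r)) =
      fderiv ℝ T z.2 (stdVec p) (stdVec q) (stdVec r) := by
    intro p q r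
    rw [hV.evalAt_spaceDeriv_of_eq hz (fun y hy => h y hy q r)]
    have h1 := (hT.hasFDerivAt.clm_apply (hasFDerivAt_const (stdVec q) z.2)).clm_apply
      (hasFDerivAt_const (stdVec r) z.2)
    rw [h1.fderiv]
    simp
  rw [christoffelFirst_apply, ringChristoffelFirst, map_smul, map_sub, map_add, e, e, e,
    smul_eq_mul]

/-- The Christoffel symbols of the family of metrics as elements of the ring. -/
abbrev christoffelElt (k i j : Fin n) : smoothRing (regularSet U G S) :=
  ringChristoffel hV.spaceDeriv hV.metricElt hV.inverseElt k i j

theorem evalAt_christoffelElt {z : ℝ × Model n} (hz : z ∈ regularSet U G S) (k i j : Fin n) :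
    evalAt z (hV.christoffelElt k i j) =
      christoffel (fun y => G y + z.1 • S y) z.2 (stdVec i) (stdVec j) k := by
  rw [christoffel_eq_sum, christoffelElt, ringChristoffel, map_sum]
  refine Finset.sum_congr rfl fun l _ => ?_
  rw [map_mul, hV.evalAt_inverseElt hz, hV.evalAt_ringChristoffelFirst hz
    ((hV.contDiffAt_slice hz).differentiableAt (by simp))
    (fun y hy i j => hV.evalAt_metricElt hy i j)]

theorem evalAt_ringRicci {z : ℝ × Model n} (hz : z ∈ regularSet U G S) (v w : Fin n) :
    evalAt z (ringRicci hV.spaceDeriv hV.christoffelElt v w) =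
      localRicci (fun y => G y + z.1 • S y) z.2 (stdVec v) (stdVec w) := by
  rw [localRicci_eq_sum (hV.contDiffAt_slice hz) hz.2, ringRicci]
  have e : ∀ p k i j, evalAt z (hV.spaceDeriv p (hV.christoffelElt k i j)) = _ := fun p k i j =>
    hV.evalAt_spaceDeriv_of_eq hz (fun y hy => hV.evalAt_christoffelElt hy k i j) p
  simp only [map_add, map_sub, map_sum, map_mul, e, hV.evalAt_christoffelElt hz]

theorem evalAt_deriv_potentialElt {z : ℝ × Model n} (hz : z ∈ regularSet U G S) (k : Fin n) :
    evalAt z (hV.spaceDeriv k hV.potentialElt) =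
      fderiv ℝ (fun y => F y + z.1 * H y) z.2 (stdVec k) :=
  hV.evalAt_spaceDeriv_of_eq hz (fun _ _ => rfl) k

theorem evalAt_ringHessian {z : ℝ × Model n} (hz : z ∈ regularSet U G S) (v w : Fin n) :
    evalAt z (ringHessian hV.spaceDeriv hV.christoffelElt hV.potentialElt v w) =
      localHessian (fun y => G y + z.1 • S y) (fun y => F y + z.1 * H y) z.2
        (stdVec v) (stdVec w) := by
  rw [localHessian_eq_sum (hV.contDiffAt_slice_function hz), ringHessian, map_sub, map_sum,
    hV.evalAt_spaceDeriv_of_eq hz (fun y hy => hV.evalAt_deriv_potentialElt hy w) v]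
  congr 1
  refine Finset.sum_congr rfl fun k _ => ?_
  rw [map_mul, hV.evalAt_deriv_potentialElt hz, hV.evalAt_christoffelElt hz]

/-- The integrand of the action for the family `(G + t S, F + t H)`, as an element of the ring. -/
def lagrangianElt : smoothRing (regularSet U G S) :=
  ∑ v, ∑ w, (hV.volElt * hV.inverseElt v w) *
    (ringRicci hV.spaceDeriv hV.christoffelElt v w
      + ringHessian hV.spaceDeriv hV.christoffelElt hV.potentialElt v w
      - hV.spaceDeriv v hV.potentialElt * hV.spaceDeriv w hV.potentialElt)

theorem evalAt_lagrangianElt {z : ℝ × Model n} (hz : z ∈ regularSet U G S) :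
    evalAt z hV.lagrangianElt =
      localDensity (fun y => G y + z.1 • S y) (fun y => F y + z.1 * H y) z.2 := by
  rw [localDensity_eq_sum, lagrangianElt]
  simp only [map_sum, map_mul, map_add, map_sub, hV.evalAt_volElt hz, hV.evalAt_inverseElt hz,
    hV.evalAt_ringRicci hz, hV.evalAt_ringHessian hz, hV.evalAt_deriv_potentialElt hz]

theorem timeDeriv_ringChristoffelFirst (i j k : Fin n) :
    hV.timeDeriv (ringChristoffelFirst hV.spaceDeriv hV.metricElt i j k) =
      ringChristoffelFirst hV.spaceDeriv (fun i j => hV.timeDeriv (hV.metricElt i j)) i j k := by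
  simp only [ringChristoffelFirst, Derivation.map_smul, map_add, map_sub, hV.time_space_comm]

theorem evalAt_timeDeriv_metricElt {z : ℝ × Model n} (hz : z ∈ regularSet U G S) (i j : Fin n) :
    evalAt z (hV.timeDeriv (hV.metricElt i j)) = S z.2 (stdVec i) (stdVec j) := by
  refine hV.evalAt_timeDeriv_of_eq hz (fun t ht => hV.evalAt_metricElt ht i j) ?_
  simp only [add_apply, smul_apply, smul_eq_mul]
  simpa using ((hasDerivAt_id z.1).mul_const (S z.2 (stdVec i) (stdVec j))).const_add
    (G z.2 (stdVec i) (stdVec j))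

theorem evalAt_timeDeriv_potentialElt {z : ℝ × Model n} (hz : z ∈ regularSet U G S) :
    evalAt z (hV.timeDeriv hV.potentialElt) = H z.2 := by
  refine hV.evalAt_timeDeriv_of_eq hz (φ := fun t => F z.2 + t * H z.2) (fun t _ => rfl) ?_
  simpa using ((hasDerivAt_id z.1).mul_const (H z.2)).const_add (F z.2)

section AtZero

variable {y : Model n} (hy : (0, y) ∈ regularSet U G S)
include hy

theorem evalAt_zero_inverseElt (k l : Fin n) :
    evalAt (0, y) (hV.inverseElt k l) = invEntry (G y) k l := by
  rw [hV.evalAt_inverseElt hy]; simp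

theorem evalAt_zero_volElt : evalAt (0, y) hV.volElt = volDensity (G y) := by
  rw [hV.evalAt_volElt hy]; simp

theorem evalAt_zero_inverseVar (k l : Fin n) :
    evalAt (0, y) (hV.timeDeriv (hV.inverseElt k l)) = inverseVar G S y k l := by
  rw [deriv_inverse hV.timeDeriv hV.sum_metricElt_mul hV.sum_inverseElt_mul k l, inverseVar]
  simp only [map_neg, map_sum, map_mul, hV.evalAt_zero_inverseElt hy,
    hV.evalAt_timeDeriv_metricElt hy]

theorem evalAt_zero_densityVar (k l : Fin n) :
    evalAt (0, y) (hV.timeDeriv (hV.volElt * hV.inverseElt k l)) = densityVar G S y k l := by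
  rw [Derivation.leibniz, hV.deriv_volElt, densityVar]
  simp only [smul_eq_mul, map_add, map_mul, map_smul, map_sum, hV.evalAt_zero_inverseElt hy,
    hV.evalAt_zero_volElt hy, hV.evalAt_zero_inverseVar hy, hV.evalAt_timeDeriv_metricElt hy]
  ring

theorem evalAt_zero_christoffelVar (k v w : Fin n) :
    evalAt (0, y) (hV.timeDeriv (hV.christoffelElt k v w)) = christoffelVar G S y k v w := by
  rw [christoffelElt, ringChristoffel, christoffelVar, map_sum, map_sum]
  refine Finset.sum_congr rfl fun l _ => ?_
  have h1 := hV.evalAt_ringChristoffelFirst hy (T := S)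
    ((hV.tensor_smooth.contDiffAt (hV.isOpen.mem_nhds hy.1)).differentiableAt (by simp))
    (fun y hy i j => hV.evalAt_timeDeriv_metricElt hy i j) v w l
  have h2 := hV.evalAt_ringChristoffelFirst hy (T := G) (a := hV.metricElt)
    ((hV.metric_smooth.contDiffAt (hV.isOpen.mem_nhds hy.1)).differentiableAt (by simp))
    (fun y hy i j => by rw [hV.evalAt_metricElt hy]; simp) v w l
  rw [Derivation.leibniz, hV.timeDeriv_ringChristoffelFirst, map_add, smul_eq_mul, smul_eq_mul,
    map_mul, map_mul, hV.evalAt_zero_inverseVar hy, hV.evalAt_zero_inverseElt hy, h1, h2]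
  ring

theorem evalAt_zero_deriv_potentialElt (k : Fin n) :
    evalAt (0, y) (hV.spaceDeriv k hV.potentialElt) = fderiv ℝ F y (stdVec k) := by
  rw [hV.evalAt_deriv_potentialElt hy]; simp

theorem evalAt_zero_ringRicci (v w : Fin n) :
    evalAt (0, y) (ringRicci hV.spaceDeriv hV.christoffelElt v w) =
      localRicci G y (stdVec v) (stdVec w) := by
  rw [hV.evalAt_ringRicci hy]; simp

theorem evalAt_zero_ringHessian (v w : Fin n) :
    evalAt (0, y) (ringHessian hV.spaceDeriv hV.christoffelElt hV.potentialElt v w) =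
      localHessian G F y (stdVec v) (stdVec w) := by
  rw [hV.evalAt_ringHessian hy]; simp

omit hy in
/-- The vector density `boundaryField` as an element of the ring. -/
def boundaryElt (k : Fin n) : smoothRing (regularSet U G S) :=
  ∑ v, ∑ w, (hV.volElt * hV.inverseElt v w) * hV.timeDeriv (hV.christoffelElt k v w)
    - ∑ w, (hV.volElt * hV.inverseElt k w) * ∑ j, hV.timeDeriv (hV.christoffelElt j j w)
    + ∑ w, hV.timeDeriv (hV.volElt * hV.inverseElt k w) * hV.spaceDeriv w hV.potentialElt
    + ∑ w, (hV.volElt * hV.inverseElt k w) * hV.spaceDeriv w (hV.timeDeriv hV.potentialElt)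
    - 2 * hV.timeDeriv hV.potentialElt *
      ∑ w, (hV.volElt * hV.inverseElt k w) * hV.spaceDeriv w hV.potentialElt

theorem evalAt_zero_boundaryElt (k : Fin n) :
    evalAt (0, y) (hV.boundaryElt k) = boundaryField G F S H k y := by
  have e : ∀ w, evalAt (0, y) (hV.spaceDeriv w (hV.timeDeriv hV.potentialElt)) =
      fderiv ℝ H y (stdVec w) := fun w =>
    hV.evalAt_spaceDeriv_of_eq hy (fun y hy => hV.evalAt_timeDeriv_potentialElt hy) w
  rw [boundaryElt, boundaryField]
  simp only [map_add, map_sub, map_sum, map_mul (evalAt _), map_ofNat,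
    hV.evalAt_zero_inverseElt hy,
    hV.evalAt_zero_volElt hy, hV.evalAt_zero_christoffelVar hy, hV.evalAt_zero_densityVar hy, e,
    hV.evalAt_zero_deriv_potentialElt hy, hV.evalAt_timeDeriv_potentialElt hy]

theorem contDiffAt_boundaryField (k : Fin n) : ContDiffAt ℝ ∞ (boundaryField G F S H k) y := by
  have h : ContDiffAt ℝ ∞ (fun y => evalAt (0, y) (hV.boundaryElt k)) y :=
    (contDiffAt_coe hV.isOpen_regularSet (hV.boundaryElt k) hy).comp y
      (contDiff_prodMk_right (0 : ℝ)).contDiffAt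
  refine h.congr_of_eventuallyEq ?_
  filter_upwards [hV.eventually_slice hy] with y hy
  exact (hV.evalAt_zero_boundaryElt hy k).symm

/-- The first variation of the density: a tensorial part and a divergence. -/
theorem evalAt_zero_timeDeriv_lagrangianElt :
    evalAt (0, y) (hV.timeDeriv hV.lagrangianElt) =
      eulerDensity G F S H y + ∑ k, fderiv ℝ (boundaryField G F S H k) y (stdVec k) := by
  have h := hV.isParallelDensity.deriv_lagrangian
    (fun v w => by rw [hV.inverseElt_symm v w])
    (ringChristoffel_symm hV.metricElt_symm) hV.time_space_comm hV.potentialElt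
  have e : ∀ k, evalAt (0, y) (hV.spaceDeriv k (hV.boundaryElt k)) =
      fderiv ℝ (boundaryField G F S H k) y (stdVec k) := fun k =>
    hV.evalAt_spaceDeriv_of_eq hy (fun y hy => hV.evalAt_zero_boundaryElt hy k) k
  rw [lagrangianElt, h, map_add, map_sum]
  refine congrArg₂ _ ?_ (Finset.sum_congr rfl fun k _ => e k)
  rw [eulerDensity]
  simp only [map_add, map_sub, map_sum, map_mul (evalAt _), map_ofNat,
    hV.evalAt_zero_inverseElt hy,
    hV.evalAt_zero_volElt hy, hV.evalAt_zero_densityVar hy,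
    hV.evalAt_zero_deriv_potentialElt hy, hV.evalAt_timeDeriv_potentialElt hy,
    hV.evalAt_zero_ringRicci hy, hV.evalAt_zero_ringHessian hy]

/-- The Ricci tensor of a metric is symmetric. -/
theorem localRicci_symm (v w : Model n) : localRicci G y v w = localRicci G y w v := by
  have hs : ∀ i j, localRicci G y (stdVec i) (stdVec j) = localRicci G y (stdVec j) (stdVec i) := by
    intro i j
    rw [← hV.evalAt_zero_ringRicci hy, ← hV.evalAt_zero_ringRicci hy]
    have pos : ∀ z ∈ regularSet U G S, evalAt z hV.volElt ≠ 0 := fun z hz => by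
      rw [hV.evalAt_volElt hz]
      exact (volDensity_pos hz.2 (hV.family_symm hz)).ne'
    let s' : smoothRing (regularSet U G S) :=
      ⟨fun z => (evalAt z hV.volElt)⁻¹, ContDiffOn.inv hV.volElt.2 pos⟩
    have hs' : s' * hV.volElt = 1 := by
      refine smoothRing_ext fun z => ?_
      rw [map_mul, map_one]
      refine inv_mul_cancel₀ (a := evalAt z hV.volElt) ?_
      by_cases hz : z ∈ regularSet U G S
      · exact pos z hz
      · rw [hV.evalAt_volElt_of_notMem hz]; exact one_ne_zero
    exact congrArg _ (ringRicci_symm hV.metricElt_symm hV.inverseElt_symm hV.space_comm hs'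
      (fun k => hV.deriv_volElt (hV.spaceDeriv k)) i j)
  rw [vector_eq_sum v, vector_eq_sum w]
  simp only [map_sum, map_smul, sum_apply, smul_apply, smul_eq_mul, Finset.mul_sum]
  rw [Finset.sum_comm]
  refine Finset.sum_congr rfl fun i _ => Finset.sum_congr rfl fun j _ => ?_
  rw [hs j i]; ring

end AtZero

end IsVariation

end VariationFormula

/-! ### Invariance of the local tensors under changes of coordinates -/

section Pullback

variable {V W : Type*} [AddCommGroup V] [Module ℝ V] [TopologicalSpace V]
  [AddCommGroup W] [Module ℝ W] [TopologicalSpace W]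

/-- The pullback of a bilinear form by a linear map. -/
def pullForm (A : V →L[ℝ] W) (B : W →L[ℝ] W →L[ℝ] ℝ) : V →L[ℝ] V →L[ℝ] ℝ :=
  (ContinuousLinearMap.precomp ℝ A) ∘L B ∘L A

@[simp] theorem pullForm_apply (A : V →L[ℝ] W) (B : W →L[ℝ] W →L[ℝ] ℝ) (v w : V) :
    pullForm A B v w = B (A v) (A w) := rfl

variable {A : V →L[ℝ] W} {g : W →L[ℝ] W →L[ℝ] ℝ}

theorem pullForm_inverse_aux (hA : A.IsInvertible) (hg : g.IsInvertible) :
    (pullForm A g).IsInvertible ∧ (pullForm A g).inverse =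
      A.inverse ∘L g.inverse ∘L ContinuousLinearMap.precomp ℝ A.inverse := by
  have h1 : (A.inverse ∘L g.inverse ∘L ContinuousLinearMap.precomp ℝ A.inverse) ∘L pullForm A g =
      .id ℝ V := by
    ext v
    have : (ContinuousLinearMap.precomp ℝ A.inverse) (pullForm A g v) = g (A v) := by
      ext w
      simp [hA.self_apply_inverse]
    simp [this, hg.inverse_apply_self, hA.inverse_apply_self]
  have h2 : pullForm A g ∘L (A.inverse ∘L g.inverse ∘L ContinuousLinearMap.precomp ℝ A.inverse) =
      .id ℝ _ := by
    ext α v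
    simp [hA.self_apply_inverse, hg.self_apply_inverse, hA.inverse_apply_self]
  exact ⟨.of_inverse h2 h1, ContinuousLinearMap.inverse_eq h2 h1⟩

theorem pullForm_isInvertible (hA : A.IsInvertible) (hg : g.IsInvertible) :
    (pullForm A g).IsInvertible := (pullForm_inverse_aux hA hg).1

theorem pullForm_inverse (hA : A.IsInvertible) (hg : g.IsInvertible) :
    (pullForm A g).inverse = A.inverse ∘L g.inverse ∘L ContinuousLinearMap.precomp ℝ A.inverse :=
  (pullForm_inverse_aux hA hg).2

theorem pullForm_inverse_comp (hA : A.IsInvertible) (hg : g.IsInvertible)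
    (B : W →L[ℝ] W →L[ℝ] ℝ) :
    (pullForm A g).inverse ∘L pullForm A B = A.inverse ∘L (g.inverse ∘L B) ∘L A := by
  rw [pullForm_inverse hA hg]
  ext v
  have : (ContinuousLinearMap.precomp ℝ A.inverse) (pullForm A B v) = B (A v) := by
    ext w
    simp [hA.self_apply_inverse]
  simp [this]

theorem trace_conj_inverse [FiniteDimensional ℝ V] [FiniteDimensional ℝ W] (hA : A.IsInvertible)
    (T : W →L[ℝ] W) :
    LinearMap.trace ℝ V (A.inverse ∘L T ∘L A).toLinearMap =
      LinearMap.trace ℝ W T.toLinearMap := by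
  have h : (A.inverse ∘L T ∘L A).toLinearMap = A.inverse.toLinearMap ∘ₗ (T ∘L A).toLinearMap := rfl
  rw [h, LinearMap.trace_comp_comm']
  congr 1
  ext w
  simp [hA.self_apply_inverse]

/-- The trace of a bilinear form with respect to a metric is invariant. -/
theorem trace_pullForm [FiniteDimensional ℝ V] [FiniteDimensional ℝ W] (hA : A.IsInvertible)
    (hg : g.IsInvertible) (B : W →L[ℝ] W →L[ℝ] ℝ) :
    LinearMap.trace ℝ V ((pullForm A g).inverse ∘L pullForm A B).toLinearMap =
      LinearMap.trace ℝ W (g.inverse ∘L B).toLinearMap := by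
  rw [pullForm_inverse_comp hA hg, trace_conj_inverse hA]

end Pullback

section Naturality

variable {n : ℕ}

/-- `ψ` is a smooth map from `V` to `U` with invertible differential, and pulls the metric `G`
back to `G'`. -/
structure IsLocalIsometry (V U : Set (Model n)) (ψ : Model n → Model n)
    (G' G : Model n → ModelForm n) : Prop where
  isOpen_source : IsOpen V
  isOpen_target : IsOpen U
  mapsTo : Set.MapsTo ψ V U
  smooth : ContDiffOn ℝ ∞ ψ V
  smooth_metric : ContDiffOn ℝ ∞ G U
  symm : ∀ y ∈ U, ∀ v w, G y v w = G y w v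
  nondegenerate : ∀ y ∈ U, (G y).IsInvertible
  isInvertible : ∀ y ∈ V, (fderiv ℝ ψ y).IsInvertible
  pullback : ∀ y ∈ V, G' y = pullForm (fderiv ℝ ψ y) (G (ψ y))

namespace IsLocalIsometry

variable {V U : Set (Model n)} {ψ : Model n → Model n} {G' G : Model n → ModelForm n}
  (hψ : IsLocalIsometry V U ψ G' G) {y : Model n} (hy : y ∈ V)
include hψ hy

theorem contDiffAt : ContDiffAt ℝ ∞ ψ y :=
  hψ.smooth.contDiffAt (hψ.isOpen_source.mem_nhds hy)

theorem contDiffAt_metric : ContDiffAt ℝ ∞ G (ψ y) :=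
  hψ.smooth_metric.contDiffAt (hψ.isOpen_target.mem_nhds (hψ.mapsTo hy))

theorem isInvertible_pullback : (G' y).IsInvertible := by
  rw [hψ.pullback y hy]
  exact pullForm_isInvertible (hψ.isInvertible y hy) (hψ.nondegenerate _ (hψ.mapsTo hy))

theorem contDiffAt_pullback : ContDiffAt ℝ ∞ G' y := by
  have h : ContDiffAt ℝ ∞ (fun z => pullForm (fderiv ℝ ψ z) (G (ψ z))) y := by
    refine contDiffAt_clm_apply_of_finiteDimensional fun v =>
      contDiffAt_clm_apply_of_finiteDimensional fun w => ?_
    simp only [pullForm_apply]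
    have h1 := contDiffAt_fderiv (hψ.contDiffAt hy)
    have h2 := (hψ.contDiffAt_metric hy).comp y (hψ.contDiffAt hy)
    exact (h2.clm_apply (h1.clm_apply contDiffAt_const)).clm_apply (h1.clm_apply contDiffAt_const)
  refine h.congr_of_eventuallyEq ?_
  filter_upwards [hψ.isOpen_source.mem_nhds hy] with z hz using hψ.pullback z hz

theorem second_deriv_symm (u v : Model n) :
    fderiv ℝ (fderiv ℝ ψ) y u v = fderiv ℝ (fderiv ℝ ψ) y v u :=
  ((hψ.contDiffAt hy).isSymmSndFDerivAt (by
    rw [minSmoothness_of_isRCLikeNormedField]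
    exact WithTop.coe_le_coe.2 (le_top : (2 : ℕ∞) ≤ ⊤))).eq u v

theorem third_deriv_symm (u v w : Model n) :
    fderiv ℝ (fderiv ℝ (fderiv ℝ ψ)) y u v w = fderiv ℝ (fderiv ℝ (fderiv ℝ ψ)) y v u w := by
  rw [((contDiffAt_fderiv (hψ.contDiffAt hy)).isSymmSndFDerivAt (by
    rw [minSmoothness_of_isRCLikeNormedField]
    exact WithTop.coe_le_coe.2 (le_top : (2 : ℕ∞) ≤ ⊤))).eq u v]

theorem fderiv_pullback (u v w : Model n) :
    fderiv ℝ G' y u v w =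
      fderiv ℝ G (ψ y) (fderiv ℝ ψ y u) (fderiv ℝ ψ y v) (fderiv ℝ ψ y w)
      + G (ψ y) (fderiv ℝ (fderiv ℝ ψ) y u v) (fderiv ℝ ψ y w)
      + G (ψ y) (fderiv ℝ ψ y v) (fderiv ℝ (fderiv ℝ ψ) y u w) := by
  have h1 := ((hψ.contDiffAt hy).differentiableAt (by simp)).hasFDerivAt
  have h2 := ((contDiffAt_fderiv (hψ.contDiffAt hy)).differentiableAt (by simp)).hasFDerivAt
  have h3 := ((hψ.contDiffAt_metric hy).differentiableAt (by simp)).hasFDerivAt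
  have h4 := ((hψ.contDiffAt_pullback hy).differentiableAt (by simp)).hasFDerivAt
  have l := (h4.clm_apply (hasFDerivAt_const v y)).clm_apply (hasFDerivAt_const w y)
  have r := ((h3.comp y h1).clm_apply (h2.clm_apply (hasFDerivAt_const v y))).clm_apply
    (h2.clm_apply (hasFDerivAt_const w y))
  have e : (fun z => G' z v w) =ᶠ[nhds y]
      fun z => (G ∘ ψ) z (fderiv ℝ ψ z v) (fderiv ℝ ψ z w) := by
    filter_upwards [hψ.isOpen_source.mem_nhds hy] with z hz
    rw [hψ.pullback z hz]; rfl
  have := congrArg (fun T => T u) (l.unique (r.congr_of_eventuallyEq e))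
  simp at this
  rw [this]
  ring

/-- The transformation law of the Christoffel symbols. -/
theorem christoffel_pullback (u v : Model n) :
    fderiv ℝ ψ y (christoffel G' y u v) =
      christoffel G (ψ y) (fderiv ℝ ψ y u) (fderiv ℝ ψ y v) + fderiv ℝ (fderiv ℝ ψ) y u v := by
  have hi := hψ.nondegenerate _ (hψ.mapsTo hy)
  have hs := hψ.symm _ (hψ.mapsTo hy)
  apply hi.injective
  ext w'
  obtain ⟨w, rfl⟩ := (hψ.isInvertible y hy).surjective w'
  have sym' := fun u v => hψ.second_deriv_symm hy v u
  have e1 : G (ψ y) (fderiv ℝ ψ y (christoffel G' y u v)) (fderiv ℝ ψ y w) =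
      christoffelFirst G' y u v w := by
    have := congrArg (fun α => α w)
      ((hψ.isInvertible_pullback hy).self_apply_inverse (christoffelFirst G' y u v))
    rw [← christoffel_apply] at this
    simp only [hψ.pullback y hy, pullForm_apply] at this
    exact this
  rw [e1, map_add, add_apply, christoffel_apply, hi.self_apply_inverse, christoffelFirst_apply,
    christoffelFirst_apply, hψ.fderiv_pullback hy, hψ.fderiv_pullback hy, hψ.fderiv_pullback hy,
    sym' u v, sym' u w, sym' v w,
    hs (fderiv ℝ ψ y v) (fderiv ℝ (fderiv ℝ ψ) y u w)]
  ring

theorem fderiv_christoffel_pullback (x u v : Model n) :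
    fderiv ℝ (fderiv ℝ ψ) y x (christoffel G' y u v)
      + fderiv ℝ ψ y (fderiv ℝ (christoffel G') y x u v) =
    fderiv ℝ (christoffel G) (ψ y) (fderiv ℝ ψ y x) (fderiv ℝ ψ y u) (fderiv ℝ ψ y v)
      + christoffel G (ψ y) (fderiv ℝ (fderiv ℝ ψ) y x u) (fderiv ℝ ψ y v)
      + christoffel G (ψ y) (fderiv ℝ ψ y u) (fderiv ℝ (fderiv ℝ ψ) y x v)
      + fderiv ℝ (fderiv ℝ (fderiv ℝ ψ)) y x u v := by
  have h1 := ((hψ.contDiffAt hy).differentiableAt (by simp)).hasFDerivAt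
  have h2 := ((contDiffAt_fderiv (hψ.contDiffAt hy)).differentiableAt (by simp)).hasFDerivAt
  have h3 := ((contDiffAt_fderiv (contDiffAt_fderiv (hψ.contDiffAt hy))).differentiableAt
    (by simp)).hasFDerivAt
  have h4 := ((contDiffAt_christoffel (hψ.contDiffAt_metric hy)
    (hψ.nondegenerate _ (hψ.mapsTo hy))).differentiableAt (by simp)).hasFDerivAt
  have h5 := ((contDiffAt_christoffel (hψ.contDiffAt_pullback hy)
    (hψ.isInvertible_pullback hy)).differentiableAt (by simp)).hasFDerivAt
  have l := h2.clm_apply ((h5.clm_apply (hasFDerivAt_const u y)).clm_apply (hasFDerivAt_const v y))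
  have r := (((h4.comp y h1).clm_apply (h2.clm_apply (hasFDerivAt_const u y))).clm_apply
    (h2.clm_apply (hasFDerivAt_const v y))).add
    ((h3.clm_apply (hasFDerivAt_const u y)).clm_apply (hasFDerivAt_const v y))
  have e : (fun z => fderiv ℝ ψ z (christoffel G' z u v)) =ᶠ[nhds y]
      ((fun z => (christoffel G ∘ ψ) z (fderiv ℝ ψ z u) (fderiv ℝ ψ z v)) +
        fun z => fderiv ℝ (fderiv ℝ ψ) z u v) := by
    filter_upwards [hψ.isOpen_source.mem_nhds hy] with z hz
    exact hψ.christoffel_pullback hz u v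
  have := congrArg (fun T => T x) (l.unique (r.congr_of_eventuallyEq e))
  simp at this
  rw [add_comm, this]
  abel

/-- The curvature is natural. -/
theorem curvature_pullback (u v w : Model n) :
    fderiv ℝ ψ y (curvatureEnd G' y v w u) =
      curvatureEnd G (ψ y) (fderiv ℝ ψ y v) (fderiv ℝ ψ y w) (fderiv ℝ ψ y u) := by
  have e1 := eq_sub_of_add_eq' (hψ.fderiv_christoffel_pullback hy u v w)
  have e2 := eq_sub_of_add_eq' (hψ.fderiv_christoffel_pullback hy v u w)
  simp only [curvatureEnd_apply, map_sub, map_add, e1, e2,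
    hψ.christoffel_pullback hy u (christoffel G' y v w),
    hψ.christoffel_pullback hy v (christoffel G' y u w), hψ.christoffel_pullback hy v w,
    hψ.christoffel_pullback hy u w, hψ.third_deriv_symm hy v u w, hψ.second_deriv_symm hy v u]
  abel

/-- The Ricci tensor is natural. -/
theorem localRicci_pullback (v w : Model n) :
    localRicci G' y v w = localRicci G (ψ y) (fderiv ℝ ψ y v) (fderiv ℝ ψ y w) := by
  rw [localRicci_apply, localRicci_apply, ← trace_conj_inverse (hψ.isInvertible y hy)
    (curvatureEnd G (ψ y) (fderiv ℝ ψ y v) (fderiv ℝ ψ y w))]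
  congr 2
  ext1 u
  simp [← hψ.curvature_pullback hy, (hψ.isInvertible y hy).inverse_apply_self]

/-- The Hessian is natural. -/
theorem localHessian_pullback {F : Model n → ℝ} (hF : ContDiffOn ℝ ∞ F U) (u v : Model n) :
    localHessian G' (F ∘ ψ) y u v =
      localHessian G F (ψ y) (fderiv ℝ ψ y u) (fderiv ℝ ψ y v) := by
  have hF' : ∀ z ∈ V, ContDiffAt ℝ ∞ F (ψ z) := fun z hz =>
    hF.contDiffAt (hψ.isOpen_target.mem_nhds (hψ.mapsTo hz))
  have comp : ∀ z ∈ V, fderiv ℝ (F ∘ ψ) z = (fderiv ℝ F (ψ z)).comp (fderiv ℝ ψ z) := fun z hz =>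
    fderiv_comp z ((hF' z hz).differentiableAt (by simp))
      ((hψ.contDiffAt hz).differentiableAt (by simp))
  have h1 := ((hψ.contDiffAt hy).differentiableAt (by simp)).hasFDerivAt
  have h2 := ((contDiffAt_fderiv (hψ.contDiffAt hy)).differentiableAt (by simp)).hasFDerivAt
  have h3 := ((contDiffAt_fderiv (hF' y hy)).differentiableAt (by simp)).hasFDerivAt
  have h4 := ((contDiffAt_fderiv ((hF' y hy).comp y (hψ.contDiffAt hy))).differentiableAt
    (by simp)).hasFDerivAt
  have l := h4.clm_apply (hasFDerivAt_const v y)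
  have r := (h3.comp y h1).clm_apply (h2.clm_apply (hasFDerivAt_const v y))
  have e : (fun z => fderiv ℝ (F ∘ ψ) z v) =ᶠ[nhds y]
      fun z => (fderiv ℝ F ∘ ψ) z (fderiv ℝ ψ z v) := by
    filter_upwards [hψ.isOpen_source.mem_nhds hy] with z hz
    rw [comp z hz]; rfl
  have h := congrArg (fun T => T u) (l.unique (r.congr_of_eventuallyEq e))
  simp at h
  simp only [localHessian, sub_apply, ContinuousLinearMap.comp_apply,
    ContinuousLinearMap.compL_apply]
  rw [h, comp y hy, ContinuousLinearMap.comp_apply, hψ.christoffel_pullback hy, map_add]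
  ring

end IsLocalIsometry

end Naturality

/-! ### Tensors in charts -/

section Charts

variable {n : ℕ} {M : Type*} [TopologicalSpace M] [ChartedSpace (Model n) M]

/-- The change of coordinates from the chart at `p` to the chart at `q`. -/
def transition (p q : M) : Model n → Model n :=
  fun y => chartAt (Model n) q ((chartAt (Model n) p).symm y)

/-- The domain of the change of coordinates from the chart at `p` to the chart at `q`. -/
def overlap (p q : M) : Set (Model n) :=
  (chartAt (Model n) p).target ∩ (chartAt (Model n) p).symm ⁻¹' (chartAt (Model n) q).source

theorem isOpen_overlap (p q : M) : IsOpen (overlap (n := n) p q) :=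
  (chartAt (Model n) p).isOpen_inter_preimage_symm (chartAt (Model n) q).open_source

theorem transition_mem {p q : M} {y : Model n} (hy : y ∈ overlap p q) :
    transition p q y ∈ overlap q p := by
  refine ⟨(chartAt (Model n) q).map_source hy.2, ?_⟩
  simp only [Set.mem_preimage, transition]
  rw [(chartAt (Model n) q).left_inv hy.2]
  exact (chartAt (Model n) p).map_target hy.1

theorem symm_transition {p q : M} {y : Model n} (hy : y ∈ overlap p q) :
    (chartAt (Model n) q).symm (transition p q y) = (chartAt (Model n) p).symm y :=
  (chartAt (Model n) q).left_inv hy.2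

theorem transition_transition {p q : M} {y : Model n} (hy : y ∈ overlap p q) :
    transition q p (transition p q y) = y := by
  rw [transition, symm_transition hy, (chartAt (Model n) p).right_inv hy.1]

variable [IsManifold 𝓘(ℝ, Model n) ∞ M]

theorem isManifold_one : IsManifold 𝓘(ℝ, Model n) 1 M := IsManifold.of_le (n := ∞) (by simp)

theorem contDiffOn_transition (p q : M) :
    ContDiffOn ℝ ∞ (transition (n := n) p q) (overlap p q) := by
  rw [← contMDiffOn_iff_contDiffOn]
  exact (contMDiffOn_chart (I := 𝓘(ℝ, Model n)) (x := q)).comp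
    ((contMDiffOn_chart_symm (I := 𝓘(ℝ, Model n)) (x := p)).mono Set.inter_subset_left)
    fun y hy => hy.2

theorem chartDeriv_comp_chartSymmDeriv_self {p : M} {y : Model n}
    (hy : y ∈ (chartAt (Model n) p).target) :
    chartDeriv p ((chartAt (Model n) p).symm y) ∘L chartSymmDeriv p y = .id ℝ _ := by
  have := isManifold_one (n := n) (M := M)
  have h := (mdifferentiable_chart (I := 𝓘(ℝ, Model n)) p).comp_symm_deriv hy
  ext1 v
  have h2 := congrArg (fun T => T v) h
  exact h2

theorem chartSymmDeriv_comp_chartDeriv_self {p : M} {y : Model n}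
    (hy : y ∈ (chartAt (Model n) p).target) :
    chartSymmDeriv p y ∘L chartDeriv p ((chartAt (Model n) p).symm y) = .id ℝ _ := by
  have := isManifold_one (n := n) (M := M)
  have h := (mdifferentiable_chart (I := 𝓘(ℝ, Model n)) p).symm_comp_deriv
    ((chartAt (Model n) p).map_target hy)
  rw [(chartAt (Model n) p).right_inv hy] at h
  ext1 v
  exact congrArg (fun T => T v) h

theorem chartSymmDeriv_isInvertible {p : M} {y : Model n}
    (hy : y ∈ (chartAt (Model n) p).target) : (chartSymmDeriv p y).IsInvertible :=
  .of_inverse (chartSymmDeriv_comp_chartDeriv_self hy) (chartDeriv_comp_chartSymmDeriv_self hy)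

theorem chartDeriv_comp_chartSymmDeriv {p q : M} {y : Model n} (hy : y ∈ overlap p q) :
    chartDeriv q ((chartAt (Model n) p).symm y) ∘L chartSymmDeriv p y =
      fderiv ℝ (transition p q) y := by
  have := isManifold_one (n := n) (M := M)
  have h1 := (mdifferentiable_chart (I := 𝓘(ℝ, Model n)) p).mdifferentiableAt_symm hy.1
  have h2 := (mdifferentiable_chart (I := 𝓘(ℝ, Model n)) q).mdifferentiableAt hy.2
  have h := mfderiv_comp y h2 h1
  rw [← mfderiv_eq_fderiv]
  ext1 v
  exact (congrArg (fun T => T v) h).symm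

theorem fderiv_transition_isInvertible {p q : M} {y : Model n} (hy : y ∈ overlap p q) :
    (fderiv ℝ (transition p q) y).IsInvertible := by
  have h : ∀ p q : M, ∀ y ∈ overlap (n := n) p q,
      fderiv ℝ (transition q p) (transition p q y) ∘L fderiv ℝ (transition p q) y = .id ℝ _ := by
    intro p q y hy
    have h1 := ((contDiffOn_transition p q).contDiffAt
      ((isOpen_overlap p q).mem_nhds hy)).differentiableAt (by simp)
    have h2 := ((contDiffOn_transition q p).contDiffAt
      ((isOpen_overlap q p).mem_nhds (transition_mem hy))).differentiableAt (by simp)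
    rw [← fderiv_comp y h2 h1]
    have : transition q p ∘ transition p q =ᶠ[nhds y] id := by
      filter_upwards [(isOpen_overlap p q).mem_nhds hy] with z hz using transition_transition hz
    rw [this.fderiv_eq, fderiv_id]
  have h2 := h q p _ (transition_mem hy)
  rw [transition_transition hy] at h2
  exact .of_inverse h2 (h p q y hy)

theorem localMetric_eq (g : TwoTensor n M) (p : M) (y : Model n) :
    localMetric g p y = pullForm (chartSymmDeriv p y) (g ((chartAt (Model n) p).symm y)) := rfl

/-- A bilinear form is recovered from its components in a chart. -/
theorem eq_pullForm_localMetric (B : ∀ x : M, TangentForm n x) {p x : M}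
    (hx : x ∈ (chartAt (Model n) p).source) :
    B x = pullForm (chartDeriv p x) (pullForm (chartSymmDeriv p (chartAt (Model n) p x))
      (B ((chartAt (Model n) p).symm (chartAt (Model n) p x)))) := by
  have key : ∀ y ∈ (chartAt (Model n) p).target, ∀ x, x = (chartAt (Model n) p).symm y →
      B x = pullForm (chartDeriv p x) (pullForm (chartSymmDeriv p y)
        (B ((chartAt (Model n) p).symm y))) := by
    rintro y hy x rfl
    ext v w
    have h : ∀ v, chartSymmDeriv p y (chartDeriv p ((chartAt (Model n) p).symm y) v) = v :=
      fun v => congrArg (fun T => T v) (chartSymmDeriv_comp_chartDeriv_self hy)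
    rw [pullForm_apply, pullForm_apply, h, h]
  exact key _ ((chartAt (Model n) p).map_source hx) x ((chartAt (Model n) p).left_inv hx).symm

/-- The components of a tensor in two charts are related by the change of coordinates. -/
theorem localMetric_transition (g : TwoTensor n M) {p q : M} {y : Model n}
    (hy : y ∈ overlap p q) :
    localMetric g p y =
      pullForm (fderiv ℝ (transition p q) y) (localMetric g q (transition p q y)) := by
  rw [localMetric_eq, eq_pullForm_localMetric (fun x => g x) hy.2,
    ← chartDeriv_comp_chartSymmDeriv hy]
  rfl

theorem localMetric_symm {g : TwoTensor n M} (hg : IsSymmTensor g) (p : M) (y v w : Model n) :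
    localMetric g p y v w = localMetric g p y w v :=
  hg _ _ _

/-- The trivialization of the tangent bundle over the chart at `p` is the differential of the
chart. -/
theorem trivializationAt_tangent_apply {p x : M} (hx : x ∈ (chartAt (Model n) p).source)
    (v : TangentSpace 𝓘(ℝ, Model n) x) :
    (trivializationAt (Model n) (TangentSpace 𝓘(ℝ, Model n) : M → Type _) p ⟨x, v⟩).2 =
      chartDeriv p x v := by
  have := isManifold_one (n := n) (M := M)
  have h := TangentBundle.continuousLinearMapAt_trivializationAt (𝕜 := ℝ) (I := 𝓘(ℝ, Model n)) hx
  have h2 := congrArg (fun T => T v) h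
  have hx' : x ∈ (trivializationAt (Model n) (TangentSpace 𝓘(ℝ, Model n) : M → Type _) p).baseSet :=
    by simpa using hx
  have h3 : (trivializationAt (Model n) (TangentSpace 𝓘(ℝ, Model n) : M → Type _)
      p).continuousLinearMapAt ℝ x v =
      (trivializationAt (Model n) (TangentSpace 𝓘(ℝ, Model n) : M → Type _) p ⟨x, v⟩).2 := by
    rw [Bundle.Trivialization.continuousLinearMapAt_apply,
      Bundle.Trivialization.linearMapAt_apply, if_pos hx']
  rw [← h3]
  exact h2

theorem contMDiffOn_chartSymmDeriv (p : M) (v : Model n) :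
    ContMDiffOn 𝓘(ℝ, Model n) (𝓘(ℝ, Model n).prod 𝓘(ℝ, Model n)) ∞
      (fun y => Bundle.TotalSpace.mk' (Model n) ((chartAt (Model n) p).symm y)
        (chartSymmDeriv p y v)) (chartAt (Model n) p).target := by
  have := isManifold_one (n := n) (M := M)
  rw [(trivializationAt (Model n) (TangentSpace 𝓘(ℝ, Model n) : M → Type _) p).contMDiffOn_iff]
  · refine ⟨contMDiffOn_chart_symm, ?_⟩
    refine (contMDiffOn_const (c := v)).congr fun y hy => ?_
    rw [Bundle.TotalSpace.mk', trivializationAt_tangent_apply ((chartAt (Model n) p).map_target hy)]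
    exact congrArg (fun T => T v) (chartDeriv_comp_chartSymmDeriv_self hy)
  · intro y hy
    rw [Bundle.Trivialization.mem_source]
    simpa using (chartAt (Model n) p).map_target hy

theorem contDiffOn_localMetric (g : TwoTensor n M) (p : M) :
    ContDiffOn ℝ ∞ (localMetric g p) (chartAt (Model n) p).target := by
  rw [contDiffOn_clm_apply]
  intro v
  rw [contDiffOn_clm_apply]
  intro w
  have h : ContMDiffOn 𝓘(ℝ, Model n) (𝓘(ℝ, Model n).prod 𝓘(ℝ)) ∞
      (fun y => Bundle.TotalSpace.mk' ℝ (E := Bundle.Trivial M ℝ) ((chartAt (Model n) p).symm y)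
        (g ((chartAt (Model n) p).symm y) (chartSymmDeriv p y v) (chartSymmDeriv p y w)))
      (chartAt (Model n) p).target := by
    refine ContMDiffOn.clm_bundle_apply₂ (F₁ := Model n) (F₂ := Model n)
      ?_ (contMDiffOn_chartSymmDeriv p v) (contMDiffOn_chartSymmDeriv p w)
    exact g.contMDiff.comp_contMDiffOn contMDiffOn_chart_symm
  rw [← contMDiffOn_iff_contDiffOn]
  intro y hy
  have := h y hy
  simp only [Bundle.contMDiffWithinAt_totalSpace] at this
  exact this.2

/-- The tensor field on the domain of the chart at `p` with constant components. -/
theorem contMDiffOn_constForm (p : M) (A : ModelForm n) :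
    ContMDiffOn 𝓘(ℝ, Model n) (𝓘(ℝ, Model n).prod 𝓘(ℝ, ModelForm n)) ∞
      (fun x : M => Bundle.TotalSpace.mk' (ModelForm n) (E := fun x : M => TangentForm n x) x
        (pullForm (chartDeriv p x) A)) (chartAt (Model n) p).source := by
  rw [(trivializationAt (ModelForm n) (fun x : M => TangentForm n x) p).contMDiffOn_section_iff
    (chartAt (Model n) p).open_source]
  · refine (contMDiffOn_const (c := A)).congr fun x hx => ?_
    rw [hom_trivializationAt_apply]
    have hx' : x ∈ (trivializationAt (Model n) (TangentSpace 𝓘(ℝ, Model n) : M → Type _)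
      p).baseSet := by simpa using hx
    have e : ∀ v, chartDeriv p x ((trivializationAt (Model n)
        (TangentSpace 𝓘(ℝ, Model n) : M → Type _) p).symmL ℝ x v) = v := fun v => by
      rw [← trivializationAt_tangent_apply hx, Bundle.Trivialization.symmL_apply _ hx']
      simpa using congrArg Prod.snd (Bundle.Trivialization.apply_mk_symm _ hx' v)
    ext v w
    have hx'' : x ∈ (trivializationAt (Model n →L[ℝ] ℝ)
        (fun x : M => TangentSpace 𝓘(ℝ, Model n) x →L[ℝ] ℝ) p).baseSet := by simpa using hx
    simp only [ContinuousLinearMap.inCoordinates, ContinuousLinearMap.comp_apply,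
      Bundle.Trivialization.continuousLinearMapAt_apply, Bundle.Trivialization.linearMapAt_apply,
      if_pos hx'', hom_trivializationAt_apply]
    simp [e]
  · intro x hx
    simpa using hx

theorem contDiffOn_localFun (f : SmoothFun n M) (p : M) :
    ContDiffOn ℝ ∞ (f ∘ (chartAt (Model n) p).symm) (chartAt (Model n) p).target := by
  rw [← contMDiffOn_iff_contDiffOn]
  exact f.contMDiff.comp_contMDiffOn (contMDiffOn_chart_symm (I := 𝓘(ℝ, Model n)))

end Charts

/-! ### The integrand of the action in charts -/

section Gram

variable {n : ℕ} {V : Type*} [AddCommGroup V] [Module ℝ V] [TopologicalSpace V]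

/-- The volume density of a family of vectors is proportional to its determinant in a basis. -/
theorem sqrt_abs_det_gram (b : Module.Basis (Fin n) ℝ V) (B : V →L[ℝ] V →L[ℝ] ℝ) (v : Fin n → V) :
    √|Matrix.det (Matrix.of fun i j => B (v i) (v j))| =
      |b.det v| * √|Matrix.det (Matrix.of fun i j => B (b i) (b j))| := by
  have h : (Matrix.of fun i j => B (v i) (v j)) =
      (b.toMatrix v).transpose * (Matrix.of fun i j => B (b i) (b j)) * b.toMatrix v := by
    ext i j
    have hv : ∀ i, v i = ∑ k, b.toMatrix v k i • b k := fun i => (b.sum_toMatrix_smul_self v i).symm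
    simp only [Matrix.of_apply, Matrix.mul_apply, Matrix.transpose_apply]
    conv_lhs => rw [hv i, hv j]
    simp only [map_sum, map_smul, sum_apply, smul_apply, smul_eq_mul, Finset.sum_mul,
      Finset.mul_sum]
    refine Finset.sum_congr rfl fun k _ => Finset.sum_congr rfl fun l _ => ?_
    ring
  rw [h, Matrix.det_mul, Matrix.det_mul, Matrix.det_transpose, Module.Basis.det_apply,
    mul_right_comm, abs_mul, Real.sqrt_mul (abs_nonneg _), abs_mul, ← sq, Real.sqrt_sq (abs_nonneg _)]

theorem volDensity_pullForm (A : Model n →L[ℝ] Model n) (B : ModelForm n) :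
    volDensity (pullForm A B) = |A.det| * volDensity B := by
  have h := sqrt_abs_det_gram (EuclideanSpace.basisFun (Fin n) ℝ).toBasis B
    (fun i => A (stdVec i))
  have hd : (EuclideanSpace.basisFun (Fin n) ℝ).toBasis.det (fun i => A (stdVec i)) = A.det := by
    rw [Module.Basis.det_apply, ContinuousLinearMap.det,
      ← LinearMap.det_toMatrix (EuclideanSpace.basisFun (Fin n) ℝ).toBasis]
    congr 1
  rw [hd] at h
  simpa [volDensity] using h

/-- A non-zero alternating map of top degree, normalized by its value on a basis `b`, is the volume
density up to sign. -/
theorem sqrt_abs_det_gram_div_mul_abs (b : Module.Basis (Fin n) ℝ V) (B : V →L[ℝ] V →L[ℝ] ℝ)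
    {α : V [⋀^Fin n]→ₗ[ℝ] ℝ} (hα : α ≠ 0) (v : Fin n → V) :
    √|Matrix.det (Matrix.of fun i j => B (b i) (b j))| / |α b| * |α v| =
      √|Matrix.det (Matrix.of fun i j => B (v i) (v j))| := by
  have h0 : α b ≠ 0 := fun h => hα (by rw [α.eq_smul_basis_det b, h, zero_smul])
  have h1 : α v = α b * b.det v := by
    conv_lhs => rw [α.eq_smul_basis_det b]
    simp
  rw [sqrt_abs_det_gram b B v, h1, abs_mul]
  field_simp [abs_ne_zero.2 h0]

end Gram

section LocalBE

variable {n : ℕ}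

theorem localHessian_congr {G : Model n → ModelForm n} {F F' : Model n → ℝ} {y : Model n}
    (h : F =ᶠ[nhds y] F') : localHessian G F y = localHessian G F' y := by
  rw [localHessian, localHessian, h.fderiv_eq, h.fderiv.fderiv_eq]

variable {V U : Set (Model n)} {ψ : Model n → Model n} {G' G : Model n → ModelForm n}
  (hψ : IsLocalIsometry V U ψ G' G) {y : Model n} (hy : y ∈ V)
include hψ hy

theorem IsLocalIsometry.localRicci_eq_pullForm :
    localRicci G' y = pullForm (fderiv ℝ ψ y) (localRicci G (ψ y)) := by
  ext v w; exact hψ.localRicci_pullback hy v w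

theorem IsLocalIsometry.localHessian_eq_pullForm {F F' : Model n → ℝ} (hF : ContDiffOn ℝ ∞ F U)
    (hF' : Set.EqOn F' (F ∘ ψ) V) :
    localHessian G' F' y = pullForm (fderiv ℝ ψ y) (localHessian G F (ψ y)) := by
  rw [localHessian_congr (hF'.eventuallyEq_of_mem (hψ.isOpen_source.mem_nhds hy))]
  ext v w; exact hψ.localHessian_pullback hy hF v w

theorem IsLocalIsometry.localDensity_eq {F F' : Model n → ℝ} (hF : ContDiffOn ℝ ∞ F U)
    (hF' : Set.EqOn F' (F ∘ ψ) V) :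
    localDensity G' F' y = |(fderiv ℝ ψ y).det| * localDensity G F (ψ y) := by
  have hd : fderiv ℝ F' y = (fderiv ℝ F (ψ y)).comp (fderiv ℝ ψ y) := by
    rw [(hF'.eventuallyEq_of_mem (hψ.isOpen_source.mem_nhds hy)).fderiv_eq]
    exact fderiv_comp y ((hF.contDiffAt (hψ.isOpen_target.mem_nhds
      (hψ.mapsTo hy))).differentiableAt (by simp)) ((hψ.contDiffAt hy).differentiableAt (by simp))
  have h : localRicci G' y + localHessian G' F' y - (fderiv ℝ F' y).smulRight (fderiv ℝ F' y) =
      pullForm (fderiv ℝ ψ y) (localRicci G (ψ y) + localHessian G F (ψ y) -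
        (fderiv ℝ F (ψ y)).smulRight (fderiv ℝ F (ψ y))) := by
    rw [hψ.localRicci_eq_pullForm hy, hψ.localHessian_eq_pullForm hy hF hF', hd]
    ext v w
    simp
  rw [localDensity, localDensity, h, hψ.pullback y hy, volDensity_pullForm,
    trace_pullForm (hψ.isInvertible y hy) (hψ.nondegenerate _ (hψ.mapsTo hy))]
  ring

end LocalBE

section ManifoldDensity

variable {n : ℕ} {M : Type*} [TopologicalSpace M] [ChartedSpace (Model n) M]
  [IsManifold 𝓘(ℝ, Model n) ∞ M]

/-- The part of the chart at `q` where the tensor `g` is non-degenerate. -/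
def regularTarget (g : TwoTensor n M) (q : M) : Set (Model n) :=
  (chartAt (Model n) q).target ∩ {y | (localMetric g q y).IsInvertible}

theorem isOpen_regularTarget (g : TwoTensor n M) (q : M) : IsOpen (regularTarget g q) :=
  (contDiffOn_localMetric g q).continuousOn.isOpen_inter_preimage (chartAt (Model n) q).open_target
    isOpen_setOf_isInvertible

theorem isLocalIsometry_transition {g : TwoTensor n M} (hg : IsSymmTensor g) (p q : M) :
    IsLocalIsometry (overlap p q ∩ transition p q ⁻¹' regularTarget g q) (regularTarget g q)
      (transition p q) (localMetric g p) (localMetric g q) where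
  isOpen_source := (contDiffOn_transition p q).continuousOn.isOpen_inter_preimage
    (isOpen_overlap p q) (isOpen_regularTarget g q)
  isOpen_target := isOpen_regularTarget g q
  mapsTo := fun _ hy => hy.2
  smooth := (contDiffOn_transition p q).mono Set.inter_subset_left
  smooth_metric := (contDiffOn_localMetric g q).mono Set.inter_subset_left
  symm := fun y _ => localMetric_symm hg q y
  nondegenerate := fun _ hy => hy.2
  isInvertible := fun _ hy => fderiv_transition_isInvertible hy.1
  pullback := fun _ hy => localMetric_transition g hy.1

omit [IsManifold 𝓘(ℝ, Model n) ∞ M] in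
theorem eqOn_localFun (f : SmoothFun n M) (p q : M) :
    Set.EqOn (f ∘ (chartAt (Model n) p).symm) ((f ∘ (chartAt (Model n) q).symm) ∘ transition p q)
      (overlap p q) := fun y hy => by
  simp only [Function.comp_apply, symm_transition hy]

theorem isInvertible_of_localMetric {g : TwoTensor n M} {p q : M} {y : Model n}
    (hy : y ∈ overlap p q) (hi : (localMetric g p y).IsInvertible) :
    (localMetric g q (transition p q y)).IsInvertible := by
  have h := localMetric_transition g (transition_mem hy)
  rw [transition_transition hy] at h
  rw [h]
  exact pullForm_isInvertible (fderiv_transition_isInvertible (transition_mem hy)) hi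

theorem mem_source_transition {g : TwoTensor n M} {p q : M} {y : Model n}
    (hy : y ∈ overlap p q) (hi : (localMetric g p y).IsInvertible) :
    y ∈ overlap p q ∩ transition p q ⁻¹' regularTarget g q :=
  ⟨hy, (transition_mem hy).1, isInvertible_of_localMetric hy hi⟩

/-- The local densities in two charts are related by the Jacobian of the change of coordinates. -/
theorem localDensity_transition {g : TwoTensor n M} (hg : IsSymmTensor g) (f : SmoothFun n M)
    {p q : M} {y : Model n} (hy : y ∈ overlap p q) (hi : (localMetric g p y).IsInvertible) :
    localDensity (localMetric g p) (f ∘ (chartAt (Model n) p).symm) y =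
      |(fderiv ℝ (transition p q) y).det| *
        localDensity (localMetric g q) (f ∘ (chartAt (Model n) q).symm) (transition p q y) :=
  (isLocalIsometry_transition hg p q).localDensity_eq (mem_source_transition hy hi)
    ((contDiffOn_localFun f q).mono Set.inter_subset_left)
    ((eqOn_localFun f p q).mono Set.inter_subset_left)

omit [IsManifold 𝓘(ℝ, Model n) ∞ M] in
theorem mem_overlap_self {p : M} {y : Model n} (hy : y ∈ (chartAt (Model n) p).target) :
    y ∈ overlap p ((chartAt (Model n) p).symm y) :=
  ⟨hy, mem_chart_source (Model n) ((chartAt (Model n) p).symm y)⟩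

theorem chartDeriv_isInvertible {p x : M} (hx : x ∈ (chartAt (Model n) p).source) :
    (chartDeriv (n := n) p x).IsInvertible := by
  have key : ∀ y ∈ (chartAt (Model n) p).target, ∀ x, x = (chartAt (Model n) p).symm y →
      (chartDeriv (n := n) p x).IsInvertible := by
    rintro y hy x rfl
    exact .of_inverse (chartDeriv_comp_chartSymmDeriv_self hy)
      (chartSymmDeriv_comp_chartDeriv_self hy)
  exact key _ ((chartAt (Model n) p).map_source hx) x ((chartAt (Model n) p).left_inv hx).symm

omit [IsManifold 𝓘(ℝ, Model n) ∞ M] in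
theorem pullForm_ofModelForm {x : M} (A : Model n →L[ℝ] TangentSpace 𝓘(ℝ, Model n) x)
    (B : ModelForm n) :
    pullForm A (ofModelForm x B) = pullForm (chartDeriv x x ∘L A) B := rfl

instance (x : M) : FiniteDimensional ℝ (TangentSpace 𝓘(ℝ, Model n) x) :=
  inferInstanceAs (FiniteDimensional ℝ (Model n))

section InChart

variable {g : TwoTensor n M} (hg : IsSymmTensor g) {p : M} {y : Model n}
  (hy : y ∈ (chartAt (Model n) p).target) (hi : (localMetric g p y).IsInvertible)

include hy in
theorem metric_isInvertible (hi : (localMetric g p y).IsInvertible) :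
    (g ((chartAt (Model n) p).symm y)).IsInvertible := by
  have h := eq_pullForm_localMetric (fun x => g x) ((chartAt (Model n) p).map_target hy)
  rw [(chartAt (Model n) p).right_inv hy] at h
  rw [h]
  exact pullForm_isInvertible (chartDeriv_isInvertible ((chartAt (Model n) p).map_target hy)) hi

include hg hy hi

/-- The components of the Ricci tensor in any chart are given by the local formula. -/
theorem pullForm_ricci :
    pullForm (chartSymmDeriv p y) (ricci g ((chartAt (Model n) p).symm y)) =
      localRicci (localMetric g p) y := by
  rw [ricci, pullForm_ofModelForm, chartDeriv_comp_chartSymmDeriv (mem_overlap_self hy)]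
  exact ((isLocalIsometry_transition hg p _).localRicci_eq_pullForm
    (mem_source_transition (mem_overlap_self hy) hi)).symm

theorem pullForm_hessian (f : SmoothFun n M) :
    pullForm (chartSymmDeriv p y) (hessian g f ((chartAt (Model n) p).symm y)) =
      localHessian (localMetric g p) (f ∘ (chartAt (Model n) p).symm) y := by
  rw [hessian, pullForm_ofModelForm, chartDeriv_comp_chartSymmDeriv (mem_overlap_self hy)]
  exact ((isLocalIsometry_transition hg p _).localHessian_eq_pullForm
    (mem_source_transition (mem_overlap_self hy) hi)
    ((contDiffOn_localFun f _).mono Set.inter_subset_left)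
    ((eqOn_localFun f p _).mono Set.inter_subset_left)).symm

omit hg hi in
theorem differential_chartSymmDeriv (f : SmoothFun n M) (v : Model n) :
    differential f ((chartAt (Model n) p).symm y) (chartSymmDeriv p y v) =
      fderiv ℝ (f ∘ (chartAt (Model n) p).symm) y v := by
  have := isManifold_one (n := n) (M := M)
  have h1 := (mdifferentiable_chart (I := 𝓘(ℝ, Model n)) p).mdifferentiableAt_symm hy
  have h2 : MDifferentiableAt 𝓘(ℝ, Model n) 𝓘(ℝ) f ((chartAt (Model n) p).symm y) :=
    f.contMDiff.mdifferentiable (by simp) _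
  have h := mfderiv_comp y h2 h1
  rw [← mfderiv_eq_fderiv]
  exact (congrArg (fun T => T v) h).symm

omit hg in
theorem metricTrace_eq (B : TangentForm n ((chartAt (Model n) p).symm y)) :
    metricTrace g ((chartAt (Model n) p).symm y) B =
      LinearMap.trace ℝ (Model n) ((localMetric g p y).inverse ∘L
        pullForm (chartSymmDeriv p y) B).toLinearMap := by
  rw [localMetric_eq]
  exact (trace_pullForm (chartSymmDeriv_isInvertible hy) (metric_isInvertible hy hi) B).symm

theorem pullForm_bakryEmeryRicci (f : SmoothFun n M) :
    pullForm (chartSymmDeriv p y) (bakryEmeryRicci 1 g f ((chartAt (Model n) p).symm y)) =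
      localRicci (localMetric g p) y +
        localHessian (localMetric g p) (f ∘ (chartAt (Model n) p).symm) y -
      (fderiv ℝ (f ∘ (chartAt (Model n) p).symm) y).smulRight
        (fderiv ℝ (f ∘ (chartAt (Model n) p).symm) y) := by
  rw [← pullForm_ricci hg hy hi, ← pullForm_hessian hg hy hi]
  ext v w
  simp [bakryEmeryRicci, covectorTensor, differential_chartSymmDeriv hy]

/-- The integrand of the action in the chart at `p`: the sign of the coordinate frame cancels
against the orientation in the volume form. -/
theorem integrand_eq_localDensity (o : ManifoldOrientation n M) (f : SmoothFun n M) :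
    (frameSign o.orientation p y : ℝ) *
      (metricTrace g ((chartAt (Model n) p).symm y)
        (bakryEmeryRicci 1 g f ((chartAt (Model n) p).symm y)) •
        volumeForm o g ((chartAt (Model n) p).symm y)) (coordFrame p y) =
      localDensity (localMetric g p) (f ∘ (chartAt (Model n) p).symm) y := by
  let x := (chartAt (Model n) p).symm y
  have hinv : (chartDeriv x x).IsInvertible := chartDeriv_isInvertible (mem_chart_source (Model n) x)
  obtain ⟨A, hA⟩ := hinv
  let b : Module.Basis (Fin n) ℝ (TangentSpace 𝓘(ℝ, Model n) x) :=
    (EuclideanSpace.basisFun (Fin n) ℝ).toBasis.map A.symm.toLinearEquiv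
  have hb : ∀ i, b i = (chartDeriv x x).inverse (EuclideanSpace.single i 1) := by
    intro i
    rw [← hA, ContinuousLinearMap.inverse_equiv]
    simp [b]
  have key := sqrt_abs_det_gram_div_mul_abs b (g x)
    (Module.Ray.someVector_ne_zero (o.orientation x)) (coordFrame p y)
  -- `volumeForm` is normalized in the frame of the preferred chart at `x`, which is the basis `b`.
  have hbf : ⇑b = fun i => (chartDeriv x x).inverse (EuclideanSpace.single i 1) := funext hb
  rw [hbf] at key
  have hvol : volDensity (localMetric g p y) =
      √|Matrix.det (Matrix.of fun i j => g x (coordFrame p y i) (coordFrame p y j))| := rfl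
  rw [localDensity, ← pullForm_bakryEmeryRicci hg hy hi f, ← metricTrace_eq hy hi, hvol, ← key,
    frameSign, ← sign_mul_self ((o.orientation x).someVector (coordFrame p y))]
  simp only [volumeForm, AlternatingMap.smul_apply, smul_eq_mul, x]
  ring

end InChart

end ManifoldDensity

/-! ### Integration of densities -/

section Densities

open MeasureTheory

/-- A continuous function on `U` which vanishes outside a compact subset of `U` is integrable. -/
theorem integrableOn_of_eq_zero_off_compact {n : ℕ} {U K : Set (Model n)} {d : Model n → ℝ}
    (hU : IsOpen U) (hd : ContinuousOn d U) (hK : IsCompact K) (hKU : K ⊆ U)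
    (h0 : ∀ y ∈ U, y ∉ K → d y = 0) : IntegrableOn d U :=
  ((hd.mono hKU).integrableOn_compact hK).of_forall_sdiff_eq_zero hU.measurableSet
    fun y hy => h0 y hy.1 hy.2

variable {n : ℕ} {M : Type*} [TopologicalSpace M] [ChartedSpace (Model n) M]

theorem isCompact_chart_image {p : M} {K : Set M} (hK : IsCompact K)
    (hKp : K ⊆ (chartAt (Model n) p).source) : IsCompact (chartAt (Model n) p '' K) :=
  hK.image_of_continuousOn ((chartAt (Model n) p).continuousOn.mono hKp)

theorem chart_image_subset_target {p : M} {K : Set M}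
    (hKp : K ⊆ (chartAt (Model n) p).source) :
    chartAt (Model n) p '' K ⊆ (chartAt (Model n) p).target := by
  rintro _ ⟨x, hx, rfl⟩
  exact (chartAt (Model n) p).map_source (hKp hx)

theorem mem_chart_image {p : M} {K : Set M} {y : Model n} (hy : y ∈ (chartAt (Model n) p).target)
    (h : (chartAt (Model n) p).symm y ∈ K) : y ∈ chartAt (Model n) p '' K :=
  ⟨_, h, (chartAt (Model n) p).right_inv hy⟩

variable [IsManifold 𝓘(ℝ, Model n) ∞ M]

/-- A density on `M`: a function in each chart, such that the changes of coordinates multiply by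
the absolute value of the Jacobian. -/
structure IsDensity (d : M → Model n → ℝ) : Prop where
  continuousOn : ∀ p, ContinuousOn (d p) (chartAt (Model n) p).target
  jacobian : ∀ p q, ∀ y ∈ overlap p q,
    d p y = |(fderiv ℝ (transition p q) y).det| * d q (transition p q y)

/-- Change of variables between two charts. -/
theorem IsDensity.setIntegral_overlap {d : M → Model n → ℝ} (hd : IsDensity d) (p q : M)
    (χ : M → ℝ) :
    ∫ y in overlap p q, χ ((chartAt (Model n) p).symm y) * d p y =
      ∫ z in overlap q p, χ ((chartAt (Model n) q).symm z) * d q z := by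
  have himage : transition (n := n) p q '' overlap (n := n) p q = overlap q p := by
    refine Set.Subset.antisymm ?_ fun z hz => ?_
    · rintro _ ⟨y, hy, rfl⟩
      exact transition_mem hy
    · exact ⟨_, transition_mem hz, transition_transition hz⟩
  rw [← himage, integral_image_eq_integral_abs_det_fderiv_smul volume
    (isOpen_overlap p q).measurableSet (f' := fderiv ℝ (transition p q))]
  · refine setIntegral_congr_fun (isOpen_overlap p q).measurableSet fun y hy => ?_
    simp only [smul_eq_mul]
    rw [hd.jacobian p q y hy, symm_transition hy]
    ring
  · intro y hy
    exact (((contDiffOn_transition p q).contDiffAt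
      ((isOpen_overlap p q).mem_nhds hy)).differentiableAt (by simp)).hasFDerivAt.hasFDerivWithinAt
  · intro y hy z hz hyz
    rw [← transition_transition hy, hyz, transition_transition hz]

variable [CompactSpace M] [T2Space M]

theorem tsupport_chartPartition_subset (p : M) :
    tsupport (chartPartition n M p) ⊆ (chartAt (Model n) p).source :=
  (SmoothPartitionOfUnity.exists_isSubordinate_chartAt_source 𝓘(ℝ, Model n) M).choose_spec p

theorem finite_support_chartPartition :
    {p : M | (Function.support (chartPartition n M p)).Nonempty}.Finite :=
  (chartPartition n M).locallyFinite.finite_nonempty_of_compact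

variable (n M) in
/-- The finitely many points whose function in the partition of unity is not identically zero. -/
def chartIndex : Finset M := (finite_support_chartPartition (n := n) (M := M)).toFinset

theorem chartPartition_eq_zero {p : M} (hp : p ∉ chartIndex n M) (x : M) :
    chartPartition n M p x = 0 := by
  by_contra h
  exact hp ((Set.Finite.mem_toFinset _).2 ⟨x, h⟩)

theorem sum_chartPartition (x : M) : ∑ p ∈ chartIndex n M, chartPartition n M p x = 1 :=
  (chartPartition n M).sum_finsupport' x (Set.mem_univ x) fun p hp => by
    by_contra h
    exact ((chartPartition n M).mem_finsupport x).1 hp (chartPartition_eq_zero h x)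

/-- The function of the partition of unity with index `p` in the chart at `p`. -/
def chartWeight (p : M) (y : Model n) : ℝ :=
  chartPartition n M p ((chartAt (Model n) p).symm y)

/-- The compact set in the chart at `p` outside which the function of the partition of unity
vanishes. -/
def chartSupport (p : M) : Set (Model n) :=
  chartAt (Model n) p '' tsupport (chartPartition n M p)

theorem isCompact_chartSupport (p : M) : IsCompact (chartSupport (n := n) p) :=
  isCompact_chart_image (isClosed_tsupport _).isCompact (tsupport_chartPartition_subset p)

theorem chartSupport_subset (p : M) : chartSupport p ⊆ (chartAt (Model n) p).target :=
  chart_image_subset_target (tsupport_chartPartition_subset p)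

theorem chartWeight_eq_zero {p : M} {y : Model n} (hy : y ∈ (chartAt (Model n) p).target)
    (h : y ∉ chartSupport p) : chartWeight p y = 0 := by
  by_contra h0
  exact h (mem_chart_image hy (subset_tsupport _ h0))

theorem continuousOn_partition_chart (p q : M) :
    ContinuousOn (fun y => chartPartition n M p ((chartAt (Model n) q).symm y))
      (chartAt (Model n) q).target :=
  (chartPartition n M p).contMDiff.continuous.comp_continuousOn
    (chartAt (Model n) q).continuousOn_symm

/-- The integral of a density. -/
def integralDensity (d : M → Model n → ℝ) : ℝ :=
  ∑ p ∈ chartIndex n M, ∫ y in (chartAt (Model n) p).target, chartWeight p y * d p y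

theorem IsDensity.integrableOn {d : M → Model n → ℝ} (hd : IsDensity d) (p : M) :
    IntegrableOn (fun y => chartWeight p y * d p y) (chartAt (Model n) p).target :=
  integrableOn_of_eq_zero_off_compact (chartAt (Model n) p).open_target
    ((continuousOn_partition_chart p p).mul (hd.continuousOn p)) (isCompact_chartSupport p)
    (chartSupport_subset p) fun y hy h => by rw [chartWeight_eq_zero hy h, zero_mul]

theorem integralDensity_add {d d' : M → Model n → ℝ} (hd : IsDensity d) (hd' : IsDensity d') :
    integralDensity (fun p y => d p y + d' p y) = integralDensity d + integralDensity d' := by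
  rw [integralDensity, integralDensity, integralDensity, ← Finset.sum_add_distrib]
  refine Finset.sum_congr rfl fun p _ => ?_
  rw [← integral_add (hd.integrableOn p) (hd'.integrableOn p)]
  simp only [mul_add]

theorem integralDensity_congr {d d' : M → Model n → ℝ}
    (h : ∀ p, ∀ y ∈ (chartAt (Model n) p).target, d p y = d' p y) :
    integralDensity d = integralDensity d' :=
  Finset.sum_congr rfl fun p _ => setIntegral_congr_fun (chartAt (Model n) p).open_target.measurableSet
    fun y hy => by simp only [h p y hy]

/-- The integral of a density with support in the domain of one chart. -/
theorem IsDensity.integralDensity_eq_of_support {d : M → Model n → ℝ} (hd : IsDensity d) (q : M)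
    {K : Set M} (hK : IsCompact K) (hKq : K ⊆ (chartAt (Model n) q).source)
    (h0 : ∀ p, ∀ y ∈ (chartAt (Model n) p).target, (chartAt (Model n) p).symm y ∉ K → d p y = 0) :
    integralDensity d = ∫ z in (chartAt (Model n) q).target, d q z := by
  -- Both sides live on the overlap: `d` is supported in the domain of the chart at `q`, and the
  -- function with index `p` in the domain of the chart at `p`.
  have hterm : ∀ p, ∫ y in (chartAt (Model n) p).target, chartWeight p y * d p y =
      ∫ z in (chartAt (Model n) q).target,
        chartPartition n M p ((chartAt (Model n) q).symm z) * d q z := by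
    intro p
    rw [setIntegral_eq_of_subset_of_forall_sdiff_eq_zero (s := overlap p q)
        (chartAt (Model n) p).open_target.measurableSet Set.inter_subset_left,
      setIntegral_eq_of_subset_of_forall_sdiff_eq_zero (s := overlap q p)
        (chartAt (Model n) q).open_target.measurableSet Set.inter_subset_left]
    · exact hd.setIntegral_overlap p q (chartPartition n M p)
    · intro z hz
      have : chartPartition n M p ((chartAt (Model n) q).symm z) = 0 := by
        by_contra h
        exact hz.2 ⟨hz.1, tsupport_chartPartition_subset p (subset_tsupport _ h)⟩
      rw [this, zero_mul]
    · intro y hy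
      rw [h0 p y hy.1 fun h => hy.2 ⟨hy.1, hKq h⟩, mul_zero]
  rw [integralDensity, Finset.sum_congr rfl fun p _ => hterm p, ← integral_finsetSum]
  · refine setIntegral_congr_fun (chartAt (Model n) q).open_target.measurableSet fun z _ => ?_
    simp only [← Finset.sum_mul, sum_chartPartition, one_mul]
  · intro p _
    exact integrableOn_of_eq_zero_off_compact (chartAt (Model n) q).open_target
      ((continuousOn_partition_chart p q).mul (hd.continuousOn q)) (isCompact_chart_image hK hKq)
      (chart_image_subset_target hKq) fun z hz h => by
        rw [h0 q z hz fun h' => h (mem_chart_image hz h'), mul_zero]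

end Densities

/-! ### The first variation of the action -/

section LocalVariation

open MeasureTheory

variable {n : ℕ} {U : Set (Model n)} {G S : Model n → ModelForm n} {F H : Model n → ℝ}

/-- The divergence of the vector density `boundaryField`. -/
def divergenceDensity (G : Model n → ModelForm n) (F : Model n → ℝ) (S : Model n → ModelForm n)
    (H : Model n → ℝ) (y : Model n) : ℝ :=
  ∑ k, fderiv ℝ (boundaryField G F S H k) y (stdVec k)

theorem mem_regularSet_zero {y : Model n} (hy : y ∈ U) (hi : (G y).IsInvertible) :
    ((0 : ℝ), y) ∈ regularSet U G S :=
  ⟨hy, by simpa using hi⟩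

theorem continuousOn_evalAt {Ω : Set (ℝ × Model n)} (a : smoothRing Ω) :
    ContinuousOn (fun z => evalAt z a) Ω :=
  ContDiffOn.continuousOn a.2

namespace IsVariation

variable (hV : IsVariation U G S F H)
include hV

/-- On a compact set where `G` is non-degenerate, so is `G + t S` for all small `t`. -/
theorem exists_closedBall_prod_subset {K : Set (Model n)} (hK : IsCompact K) (hKU : K ⊆ U)
    (hG : ∀ y ∈ K, (G y).IsInvertible) :
    ∃ ε > 0, Metric.closedBall (0 : ℝ) ε ×ˢ K ⊆ regularSet U G S := by
  have h : ({0} : Set ℝ) ×ˢ K ⊆ regularSet U G S := by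
    rintro ⟨t, y⟩ ⟨ht, hy⟩
    rw [Set.mem_singleton_iff] at ht
    subst ht
    exact mem_regularSet_zero (hKU hy) (hG y hy)
  obtain ⟨u, v, hu, -, h0, hv, huv⟩ :=
    generalized_tube_lemma isCompact_singleton hK hV.isOpen_regularSet h
  obtain ⟨ε, hε, hb⟩ := Metric.nhds_basis_closedBall.mem_iff.1
    (hu.mem_nhds (Set.singleton_subset_iff.1 h0))
  exact ⟨ε, hε, (Set.prod_mono hb hv).trans huv⟩

theorem hasDerivAt_localDensity {y : Model n} (hy : ((0 : ℝ), y) ∈ regularSet U G S) :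
    HasDerivAt (fun t : ℝ => localDensity (fun y => G y + t • S y) (fun y => F y + t * H y) y)
      (eulerDensity G F S H y + divergenceDensity G F S H y) 0 := by
  rw [divergenceDensity, ← hV.evalAt_zero_timeDeriv_lagrangianElt hy]
  refine (hV.hasDerivAt_evalAt hy hV.lagrangianElt).congr_of_eventuallyEq ?_
  filter_upwards [hV.eventually_time hy] with t ht
  exact (hV.evalAt_lagrangianElt ht).symm

theorem continuousAt_variation {y : Model n} (hy : ((0 : ℝ), y) ∈ regularSet U G S) :
    ContinuousAt (fun y => eulerDensity G F S H y + divergenceDensity G F S H y) y := by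
  have h : ContinuousAt (fun y => evalAt (0, y) (hV.timeDeriv hV.lagrangianElt)) y :=
    ((continuousOn_evalAt _).continuousAt (hV.isOpen_regularSet.mem_nhds hy)).comp
      (f := fun y => ((0 : ℝ), y)) (Continuous.prodMk_right (0 : ℝ)).continuousAt
  refine h.congr ?_
  filter_upwards [hV.eventually_slice hy] with z hz
  exact hV.evalAt_zero_timeDeriv_lagrangianElt hz

theorem continuousAt_divergenceDensity {y : Model n} (hy : ((0 : ℝ), y) ∈ regularSet U G S) :
    ContinuousAt (divergenceDensity G F S H) y := by
  refine tendsto_finsetSum _ fun k _ => ?_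
  exact ((contDiffAt_fderiv (hV.contDiffAt_boundaryField hy k)).continuousAt.clm_apply
    continuousAt_const)

theorem continuousAt_eulerDensity {y : Model n} (hy : ((0 : ℝ), y) ∈ regularSet U G S) :
    ContinuousAt (eulerDensity G F S H) y := by
  have h := (hV.continuousAt_variation hy).sub (hV.continuousAt_divergenceDensity hy)
  exact h.congr (Filter.Eventually.of_forall fun z => by simp)

/-- Differentiation under the integral. -/
theorem hasDerivAt_integral {χ : Model n → ℝ} (hχ : ContinuousOn χ U) {K : Set (Model n)}
    (hK : IsCompact K) (hKU : K ⊆ U) (h0 : ∀ y ∈ U, y ∉ K → χ y = 0)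
    (hG : ∀ y ∈ K, (G y).IsInvertible) :
    HasDerivAt (fun t : ℝ => ∫ y in U,
        χ y * localDensity (fun y => G y + t • S y) (fun y => F y + t * H y) y)
      (∫ y in U, χ y * (eulerDensity G F S H y + divergenceDensity G F S H y)) 0 := by
  have hred : ∀ φ : Model n → ℝ, ∫ y in U, χ y * φ y = ∫ y in K, χ y * φ y := fun φ =>
    setIntegral_eq_of_subset_of_forall_sdiff_eq_zero hV.isOpen.measurableSet hKU
      fun y hy => by rw [h0 y hy.1 hy.2, zero_mul]
  simp only [hred]
  obtain ⟨ε, hε, hsub⟩ := hV.exists_closedBall_prod_subset hK hKU hG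
  set a := hV.lagrangianElt
  have hmem : ∀ t ∈ Metric.ball (0 : ℝ) ε, ∀ y ∈ K, (t, y) ∈ regularSet U G S := fun t ht y hy =>
    hsub ⟨Metric.ball_subset_closedBall ht, hy⟩
  have hcont : ∀ t ∈ Metric.ball (0 : ℝ) ε, ∀ b : smoothRing (regularSet U G S),
      ContinuousOn (fun y => χ y * evalAt (t, y) b) K := fun t ht b =>
    (hχ.mono hKU).mul ((continuousOn_evalAt b).comp
      (Continuous.prodMk_right t).continuousOn fun y hy => hmem t ht y hy)
  have hb0 : (0 : ℝ) ∈ Metric.ball (0 : ℝ) ε := Metric.mem_ball_self hε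
  -- The derivative is bounded on `closedBall 0 ε × K` by compactness.
  have hbound : ∃ C, ∀ z ∈ Metric.closedBall (0 : ℝ) ε ×ˢ K,
      ‖χ z.2 * evalAt z (hV.timeDeriv a)‖ ≤ C := by
    refine ((isCompact_closedBall (0 : ℝ) ε).prod hK).exists_bound_of_continuousOn ?_
    exact (hχ.comp continuousOn_snd fun z hz => hKU hz.2).mul
      ((continuousOn_evalAt _).mono hsub)
  obtain ⟨C, hC⟩ := hbound
  have main := (hasDerivAt_integral_of_dominated_loc_of_deriv_le (μ := volume.restrict K)
    (F := fun t y => χ y * evalAt (t, y) a) (F' := fun t y => χ y * evalAt (t, y) (hV.timeDeriv a))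
    (bound := fun _ => C) (x₀ := (0 : ℝ)) (s := Metric.ball 0 ε) (Metric.ball_mem_nhds _ hε)
    (Filter.eventually_of_mem (Metric.ball_mem_nhds _ hε) fun t ht =>
      (hcont t ht a).aestronglyMeasurable hK.measurableSet)
    ((hcont 0 hb0 a).integrableOn_compact hK)
    ((hcont 0 hb0 _).aestronglyMeasurable hK.measurableSet)
    ((ae_restrict_iff' hK.measurableSet).2 (Filter.Eventually.of_forall fun y hy t ht =>
      hC (t, y) ⟨Metric.ball_subset_closedBall ht, hy⟩))
    (continuousOn_const.integrableOn_compact hK)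
    ((ae_restrict_iff' hK.measurableSet).2 (Filter.Eventually.of_forall fun y hy t ht =>
      (hV.hasDerivAt_evalAt (hmem t ht y hy) a).const_mul (χ y)))).2
  have e : ∫ y in K, χ y * (eulerDensity G F S H y + divergenceDensity G F S H y) =
      ∫ y in K, χ y * evalAt (0, y) (hV.timeDeriv a) :=
    setIntegral_congr_fun hK.measurableSet fun y hy => by
      simp only [divergenceDensity, a, hV.evalAt_zero_timeDeriv_lagrangianElt (hmem 0 hb0 y hy)]
  rw [e]
  refine main.congr_of_eventuallyEq ?_
  filter_upwards [Metric.ball_mem_nhds (0 : ℝ) hε] with t ht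
  exact setIntegral_congr_fun hK.measurableSet fun y hy => by
    simp only [a, hV.evalAt_lagrangianElt (hmem t ht y hy)]

end IsVariation

/-! ### Linearity and locality of the boundary term -/

theorem christoffelFirst_add {S S' : Model n → ModelForm n} {y : Model n}
    (hS : DifferentiableAt ℝ S y) (hS' : DifferentiableAt ℝ S' y) (u v w : Model n) :
    christoffelFirst (fun y => S y + S' y) y u v w =
      christoffelFirst S y u v w + christoffelFirst S' y u v w := by
  simp only [christoffelFirst_apply, fderiv_fun_add hS hS', add_apply]
  ring

theorem inverseVar_add (G S S' : Model n → ModelForm n) (y : Model n) (k l : Fin n) :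
    inverseVar G (fun y => S y + S' y) y k l = inverseVar G S y k l + inverseVar G S' y k l := by
  simp only [inverseVar, add_apply, mul_add, add_mul, Finset.sum_add_distrib]
  ring

theorem densityVar_add (G S S' : Model n → ModelForm n) (y : Model n) (k l : Fin n) :
    densityVar G (fun y => S y + S' y) y k l = densityVar G S y k l + densityVar G S' y k l := by
  simp only [densityVar, inverseVar_add, add_apply, mul_add, add_mul, Finset.sum_add_distrib]
  ring

theorem christoffelVar_add (G : Model n → ModelForm n) {S S' : Model n → ModelForm n}
    {y : Model n} (hS : DifferentiableAt ℝ S y) (hS' : DifferentiableAt ℝ S' y) (k v w : Fin n) :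
    christoffelVar G (fun y => S y + S' y) y k v w =
      christoffelVar G S y k v w + christoffelVar G S' y k v w := by
  simp only [christoffelVar, inverseVar_add, christoffelFirst_add hS hS', mul_add, add_mul,
    Finset.sum_add_distrib]
  ring

theorem boundaryField_add (G : Model n → ModelForm n) (F : Model n → ℝ)
    {S S' : Model n → ModelForm n} {H H' : Model n → ℝ} {y : Model n}
    (hS : DifferentiableAt ℝ S y) (hS' : DifferentiableAt ℝ S' y)
    (hH : DifferentiableAt ℝ H y) (hH' : DifferentiableAt ℝ H' y) (k : Fin n) :
    boundaryField G F (fun y => S y + S' y) (fun y => H y + H' y) k y =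
      boundaryField G F S H k y + boundaryField G F S' H' k y := by
  simp only [boundaryField, christoffelVar_add G hS hS', densityVar_add, fderiv_fun_add hH hH',
    add_apply, mul_add, add_mul, Finset.sum_add_distrib]
  ring

theorem boundaryField_eq_zero (G : Model n → ModelForm n) (F : Model n → ℝ)
    {S : Model n → ModelForm n} {H : Model n → ℝ} {y : Model n}
    (hS : S =ᶠ[nhds y] 0) (hH : H =ᶠ[nhds y] 0) (k : Fin n) : boundaryField G F S H k y = 0 := by
  have h1 : S y = 0 := hS.eq_of_nhds
  have h2 : H y = 0 := hH.eq_of_nhds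
  have h3 : fderiv ℝ S y = 0 := by rw [hS.fderiv_eq]; simp
  have h4 : fderiv ℝ H y = 0 := by rw [hH.fderiv_eq]; simp
  have hi : ∀ k l, inverseVar G S y k l = 0 := by simp [inverseVar, h1]
  have hc : ∀ k v w, christoffelVar G S y k v w = 0 := by
    simp [christoffelVar, hi, christoffelFirst_apply, h3]
  have hd : ∀ k l, densityVar G S y k l = 0 := by simp [densityVar, hi, h1]
  simp [boundaryField, hc, hd, h2, h4]

theorem divergenceDensity_eq_zero (G : Model n → ModelForm n) (F : Model n → ℝ)
    {S : Model n → ModelForm n} {H : Model n → ℝ} {y : Model n}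
    (hS : S =ᶠ[nhds y] 0) (hH : H =ᶠ[nhds y] 0) : divergenceDensity G F S H y = 0 := by
  refine Finset.sum_eq_zero fun k _ => ?_
  have : boundaryField G F S H k =ᶠ[nhds y] 0 := by
    filter_upwards [hS.eventuallyEq_nhds, hH.eventuallyEq_nhds] with z h1 h2
    exact boundaryField_eq_zero G F h1 h2 k
  rw [this.fderiv_eq]
  simp

theorem divergenceDensity_add {S' : Model n → ModelForm n} {H' : Model n → ℝ}
    (hV : IsVariation U G S F H) (hV' : IsVariation U G S' F H') {y : Model n} (hy : y ∈ U)
    (hi : (G y).IsInvertible) :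
    divergenceDensity G F (fun y => S y + S' y) (fun y => H y + H' y) y =
      divergenceDensity G F S H y + divergenceDensity G F S' H' y := by
  rw [divergenceDensity, divergenceDensity, divergenceDensity, ← Finset.sum_add_distrib]
  refine Finset.sum_congr rfl fun k _ => ?_
  have h : boundaryField G F (fun y => S y + S' y) (fun y => H y + H' y) k =ᶠ[nhds y]
      fun y => boundaryField G F S H k y + boundaryField G F S' H' k y := by
    filter_upwards [hV.isOpen.mem_nhds hy] with z hz
    have hU := hV.isOpen.mem_nhds hz
    exact boundaryField_add G F ((hV.tensor_smooth.contDiffAt hU).differentiableAt (by simp))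
      ((hV'.tensor_smooth.contDiffAt hU).differentiableAt (by simp))
      ((hV.function_smooth.contDiffAt hU).differentiableAt (by simp))
      ((hV'.function_smooth.contDiffAt hU).differentiableAt (by simp)) k
  rw [h.fderiv_eq, fderiv_fun_add
    ((hV.contDiffAt_boundaryField (mem_regularSet_zero hy hi) k).differentiableAt (by simp))
    ((hV'.contDiffAt_boundaryField (mem_regularSet_zero hy hi) k).differentiableAt (by simp)),
    add_apply]

/-- The divergence theorem for a vector field with compact support in `U`. -/
theorem integral_sum_fderiv_eq_zero {W : Fin n → Model n → ℝ} (hU : IsOpen U)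
    (hW : ∀ k, ContDiffOn ℝ ∞ (W k) U) {K : Set (Model n)} (hK : IsCompact K) (hKU : K ⊆ U)
    (h0 : ∀ k, ∀ y ∈ U, y ∉ K → W k y = 0) :
    ∫ y in U, ∑ k, fderiv ℝ (W k) y (stdVec k) = 0 := by
  classical
  -- The extension by zero is smooth, and has compact support.
  set W' : Fin n → Model n → ℝ := fun k => U.indicator (W k)
  have hout : ∀ k, ∀ y ∉ K, W' k y = 0 := fun k y hy => by
    by_cases hyU : y ∈ U
    · simp only [W', Set.indicator_of_mem hyU, h0 k y hyU hy]
    · simp only [W', Set.indicator_of_notMem hyU]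
  have hsmooth : ∀ k, ContDiff ℝ ∞ (W' k) := fun k => by
    rw [contDiff_iff_contDiffAt]
    intro y
    by_cases hy : y ∈ U
    · refine ((hW k).contDiffAt (hU.mem_nhds hy)).congr_of_eventuallyEq ?_
      filter_upwards [hU.mem_nhds hy] with z hz using Set.indicator_of_mem hz _
    · refine (contDiffAt_const (c := (0 : ℝ))).congr_of_eventuallyEq ?_
      filter_upwards [hK.isClosed.isOpen_compl.mem_nhds fun h => hy (hKU h)] with z hz
        using hout k z hz
  have hcs : ∀ k, HasCompactSupport (W' k) := fun k =>
    HasCompactSupport.intro hK fun y hy => hout k y hy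
  have hcd : ∀ k, Continuous fun y => fderiv ℝ (W' k) y (stdVec k) := fun k =>
    ((hsmooth k).continuous_fderiv (by simp)).clm_apply continuous_const
  have hint : ∀ k, Integrable fun y => fderiv ℝ (W' k) y (stdVec k) := fun k =>
    (hcd k).integrable_of_hasCompactSupport
      ((hcs k).fderiv_apply (𝕜 := ℝ) (stdVec k))
  have hzero : ∀ k, ∫ y, fderiv ℝ (W' k) y (stdVec k) = 0 := fun k => by
    have h := integral_mul_fderiv_eq_neg_fderiv_mul_of_integrable (𝕜 := ℝ) (μ := volume)
      (f := fun _ : Model n => (1 : ℝ)) (g := W' k) (v := stdVec k) (by simp) (by simpa using hint k)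
      (by simpa using (hsmooth k).continuous.integrable_of_hasCompactSupport (hcs k))
      (fun _ _ => by fun_prop) fun y _ => (hsmooth k).differentiable (by simp) y
    simpa using h
  have e1 : ∫ y in U, ∑ k, fderiv ℝ (W k) y (stdVec k) =
      ∫ y in U, ∑ k, fderiv ℝ (W' k) y (stdVec k) := by
    refine setIntegral_congr_fun hU.measurableSet fun y hy => ?_
    refine Finset.sum_congr rfl fun k _ => ?_
    have : W k =ᶠ[nhds y] W' k := by
      filter_upwards [hU.mem_nhds hy] with z hz using (Set.indicator_of_mem hz _).symm
    rw [this.fderiv_eq]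
  have e2 : ∫ y in U, ∑ k, fderiv ℝ (W' k) y (stdVec k) =
      ∫ y, ∑ k, fderiv ℝ (W' k) y (stdVec k) := by
    refine setIntegral_eq_integral_of_forall_compl_eq_zero fun y hy => ?_
    refine Finset.sum_eq_zero fun k _ => ?_
    have : W' k =ᶠ[nhds y] 0 := by
      filter_upwards [hK.isClosed.isOpen_compl.mem_nhds fun h => hy (hKU h)] with z hz
        using hout k z hz
    rw [this.fderiv_eq]
    simp
  rw [e1, e2, integral_finsetSum _ fun k _ => hint k]
  exact Finset.sum_eq_zero fun k _ => hzero k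

end LocalVariation

/-! ### The tensorial part of the first variation -/

section Euler

variable {n : ℕ}

theorem trace_inverse_comp_inverse_comp (B : ModelForm n) {S : ModelForm n}
    (hS : ∀ v w, S v w = S w v) (C : ModelForm n) :
    LinearMap.trace ℝ (Model n) ((B.inverse ∘L S) ∘L (B.inverse ∘L C)).toLinearMap =
      ∑ k, ∑ l, (∑ a, ∑ b, invEntry B k a * S (stdVec a) (stdVec b) * invEntry B b l) *
        C (stdVec k) (stdVec l) := by
  rw [trace_eq_sum_apply]
  refine Finset.sum_congr rfl fun k _ => ?_
  have h1 : ((B.inverse ∘L S) ∘L (B.inverse ∘L C)).toLinearMap (stdVec k) k =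
      ∑ a, invEntry B k a * S (B.inverse (C (stdVec k))) (stdVec a) :=
    inverse_apply_eq_sum B _ k
  have h2 : ∀ a, S (B.inverse (C (stdVec k))) (stdVec a) =
      ∑ b, (∑ l, invEntry B b l * C (stdVec k) (stdVec l)) * S (stdVec a) (stdVec b) := by
    intro a
    rw [hS]
    conv_lhs => rw [vector_eq_sum (B.inverse (C (stdVec k)))]
    simp only [map_sum, map_smul, smul_eq_mul, inverse_apply_eq_sum]
  rw [h1]
  simp only [h2, Finset.mul_sum, Finset.sum_mul]
  have h3 : ∀ a, ∑ b, ∑ l, invEntry B k a * (invEntry B b l * C (stdVec k) (stdVec l) *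
      S (stdVec a) (stdVec b)) = ∑ l, ∑ b, invEntry B k a * S (stdVec a) (stdVec b) *
        invEntry B b l * C (stdVec k) (stdVec l) := by
    intro a
    rw [Finset.sum_comm]
    refine Finset.sum_congr rfl fun l _ => Finset.sum_congr rfl fun b _ => ?_
    ring
  rw [Finset.sum_congr rfl fun a _ => h3 a, Finset.sum_comm]

/-- The tensorial part of the first variation in terms of traces. -/
theorem eulerDensity_eq_trace (G : Model n → ModelForm n) (F : Model n → ℝ)
    {S : Model n → ModelForm n} (H : Model n → ℝ) {y : Model n}
    (hS : ∀ v w, S y v w = S y w v) {C : ModelForm n}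
    (hC : C = localRicci G y - (fderiv ℝ F y).smulRight (fderiv ℝ F y)) :
    eulerDensity G F S H y = volDensity (G y) *
      (2 * H y * LinearMap.trace ℝ (Model n) ((G y).inverse ∘L localHessian G F y).toLinearMap
        + 1 / 2 * LinearMap.trace ℝ (Model n) ((G y).inverse ∘L S y).toLinearMap *
          LinearMap.trace ℝ (Model n) ((G y).inverse ∘L C).toLinearMap
        - LinearMap.trace ℝ (Model n)
          (((G y).inverse ∘L S y) ∘L ((G y).inverse ∘L C)).toLinearMap) := by
  have hC' : ∀ v w, localRicci G y (stdVec v) (stdVec w) -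
      fderiv ℝ F y (stdVec v) * fderiv ℝ F y (stdVec w) = C (stdVec v) (stdVec w) := by
    simp [hC]
  rw [trace_inverse_comp_inverse_comp _ hS, trace_inverse_comp, trace_inverse_comp,
    trace_inverse_comp, eulerDensity]
  simp only [hC', densityVar, inverseVar]
  set τ := ∑ v, ∑ w, invEntry (G y) v w * S y (stdVec v) (stdVec w)
  clear_value τ
  have e1 : ∑ v, ∑ w, (1 / 2 * (volDensity (G y) * τ) * invEntry (G y) v w +
      volDensity (G y) * -∑ a, ∑ b, invEntry (G y) v a * S y (stdVec a) (stdVec b) *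
        invEntry (G y) b w) * C (stdVec v) (stdVec w) =
      1 / 2 * (volDensity (G y) * τ) * ∑ v, ∑ w, invEntry (G y) v w * C (stdVec v) (stdVec w) -
      volDensity (G y) * ∑ v, ∑ w, (∑ a, ∑ b, invEntry (G y) v a * S y (stdVec a) (stdVec b) *
        invEntry (G y) b w) * C (stdVec v) (stdVec w) := by
    rw [Finset.mul_sum, Finset.mul_sum, ← Finset.sum_sub_distrib]
    refine Finset.sum_congr rfl fun v _ => ?_
    rw [Finset.mul_sum, Finset.mul_sum, ← Finset.sum_sub_distrib]
    refine Finset.sum_congr rfl fun w _ => ?_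
    ring
  have e2 : ∑ v, ∑ w, volDensity (G y) * invEntry (G y) v w *
      localHessian G F y (stdVec v) (stdVec w) = volDensity (G y) *
      ∑ v, ∑ w, invEntry (G y) v w * localHessian G F y (stdVec v) (stdVec w) := by
    simp only [Finset.mul_sum, mul_assoc]
  rw [e1, e2]
  ring

end Euler

section TraceAlgebra

variable {V W : Type*} [AddCommGroup V] [Module ℝ V] [TopologicalSpace V] [FiniteDimensional ℝ V]
  [AddCommGroup W] [Module ℝ W] [TopologicalSpace W] [FiniteDimensional ℝ W]

theorem trace_pullForm_comp_pullForm {A : V →L[ℝ] W} {g : W →L[ℝ] W →L[ℝ] ℝ}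
    (hA : A.IsInvertible) (hg : g.IsInvertible) (S C : W →L[ℝ] W →L[ℝ] ℝ) :
    LinearMap.trace ℝ V (((pullForm A g).inverse ∘L pullForm A S) ∘L
      ((pullForm A g).inverse ∘L pullForm A C)).toLinearMap =
      LinearMap.trace ℝ W ((g.inverse ∘L S) ∘L (g.inverse ∘L C)).toLinearMap := by
  rw [pullForm_inverse_comp hA hg, pullForm_inverse_comp hA hg, ← trace_conj_inverse hA]
  congr 2
  ext v
  simp [hA.self_apply_inverse]

end TraceAlgebra

section Pointwise

variable {n : ℕ}

/-- The pointwise content of the field equation: testing with `A = B(u, ·) ⊗ B(u, ·)` determines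
the quadratic form of `C`. -/
theorem eq_smul_of_forall_trace_eq {B C : ModelForm n} (hB : B.IsInvertible)
    (hBs : ∀ v w, B v w = B w v) (hCs : ∀ v w, C v w = C w v)
    (h : ∀ A : ModelForm n, (∀ v w, A v w = A w v) →
      1 / 2 * LinearMap.trace ℝ (Model n) (B.inverse ∘L A).toLinearMap *
          LinearMap.trace ℝ (Model n) (B.inverse ∘L C).toLinearMap
        - LinearMap.trace ℝ (Model n) ((B.inverse ∘L A) ∘L (B.inverse ∘L C)).toLinearMap = 0) :
    C = (1 / 2 * LinearMap.trace ℝ (Model n) (B.inverse ∘L C).toLinearMap) • B := by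
  set τ := LinearMap.trace ℝ (Model n) (B.inverse ∘L C).toLinearMap
  have hq : ∀ u, C u u = 1 / 2 * τ * B u u := by
    intro u
    have h1 := h ((B u).smulRight (B u)) fun v w => by simp [mul_comm]
    have e1 : (B.inverse ∘L (B u).smulRight (B u)).toLinearMap =
        (B u).toLinearMap.smulRight u := by
      ext1 v
      simp [hB.inverse_apply_self]
    have e2 : ((B.inverse ∘L (B u).smulRight (B u)) ∘L (B.inverse ∘L C)).toLinearMap =
        ((B u).toLinearMap ∘ₗ (B.inverse ∘L C).toLinearMap).smulRight u := by
      ext1 v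
      simp [hB.inverse_apply_self]
    rw [e1, e2, LinearMap.trace_smulRight, LinearMap.trace_smulRight] at h1
    have e3 : ((B u).toLinearMap ∘ₗ (B.inverse ∘L C).toLinearMap) u = C u u := by
      simp [hBs u, hB.self_apply_inverse]
    rw [e3] at h1
    have e4 : (B u).toLinearMap u = B u u := rfl
    rw [e4] at h1
    linarith
  ext u v
  have h1 := hq (u + v)
  simp only [map_add, add_apply, hq u, hq v, hCs v u, hBs v u] at h1
  simp only [smul_apply, smul_eq_mul]
  linarith

end Pointwise

section Scalar

variable {n : ℕ} {M : Type*} [TopologicalSpace M] [ChartedSpace (Model n) M]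
  [IsManifold 𝓘(ℝ, Model n) ∞ M]

/-- The tensor `Ric - df ⊗ df`. -/
def reducedRicci (g : TwoTensor n M) (f : SmoothFun n M) (x : M) : TangentForm n x :=
  ricci g x - covectorTensor (differential f x) (differential f x)

/-- The function `e` such that the tensorial part of the first variation of the action in the
direction `(s, h)` is `e dV_g`. -/
def eulerScalar (g : TwoTensor n M) (f : SmoothFun n M) (s : TwoTensor n M) (h : SmoothFun n M)
    (x : M) : ℝ :=
  2 * h x * laplacian g f x + 1 / 2 * metricTrace g x (s x) * metricTrace g x (reducedRicci g f x)
    - LinearMap.trace ℝ (TangentSpace 𝓘(ℝ, Model n) x)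
      (((g x).inverse ∘L s x) ∘L ((g x).inverse ∘L reducedRicci g f x)).toLinearMap

theorem metricTrace_covectorTensor {g : TwoTensor n M} (f : SmoothFun n M) {x : M}
    (hi : (g x).IsInvertible) :
    metricTrace g x (covectorTensor (differential f x) (differential f x)) = gradientSq g f x := by
  have e : ((g x).inverse ∘L covectorTensor (differential f x) (differential f x)).toLinearMap =
      (differential f x).toLinearMap.smulRight (metricGradient g f x) := by
    ext1 v
    simp [covectorTensor, metricGradient]
  rw [metricTrace, e, LinearMap.trace_smulRight, gradientSq]
  conv_rhs => rw [metricGradient, hi.self_apply_inverse]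
  rfl

theorem metricTrace_reducedRicci {g : TwoTensor n M} (f : SmoothFun n M) {x : M}
    (hi : (g x).IsInvertible) :
    metricTrace g x (reducedRicci g f x) = scalarCurvature g x - gradientSq g f x := by
  rw [← metricTrace_covectorTensor f hi, scalarCurvature, metricTrace, metricTrace, metricTrace,
    ← map_sub, reducedRicci]
  congr 1
  ext1 v
  simp

/-- The field equation `Ric - ½ R g = df ⊗ df - ½ |∇f|² g` in terms of `Ric - df ⊗ df`. -/
theorem field_equation_iff {g : TwoTensor n M} (f : SmoothFun n M) {x : M}
    (hi : (g x).IsInvertible) :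
    ricci g x - (1 / 2 * scalarCurvature g x) • g x =
        covectorTensor (differential f x) (differential f x) - (1 / 2 * gradientSq g f x) • g x ↔
      reducedRicci g f x = (1 / 2 * metricTrace g x (reducedRicci g f x)) • g x := by
  rw [metricTrace_reducedRicci f hi, mul_sub, sub_smul, reducedRicci, ← sub_eq_zero,
    ← sub_eq_zero (a := ricci g x - _)]
  refine Eq.congr ?_ rfl
  abel

theorem eulerScalar_eq_zero {g : TwoTensor n M} {f : SmoothFun n M} (s : TwoTensor n M)
    (h : SmoothFun n M) {x : M} (hi : (g x).IsInvertible)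
    (h1 : reducedRicci g f x = (1 / 2 * metricTrace g x (reducedRicci g f x)) • g x)
    (h2 : laplacian g f x = 0) : eulerScalar g f s h x = 0 := by
  have e : (((g x).inverse ∘L s x) ∘L ((g x).inverse ∘L reducedRicci g f x)).toLinearMap =
      (1 / 2 * metricTrace g x (reducedRicci g f x)) • ((g x).inverse ∘L s x).toLinearMap := by
    ext1 v
    have : reducedRicci g f x v = (1 / 2 * metricTrace g x (reducedRicci g f x)) • g x v :=
      congrArg (fun T => T v) h1
    simp [this, hi.inverse_apply_self]
  rw [eulerScalar, e, map_smul, h2, metricTrace, smul_eq_mul]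
  ring

variable {g : TwoTensor n M} (hg : IsSymmTensor g) {p : M} {y : Model n}
  (hy : y ∈ (chartAt (Model n) p).target) (hi : (localMetric g p y).IsInvertible)
include hg hy hi

theorem pullForm_reducedRicci (f : SmoothFun n M) :
    pullForm (chartSymmDeriv p y) (reducedRicci g f ((chartAt (Model n) p).symm y)) =
      localRicci (localMetric g p) y - (fderiv ℝ (f ∘ (chartAt (Model n) p).symm) y).smulRight
        (fderiv ℝ (f ∘ (chartAt (Model n) p).symm) y) := by
  rw [← pullForm_ricci hg hy hi]
  ext v w
  simp [reducedRicci, covectorTensor, differential_chartSymmDeriv hy]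

theorem eulerDensity_eq_eulerScalar (f : SmoothFun n M) {s : TwoTensor n M} (hs : IsSymmTensor s)
    (h : SmoothFun n M) :
    eulerDensity (localMetric g p) (f ∘ (chartAt (Model n) p).symm) (localMetric s p)
        (h ∘ (chartAt (Model n) p).symm) y =
      volDensity (localMetric g p y) * eulerScalar g f s h ((chartAt (Model n) p).symm y) := by
  rw [eulerDensity_eq_trace _ _ _ (localMetric_symm hs p y) (pullForm_reducedRicci hg hy hi f),
    eulerScalar, laplacian, metricTrace_eq hy hi, metricTrace_eq hy hi, metricTrace_eq hy hi,
    pullForm_hessian hg hy hi, ← localMetric_eq s]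
  congr 2
  exact trace_pullForm_comp_pullForm (chartSymmDeriv_isInvertible hy) (metric_isInvertible hy hi)
    _ _

end Scalar

/-! ### The first variation of the action on the manifold -/

section ManifoldVariation

open MeasureTheory

variable {n : ℕ} {M : Type*} [TopologicalSpace M] [ChartedSpace (Model n) M]
  [IsManifold 𝓘(ℝ, Model n) ∞ M]

theorem localMetric_add (s s' : TwoTensor n M) (p : M) :
    localMetric (s + s') p = fun y => localMetric s p y + localMetric s' p y := by
  funext y
  ext v w
  rfl

theorem localMetric_add_smul (g s : TwoTensor n M) (t : ℝ) (p : M) :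
    localMetric (g + t • s) p = fun y => localMetric g p y + t • localMetric s p y := by
  funext y
  ext v w
  rfl

omit [IsManifold 𝓘(ℝ, Model n) ∞ M] in
theorem localFun_add_smul (f h : SmoothFun n M) (t : ℝ) (p : M) :
    (f + t • h : SmoothFun n M) ∘ (chartAt (Model n) p).symm = fun y =>
      (f ∘ (chartAt (Model n) p).symm) y + t * (h ∘ (chartAt (Model n) p).symm) y := rfl

theorem IsSymmTensor.add_smul {g s : TwoTensor n M} (hg : IsSymmTensor g) (hs : IsSymmTensor s)
    (t : ℝ) : IsSymmTensor (g + t • s) := fun x v w => by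
  change g x v w + t * s x v w = g x w v + t * s x w v
  rw [hg x v w, hs x v w]

theorem isVariation_chart {g s : TwoTensor n M} (hg : IsSymmTensor g) (hs : IsSymmTensor s)
    (f h : SmoothFun n M) (p : M) :
    IsVariation (chartAt (Model n) p).target (localMetric g p) (localMetric s p)
      (f ∘ (chartAt (Model n) p).symm) (h ∘ (chartAt (Model n) p).symm) where
  isOpen := (chartAt (Model n) p).open_target
  metric_smooth := contDiffOn_localMetric g p
  tensor_smooth := contDiffOn_localMetric s p
  potential_smooth := contDiffOn_localFun f p
  function_smooth := contDiffOn_localFun h p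
  metric_symm := fun y _ => localMetric_symm hg p y
  tensor_symm := fun y _ => localMetric_symm hs p y

/-- In finite dimension, a non-degenerate form is an isomorphism onto the dual space. -/
theorem IsSemiRiemannian.localMetric_isInvertible {g : TwoTensor n M} (hg : IsSemiRiemannian g)
    {p : M} {y : Model n} (hy : y ∈ (chartAt (Model n) p).target) :
    (localMetric g p y).IsInvertible := by
  have hinj : Function.Injective (localMetric g p y) := by
    rw [injective_iff_map_eq_zero]
    intro v hv
    obtain ⟨A, hA⟩ := chartSymmDeriv_isInvertible hy
    have h0 : chartSymmDeriv p y v = 0 := by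
      refine hg.nondegenerate _ _ fun w => ?_
      have h := congrArg (fun T => T (A.symm w)) hv
      have e : localMetric g p y v (A.symm w) =
          g ((chartAt (Model n) p).symm y) (chartSymmDeriv p y v)
            (chartSymmDeriv p y (A.symm w)) := rfl
      have e2 : chartSymmDeriv p y (A.symm w) = w := by rw [← hA]; exact A.apply_symm_apply w
      rw [← e2, ← e]
      exact h
    rw [← hA] at h0
    exact (A.map_eq_zero_iff).1 h0
  have hrank : Module.finrank ℝ (Model n) = Module.finrank ℝ (Model n →L[ℝ] ℝ) := by
    rw [← (LinearMap.toContinuousLinearMap (𝕜 := ℝ) (E := Model n) (F' := ℝ)).finrank_eq]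
    exact (Subspace.dual_finrank_eq (K := ℝ) (V := Model n)).symm
  have hker : (localMetric g p y).toLinearMap.ker = ⊥ := LinearMap.ker_eq_bot.2 hinj
  exact ⟨(LinearEquiv.ofInjectiveOfFinrankEq (localMetric g p y).toLinearMap hinj
    hrank).toContinuousLinearEquiv, by ext v w; rfl⟩

/-- The tensorial part of the first variation of the action, as a family of functions in charts. -/
def eulerFamily (g : TwoTensor n M) (f : SmoothFun n M) (s : TwoTensor n M) (h : SmoothFun n M)
    (p : M) (y : Model n) : ℝ :=
  eulerDensity (localMetric g p) (f ∘ (chartAt (Model n) p).symm) (localMetric s p)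
    (h ∘ (chartAt (Model n) p).symm) y

/-- The divergence part of the first variation of the action, as a family of functions in charts. -/
def divergenceFamily (g : TwoTensor n M) (f : SmoothFun n M) (s : TwoTensor n M)
    (h : SmoothFun n M) (p : M) (y : Model n) : ℝ :=
  divergenceDensity (localMetric g p) (f ∘ (chartAt (Model n) p).symm) (localMetric s p)
    (h ∘ (chartAt (Model n) p).symm) y

section Density

variable {g : TwoTensor n M} (hg : IsSemiRiemannian g) (f : SmoothFun n M) {s : TwoTensor n M}
  (hs : IsSymmTensor s) (h : SmoothFun n M)
include hg hs

/-- The tensorial part is the density `e dV_g` with the function `e = eulerScalar g f s h`. -/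
theorem isDensity_eulerFamily : IsDensity (eulerFamily g f s h) where
  continuousOn := fun p _ hy =>
    ((isVariation_chart hg.symm hs f h p).continuousAt_eulerDensity
      (mem_regularSet_zero hy (hg.localMetric_isInvertible hy))).continuousWithinAt
  jacobian := fun p q y hy => by
    have hy' := (transition_mem hy).1
    rw [eulerFamily, eulerFamily,
      eulerDensity_eq_eulerScalar hg.symm hy.1 (hg.localMetric_isInvertible hy.1) f hs h,
      eulerDensity_eq_eulerScalar hg.symm hy' (hg.localMetric_isInvertible hy') f hs h,
      symm_transition hy, localMetric_transition g hy, volDensity_pullForm, mul_assoc]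

/-- The full first variation is a density, being the derivative of a family of densities. -/
theorem isDensity_variation :
    IsDensity fun p y => eulerFamily g f s h p y + divergenceFamily g f s h p y where
  continuousOn := fun p _ hy =>
    ((isVariation_chart hg.symm hs f h p).continuousAt_variation
      (mem_regularSet_zero hy (hg.localMetric_isInvertible hy))).continuousWithinAt
  jacobian := fun p q y hy => by
    have hV := isVariation_chart hg.symm hs f h p
    have hy' := (transition_mem hy).1
    have hr := mem_regularSet_zero (S := localMetric s p) hy.1 (hg.localMetric_isInvertible hy.1)
    have h1 := hV.hasDerivAt_localDensity hr
    have h2 := ((isVariation_chart hg.symm hs f h q).hasDerivAt_localDensity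
      (mem_regularSet_zero hy' (hg.localMetric_isInvertible hy'))).const_mul
        |(fderiv ℝ (transition p q) y).det|
    refine h1.unique (h2.congr_of_eventuallyEq ?_)
    filter_upwards [hV.eventually_time hr] with t ht
    have key := localDensity_transition (hg.symm.add_smul hs t) (f + t • h) hy
      (by rw [localMetric_add_smul]; exact ht.2)
    rw [localMetric_add_smul, localMetric_add_smul, localFun_add_smul, localFun_add_smul] at key
    exact key

/-- The divergence part is a density, being the difference of two densities. -/
theorem isDensity_divergenceFamily : IsDensity (divergenceFamily g f s h) where
  continuousOn := fun p _ hy =>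
    ((isVariation_chart hg.symm hs f h p).continuousAt_divergenceDensity
      (mem_regularSet_zero hy (hg.localMetric_isInvertible hy))).continuousWithinAt
  jacobian := fun p q y hy => by
    have h1 := (isDensity_variation hg f hs h).jacobian p q y hy
    have h2 := (isDensity_eulerFamily hg f hs h).jacobian p q y hy
    rw [h2, mul_add] at h1
    exact add_left_cancel h1

end Density

section Support

variable {s : TwoTensor n M} {h : SmoothFun n M} {K : Set M} (hK : IsClosed K)
  (hs0 : ∀ x ∉ K, s x = 0) (hh0 : ∀ x ∉ K, h x = 0) {p : M} {y : Model n}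
  (hy : y ∈ (chartAt (Model n) p).target) (hyK : (chartAt (Model n) p).symm y ∉ K)
include hK hy hyK

omit [IsManifold 𝓘(ℝ, Model n) ∞ M] in
theorem eventually_symm_notMem : ∀ᶠ z in nhds y, (chartAt (Model n) p).symm z ∉ K := by
  filter_upwards [((chartAt (Model n) p).isOpen_inter_preimage_symm hK.isOpen_compl).mem_nhds
    ⟨hy, hyK⟩] with z hz using hz.2

include hs0 in
theorem localMetric_eventuallyEq_zero : localMetric s p =ᶠ[nhds y] 0 := by
  filter_upwards [eventually_symm_notMem hK hy hyK] with z hz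
  ext v w
  change s _ _ _ = 0
  rw [hs0 _ hz]
  rfl

include hh0 in
omit [IsManifold 𝓘(ℝ, Model n) ∞ M] in
theorem localFun_eventuallyEq_zero : h ∘ (chartAt (Model n) p).symm =ᶠ[nhds y] 0 := by
  filter_upwards [eventually_symm_notMem hK hy hyK] with z hz
  exact hh0 _ hz

end Support

variable [CompactSpace M] [T2Space M]

/-- The divergence part integrates to zero if the variation is supported in one chart. -/
theorem integralDensity_divergenceFamily_of_support {g : TwoTensor n M} (hg : IsSemiRiemannian g)
    (f : SmoothFun n M) {s : TwoTensor n M} (hs : IsSymmTensor s) (h : SmoothFun n M) (q : M)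
    {K : Set M} (hK : IsClosed K) (hKq : K ⊆ (chartAt (Model n) q).source)
    (hs0 : ∀ x ∉ K, s x = 0) (hh0 : ∀ x ∉ K, h x = 0) :
    integralDensity (divergenceFamily g f s h) = 0 := by
  rw [(isDensity_divergenceFamily hg f hs h).integralDensity_eq_of_support q hK.isCompact hKq
    fun p y hy hyK => divergenceDensity_eq_zero _ _ (localMetric_eventuallyEq_zero hK hs0 hy hyK)
      (localFun_eventuallyEq_zero hK hh0 hy hyK)]
  refine integral_sum_fderiv_eq_zero (chartAt (Model n) q).open_target (fun k y hy => ?_)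
    (isCompact_chart_image hK.isCompact hKq) (chart_image_subset_target hKq) fun k y hy hyK => ?_
  · exact ((isVariation_chart hg.symm hs f h q).contDiffAt_boundaryField
      (mem_regularSet_zero hy (hg.localMetric_isInvertible hy)) k).contDiffWithinAt
  · have hyK' : (chartAt (Model n) q).symm y ∉ K := fun h => hyK (mem_chart_image hy h)
    exact boundaryField_eq_zero _ _ (localMetric_eventuallyEq_zero hK hs0 hy hyK')
      (localFun_eventuallyEq_zero hK hh0 hy hyK') k

/-- The product of a function and a tensor field. -/
def mulTensor (ρ : SmoothFun n M) (s : TwoTensor n M) : TwoTensor n M :=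
  ⟨fun x => ρ x • s x, ρ.contMDiff.smul_section s.contMDiff⟩

theorem integralDensity_divergenceFamily_sum {g : TwoTensor n M} (hg : IsSemiRiemannian g)
    (f : SmoothFun n M) {s : TwoTensor n M} (hs : IsSymmTensor s) (h : SmoothFun n M)
    (T : Finset M) :
    IsSymmTensor (∑ q ∈ T, mulTensor (chartPartition n M q) s) ∧
      integralDensity (divergenceFamily g f (∑ q ∈ T, mulTensor (chartPartition n M q) s)
        (∑ q ∈ T, chartPartition n M q * h)) = 0 := by
  classical
  induction T using Finset.induction_on with
  | empty =>
    refine ⟨fun x v w => rfl, ?_⟩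
    refine Finset.sum_eq_zero fun p _ => ?_
    refine (setIntegral_congr_fun (g := fun _ => (0 : ℝ))
      (chartAt (Model n) p).open_target.measurableSet fun y hy => ?_).trans (by simp)
    have : divergenceFamily g f (0 : TwoTensor n M) (0 : SmoothFun n M) p y = 0 :=
      divergenceDensity_eq_zero _ _
        (localMetric_eventuallyEq_zero isClosed_empty (fun _ _ => rfl) hy (by simp))
        (localFun_eventuallyEq_zero isClosed_empty (fun _ _ => rfl) hy (by simp))
    simp only [Finset.sum_empty, this, mul_zero]
  | insert q T hq ih =>
    have hsq : IsSymmTensor (mulTensor (chartPartition n M q) s) := fun x v w => by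
      change chartPartition n M q x * s x v w = chartPartition n M q x * s x w v
      rw [hs x v w]
    have hK : ∀ x ∉ tsupport (chartPartition n M q), chartPartition n M q x = 0 := fun x hx =>
      image_eq_zero_of_notMem_tsupport hx
    have h1 := integralDensity_divergenceFamily_of_support hg f hsq (chartPartition n M q * h) q
      (isClosed_tsupport _) (tsupport_chartPartition_subset q)
      (fun x hx => by change chartPartition n M q x • s x = 0; rw [hK x hx, zero_smul])
      (fun x hx => by change chartPartition n M q x * h x = 0; rw [hK x hx, zero_mul])
    rw [Finset.sum_insert hq, Finset.sum_insert hq]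
    refine ⟨fun x v w => ?_, ?_⟩
    · exact congrArg₂ (· + ·) (hsq x v w) (ih.1 x v w)
    · have e := integralDensity_add (isDensity_divergenceFamily hg f hsq (chartPartition n M q * h))
        (isDensity_divergenceFamily hg f ih.1 (∑ q ∈ T, chartPartition n M q * h))
      rw [h1, ih.2, add_zero] at e
      rw [← e]
      refine integralDensity_congr fun p y hy => ?_
      have key := divergenceDensity_add (isVariation_chart hg.symm hsq f (chartPartition n M q * h) p)
        (isVariation_chart hg.symm ih.1 f (∑ q ∈ T, chartPartition n M q * h) p) hy
        (hg.localMetric_isInvertible hy)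
      rw [← localMetric_add] at key
      exact key

/-- The divergence part of the first variation integrates to zero: it is linear in the variation,
which a partition of unity decomposes into variations supported in one chart. -/
theorem integralDensity_divergenceFamily {g : TwoTensor n M} (hg : IsSemiRiemannian g)
    (f : SmoothFun n M) {s : TwoTensor n M} (hs : IsSymmTensor s) (h : SmoothFun n M) :
    integralDensity (divergenceFamily g f s h) = 0 := by
  have e1 : ∑ q ∈ chartIndex n M, mulTensor (chartPartition n M q) s = s := by
    ext1 x
    have e := congrFun (map_sum (ContMDiffSection.coeAddHom 𝓘(ℝ, Model n) (ModelForm n) ∞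
      (fun x : M => TangentForm n x)) (fun q => mulTensor (chartPartition n M q) s)
      (chartIndex n M)) x
    rw [Finset.sum_apply] at e
    refine e.trans ?_
    change ∑ q ∈ chartIndex n M, chartPartition n M q x • s x = s x
    rw [← Finset.sum_smul, sum_chartPartition, one_smul]
  have e2 : ∑ q ∈ chartIndex n M, chartPartition n M q * h = h := by
    rw [← Finset.sum_mul]
    ext1 x
    have e := congrFun (map_sum (ContMDiffMap.coeFnAddMonoidHom (I := 𝓘(ℝ, Model n)) (N := M)
      (I' := 𝓘(ℝ)) (G := ℝ) (n := ∞)) (fun q => chartPartition n M q) (chartIndex n M)) x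
    rw [Finset.sum_apply] at e
    have e' : (∑ q ∈ chartIndex n M, chartPartition n M q : SmoothFun n M) x = 1 :=
      e.trans (sum_chartPartition x)
    change (∑ q ∈ chartIndex n M, chartPartition n M q : SmoothFun n M) x * h x = h x
    rw [e', one_mul]
  have := (integralDensity_divergenceFamily_sum hg f hs h (chartIndex n M)).2
  rwa [e1, e2] at this

/-- The action as a sum of integrals of local densities. -/
theorem hilbertAction_eq_sum (o : ManifoldOrientation n M) {g : TwoTensor n M}
    (hg : IsSymmTensor g) (f : SmoothFun n M)
    (hi : ∀ p ∈ chartIndex n M, ∀ y ∈ chartSupport p, (localMetric g p y).IsInvertible) :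
    hilbertAction o g f = ∑ p ∈ chartIndex n M, ∫ y in (chartAt (Model n) p).target,
      chartWeight p y * localDensity (localMetric g p) (f ∘ (chartAt (Model n) p).symm) y := by
  rw [hilbertAction, integralForm, finsum_eq_sum_of_support_subset (s := chartIndex n M)]
  · refine Finset.sum_congr rfl fun p hp =>
      setIntegral_congr_fun (chartAt (Model n) p).open_target.measurableSet fun y hy => ?_
    by_cases hyK : y ∈ chartSupport p
    · have := integrand_eq_localDensity hg hy (hi p hp y hyK) o f
      exact congrArg (chartWeight p y * ·) this
    · have h0 := chartWeight_eq_zero hy hyK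
      have h0' : chartPartition n M p ((chartAt (Model n) p).symm y) = 0 := h0
      simp only [h0, h0', zero_mul]
  · intro p hp
    by_contra h
    refine hp ?_
    simp only [chartPartition_eq_zero h, zero_mul, integral_zero]

theorem eventually_localMetric_isInvertible {g : TwoTensor n M} (hg : IsSemiRiemannian g)
    {s : TwoTensor n M} (hs : IsSymmTensor s) :
    ∀ᶠ t in nhds (0 : ℝ), ∀ p ∈ chartIndex n M, ∀ y ∈ chartSupport p,
      (localMetric (g + t • s) p y).IsInvertible := by
  refine (Filter.eventually_all_finset _).2 fun p _ => ?_
  obtain ⟨ε, hε, hsub⟩ := (isVariation_chart hg.symm hs 0 0 p).exists_closedBall_prod_subset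
    (isCompact_chartSupport p) (chartSupport_subset p)
    fun y hy => hg.localMetric_isInvertible (chartSupport_subset p hy)
  refine Filter.eventually_of_mem (Metric.closedBall_mem_nhds (0 : ℝ) hε) fun t ht y hy => ?_
  rw [localMetric_add_smul]
  exact (hsub (Set.mk_mem_prod ht hy)).2

/-- The first variation of the action is the integral of its tensorial part. -/
theorem hasDerivAt_hilbertAction (o : ManifoldOrientation n M) {g : TwoTensor n M}
    (hg : IsSemiRiemannian g) (f : SmoothFun n M) {s : TwoTensor n M} (hs : IsSymmTensor s)
    (h : SmoothFun n M) :
    HasDerivAt (fun t : ℝ => hilbertAction o (g + t • s) (f + t • h))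
      (integralDensity (eulerFamily g f s h)) 0 := by
  have e : integralDensity (eulerFamily g f s h) = integralDensity fun p y =>
      eulerFamily g f s h p y + divergenceFamily g f s h p y := by
    rw [integralDensity_add (isDensity_eulerFamily hg f hs h)
      (isDensity_divergenceFamily hg f hs h), integralDensity_divergenceFamily hg f hs h, add_zero]
  rw [e]
  have hder : HasDerivAt (fun t : ℝ => ∑ p ∈ chartIndex n M, ∫ y in (chartAt (Model n) p).target,
      chartWeight p y * localDensity (fun y => localMetric g p y + t • localMetric s p y)
        (fun y => (f ∘ (chartAt (Model n) p).symm) y + t * (h ∘ (chartAt (Model n) p).symm) y) y)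
      (integralDensity fun p y => eulerFamily g f s h p y + divergenceFamily g f s h p y) 0 :=
    HasDerivAt.fun_sum fun p _ => (isVariation_chart hg.symm hs f h p).hasDerivAt_integral
      (continuousOn_partition_chart p p) (isCompact_chartSupport p) (chartSupport_subset p)
      (fun y hy hyK => chartWeight_eq_zero hy hyK)
      fun y hy => hg.localMetric_isInvertible (chartSupport_subset p hy)
  refine hder.congr_of_eventuallyEq ?_
  filter_upwards [eventually_localMetric_isInvertible hg hs] with t ht
  rw [hilbertAction_eq_sum o (hg.symm.add_smul hs t) (f + t • h) ht]
  refine Finset.sum_congr rfl fun p _ => ?_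
  rw [localMetric_add_smul, localFun_add_smul]

end ManifoldVariation

/-! ### Test variations -/

section TestVariation

open MeasureTheory

variable {n : ℕ} {M : Type*} [TopologicalSpace M] [ChartedSpace (Model n) M]

/-- The function on `M` given by `χ` in the chart at `q`, and by zero outside its domain. -/
def chartBump (q : M) (χ : Model n → ℝ) : M → ℝ :=
  (chartAt (Model n) q).source.indicator (χ ∘ chartAt (Model n) q)

theorem chartBump_symm {q : M} (χ : Model n → ℝ) {y : Model n}
    (hy : y ∈ (chartAt (Model n) q).target) :
    chartBump q χ ((chartAt (Model n) q).symm y) = χ y := by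
  rw [chartBump, Set.indicator_of_mem ((chartAt (Model n) q).map_target hy), Function.comp_apply,
    (chartAt (Model n) q).right_inv hy]

theorem chartBump_eq_zero {q : M} {χ : Model n → ℝ} {x : M}
    (hx : x ∉ (chartAt (Model n) q).symm '' tsupport χ) : chartBump q χ x = 0 := by
  by_cases hs : x ∈ (chartAt (Model n) q).source
  · rw [chartBump, Set.indicator_of_mem hs, Function.comp_apply]
    refine image_eq_zero_of_notMem_tsupport fun h => hx ⟨_, h, ?_⟩
    exact (chartAt (Model n) q).left_inv hs
  · rw [chartBump, Set.indicator_of_notMem hs]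

variable {q : M} {χ : Model n → ℝ} (hχ : ContDiff ℝ ∞ χ) (hc : HasCompactSupport χ)
  (ht : tsupport χ ⊆ (chartAt (Model n) q).target)

include ht in
theorem symm_image_tsupport_subset :
    (chartAt (Model n) q).symm '' tsupport χ ⊆ (chartAt (Model n) q).source := by
  rintro _ ⟨y, hy, rfl⟩
  exact (chartAt (Model n) q).map_target (ht hy)

variable [T2Space M]

include hc ht

theorem isClosed_symm_image_tsupport : IsClosed ((chartAt (Model n) q).symm '' tsupport χ) :=
  (hc.isCompact.image_of_continuousOn ((chartAt (Model n) q).continuousOn_symm.mono ht)).isClosed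

theorem tsupport_chartBump_subset :
    tsupport (chartBump q χ) ⊆ (chartAt (Model n) q).source := by
  refine (closure_minimal (fun x hx => ?_) (isClosed_symm_image_tsupport hc ht)).trans
    (symm_image_tsupport_subset ht)
  by_contra h
  exact hx (chartBump_eq_zero h)

variable [IsManifold 𝓘(ℝ, Model n) ∞ M]

include hχ

theorem contMDiff_chartBump : ContMDiff 𝓘(ℝ, Model n) 𝓘(ℝ) ∞ (chartBump q χ) := by
  refine contMDiff_of_tsupport fun x hx => ?_
  have hs := tsupport_chartBump_subset hc ht hx
  have h : ContMDiffAt 𝓘(ℝ, Model n) 𝓘(ℝ) ∞ (χ ∘ chartAt (Model n) q) x :=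
    hχ.contMDiff.contMDiffAt.comp x ((contMDiffOn_chart (I := 𝓘(ℝ, Model n))).contMDiffAt
      ((chartAt (Model n) q).open_source.mem_nhds hs))
  refine h.congr_of_eventuallyEq ?_
  filter_upwards [(chartAt (Model n) q).open_source.mem_nhds hs] with z hz
    using Set.indicator_of_mem hz _

/-- The function which is `c χ` in the chart at `q`. -/
def testFun (c : ℝ) : SmoothFun n M :=
  ⟨fun x => chartBump q χ x * c, (contMDiff_chartBump hχ hc ht).mul contMDiff_const⟩

/-- The tensor field with components `χ A` in the chart at `q`. -/
def testTensor (A : ModelForm n) : TwoTensor n M :=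
  ⟨chartBump q χ • fun x => pullForm (chartDeriv q x) A,
    ContMDiffOn.smul_section_of_tsupport (contMDiff_chartBump hχ hc ht).contMDiffOn
      (chartAt (Model n) q).open_source (tsupport_chartBump_subset hc ht)
      (contMDiffOn_constForm q A)⟩

theorem testTensor_apply (A : ModelForm n) (x : M) :
    testTensor hχ hc ht A x = chartBump q χ x • pullForm (chartDeriv q x) A := rfl

theorem testFun_apply (c : ℝ) (x : M) : testFun hχ hc ht c x = chartBump q χ x * c := rfl

theorem isSymmTensor_testTensor {A : ModelForm n} (hA : ∀ v w, A v w = A w v) :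
    IsSymmTensor (testTensor hχ hc ht A) := fun x v w =>
  congrArg (chartBump q χ x * ·) (hA (chartDeriv q x v) (chartDeriv q x w))

theorem localMetric_testTensor (A : ModelForm n) {y : Model n}
    (hy : y ∈ (chartAt (Model n) q).target) :
    localMetric (testTensor hχ hc ht A) q y = χ y • A := by
  rw [localMetric_eq, testTensor_apply, chartBump_symm χ hy]
  ext v w
  have h : ∀ v, chartDeriv q ((chartAt (Model n) q).symm y) (chartSymmDeriv q y v) = v := fun v =>
    congrArg (fun T => T v) (chartDeriv_comp_chartSymmDeriv_self hy)
  simp [h]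

end TestVariation

/-! ### Critical points -/

section Necessity

open MeasureTheory

variable {n : ℕ}

/-- No derivatives of the variation enter the tensorial part, so that it is homogeneous under
multiplication by functions. -/
theorem eulerDensity_smul (G : Model n → ModelForm n) (F : Model n → ℝ)
    {S : Model n → ModelForm n} {H : Model n → ℝ} {y : Model n} {r c : ℝ} {A : ModelForm n}
    (hS : S y = r • A) (hH : H y = r * c) :
    eulerDensity G F S H y = r * eulerDensity G F (fun _ => A) (fun _ => c) y := by
  have hi : ∀ k l, inverseVar G S y k l = r * inverseVar G (fun _ => A) y k l := fun k l => by
    simp only [inverseVar, hS, smul_apply, smul_eq_mul, Finset.mul_sum, mul_neg]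
    refine congrArg _ (Finset.sum_congr rfl fun a _ => Finset.sum_congr rfl fun b _ => ?_)
    ring
  have hd : ∀ k l, densityVar G S y k l = r * densityVar G (fun _ => A) y k l := fun k l => by
    have e : ∑ a, ∑ b, invEntry (G y) a b * (r * A (stdVec a) (stdVec b)) =
        r * ∑ a, ∑ b, invEntry (G y) a b * A (stdVec a) (stdVec b) := by
      simp only [Finset.mul_sum]
      refine Finset.sum_congr rfl fun a _ => Finset.sum_congr rfl fun b _ => ?_
      ring
    simp only [densityVar, hi, hS, smul_apply, smul_eq_mul, e]
    ring
  simp only [eulerDensity, hd, hH, mul_assoc r, ← Finset.mul_sum]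
  ring

variable {M : Type*} [TopologicalSpace M] [ChartedSpace (Model n) M]
  [IsManifold 𝓘(ℝ, Model n) ∞ M] [CompactSpace M] [T2Space M]

/-- At a critical point, the tensorial part of the first variation vanishes in each direction. -/
theorem IsCriticalPoint.eulerDensity_eq_zero {o : ManifoldOrientation n M} {g : TwoTensor n M}
    (hg : IsSemiRiemannian g) {f : SmoothFun n M} (hcrit : IsCriticalPoint o g f) {q : M}
    {y : Model n} (hy : y ∈ (chartAt (Model n) q).target) {A : ModelForm n}
    (hA : ∀ v w, A v w = A w v) (c : ℝ) :
    eulerDensity (localMetric g q) (f ∘ (chartAt (Model n) q).symm) (fun _ => A) (fun _ => c) y =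
      0 := by
  have hU := (chartAt (Model n) q).open_target
  have hV : IsVariation (chartAt (Model n) q).target (localMetric g q) (fun _ => A)
      (f ∘ (chartAt (Model n) q).symm) (fun _ => c) :=
    { isOpen := hU
      metric_smooth := contDiffOn_localMetric g q
      tensor_smooth := contDiffOn_const
      potential_smooth := contDiffOn_localFun f q
      function_smooth := contDiffOn_const
      metric_symm := fun y _ => localMetric_symm hg.symm q y
      tensor_symm := fun _ _ => hA }
  set b := eulerDensity (localMetric g q) (f ∘ (chartAt (Model n) q).symm) (fun _ => A) (fun _ => c)
  have hb : ContinuousOn b (chartAt (Model n) q).target := fun z hz =>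
    (hV.continuousAt_eulerDensity
      (mem_regularSet_zero hz (hg.localMetric_isInvertible hz))).continuousWithinAt
  have hae := hU.ae_eq_zero_of_integral_contDiff_smul_eq_zero (μ := volume)
    (hb.locallyIntegrableOn hU.measurableSet) fun χ hχ hc ht => by
      have hs := isSymmTensor_testTensor hχ hc ht hA
      have h0 : integralDensity (eulerFamily g f (testTensor hχ hc ht A) (testFun hχ hc ht c)) = 0 :=
        (hasDerivAt_hilbertAction o hg f hs _).unique (hcrit _ hs _)
      rw [(isDensity_eulerFamily hg f hs _).integralDensity_eq_of_support q
        (isClosed_symm_image_tsupport hc ht).isCompact (symm_image_tsupport_subset ht)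
        fun p y hy hyK => ?_] at h0
      · rw [← h0, ← setIntegral_eq_integral_of_forall_compl_eq_zero
          (s := (chartAt (Model n) q).target)]
        · refine setIntegral_congr_fun hU.measurableSet fun z hz => ?_
          exact (eulerDensity_smul _ _ (localMetric_testTensor hχ hc ht A hz)
            (congrArg (· * c) (chartBump_symm χ hz))).symm
        · intro z hz
          rw [image_eq_zero_of_notMem_tsupport fun h => hz (ht h), zero_smul]
      -- Off the support of the test variation both of its components vanish.
      · have hz := chartBump_eq_zero hyK
        refine (eulerDensity_smul (r := 0) (A := 0) (c := 0) _ _ ?_ ?_).trans (zero_mul _)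
        · rw [localMetric_eq, testTensor_apply, hz]
          ext v w
          simp
        · rw [Function.comp_apply, testFun_apply, hz, zero_mul, zero_mul]
  have h := Measure.eqOn_open_of_ae_eq (μ := volume) (f := b) (g := 0)
    ((ae_restrict_iff' hU.measurableSet).2 hae) hU hb continuousOn_const
  exact h hy

theorem pullForm_injective {V W : Type*} [AddCommGroup V] [Module ℝ V] [TopologicalSpace V]
    [AddCommGroup W] [Module ℝ W] [TopologicalSpace W] {A : V →L[ℝ] W} (hA : A.IsInvertible) :
    Function.Injective (pullForm A) := fun B C h => by
  ext v w
  have := congrArg (fun T => T (A.inverse v) (A.inverse w)) h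
  simpa [hA.self_apply_inverse] using this

variable {o : ManifoldOrientation n M} {g : TwoTensor n M} (hg : IsSemiRiemannian g)
  {f : SmoothFun n M} (hcrit : IsCriticalPoint o g f) (x : M)
include hg hcrit

/-- Testing with the function `1` and no variation of the metric. -/
theorem IsCriticalPoint.laplacian_eq_zero : laplacian g f x = 0 := by
  have key : ∀ y ∈ (chartAt (Model n) x).target,
      laplacian g f ((chartAt (Model n) x).symm y) = 0 := by
    intro y hy
    have hi := hg.localMetric_isInvertible hy
    have h := hcrit.eulerDensity_eq_zero hg hy (A := 0) (fun _ _ => rfl) 1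
    rw [eulerDensity_eq_trace _ _ _ (fun _ _ => rfl) rfl] at h
    have hv := volDensity_pos hi (localMetric_symm hg.symm x y)
    rw [laplacian, metricTrace_eq hy hi, pullForm_hessian hg.symm hy hi]
    simpa [hv.ne'] using h
  have h := key _ (mem_chart_target (Model n) x)
  rwa [(chartAt (Model n) x).left_inv (mem_chart_source (Model n) x)] at h

theorem IsCriticalPoint.reducedRicci_eq :
    reducedRicci g f x = (1 / 2 * metricTrace g x (reducedRicci g f x)) • g x := by
  have key : ∀ y ∈ (chartAt (Model n) x).target, ∀ z, z = (chartAt (Model n) x).symm y →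
      reducedRicci g f z = (1 / 2 * metricTrace g z (reducedRicci g f z)) • g z := by
    rintro y hy z rfl
    have hi := hg.localMetric_isInvertible hy
    have hsymm := localMetric_symm hg.symm x y
    have hC := pullForm_reducedRicci hg.symm hy hi f
    have h := eq_smul_of_forall_trace_eq hi hsymm
      (C := pullForm (chartSymmDeriv x y) (reducedRicci g f ((chartAt (Model n) x).symm y)))
      (fun v w => by
        have hr := (isVariation_chart hg.symm hg.symm f f x).localRicci_symm
          (mem_regularSet_zero hy hi) v w
        rw [hC]
        simp [hr, mul_comm])
      (fun A hA => by
        have h := hcrit.eulerDensity_eq_zero hg hy hA 0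
        rw [eulerDensity_eq_trace _ _ _ hA hC] at h
        have hv := volDensity_pos hi hsymm
        simpa [hv.ne'] using h)
    rw [← metricTrace_eq hy hi] at h
    refine pullForm_injective (chartSymmDeriv_isInvertible hy) (h.trans ?_)
    rw [localMetric_eq]
    ext v w
    simp
  exact key _ (mem_chart_target (Model n) x) x
    ((chartAt (Model n) x).left_inv (mem_chart_source (Model n) x)).symm

end Necessity

section Characterization

variable {n : ℕ} {M : Type*} [TopologicalSpace M] [ChartedSpace (Model n) M]
  [IsManifold 𝓘(ℝ, Model n) ∞ M]

theorem IsSemiRiemannian.isInvertible {g : TwoTensor n M} (hg : IsSemiRiemannian g) (x : M) :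
    (g x).IsInvertible := by
  have hy := mem_chart_target (Model n) x
  have h := metric_isInvertible hy (hg.localMetric_isInvertible hy)
  rwa [(chartAt (Model n) x).left_inv (mem_chart_source (Model n) x)] at h

variable [CompactSpace M] [T2Space M]

/-- The characterization of critical points, with the field equation for the metric solved for
`Ric - df ⊗ df`. -/
theorem isCriticalPoint_iff (o : ManifoldOrientation n M) {g : TwoTensor n M}
    (hg : IsSemiRiemannian g) (f : SmoothFun n M) :
    IsCriticalPoint o g f ↔
      (∀ x, reducedRicci g f x = (1 / 2 * metricTrace g x (reducedRicci g f x)) • g x) ∧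
        ∀ x, laplacian g f x = 0 := by
  refine ⟨fun h => ⟨h.reducedRicci_eq hg, h.laplacian_eq_zero hg⟩, fun ⟨h1, h2⟩ s hs h => ?_⟩
  have e : integralDensity (eulerFamily g f s h) = 0 := by
    refine Finset.sum_eq_zero fun p _ => ?_
    refine (MeasureTheory.setIntegral_congr_fun (g := fun _ => (0 : ℝ))
      (chartAt (Model n) p).open_target.measurableSet fun y hy => ?_).trans (by simp)
    simp only [eulerFamily]
    rw [eulerDensity_eq_eulerScalar hg.symm hy (hg.localMetric_isInvertible hy) f hs h,
      eulerScalar_eq_zero s h (hg.isInvertible _) (h1 _) (h2 _), mul_zero, mul_zero]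
  simpa only [e] using hasDerivAt_hilbertAction o hg f hs h

end Characterization

end BakryEmery

end

theorem mainTheorem1 {n : ℕ} (hn : 2 ≤ n) {M : Type*} [TopologicalSpace M]
    [ChartedSpace (BakryEmery.Model n) M] [IsManifold 𝓘(ℝ, BakryEmery.Model n) ∞ M]
    [CompactSpace M] [T2Space M] (o : BakryEmery.ManifoldOrientation n M)
    (g : BakryEmery.TwoTensor n M) (hg : BakryEmery.IsSemiRiemannian g)
    (f : BakryEmery.SmoothFun n M) :
    BakryEmery.IsCriticalPoint o g f ↔
      (∀ x : M,
        BakryEmery.ricci g x - (1 / 2 * BakryEmery.scalarCurvature g x) • g x =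
          BakryEmery.covectorTensor (BakryEmery.differential f x) (BakryEmery.differential f x) -
            (1 / 2 * BakryEmery.gradientSq g f x) • g x) ∧
      ∀ x : M, BakryEmery.laplacian g f x = 0 := by
  rw [BakryEmery.isCriticalPoint_iff o hg f]
  exact and_congr_left' (forall_congr' fun x =>
    (BakryEmery.field_equation_iff f (hg.isInvertible x)).symm)
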